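/- Let $k\ge 2$ and $p>0$ be coprime integers, let $A\ge 0$, and let \[ F(z)=z^{p}e^{Az^{k}}\,\frac{\prod_{\nu=1}^{\omega_1}\bigl(1+z^k/a_\nu\bigr)}{\prod_{\mu=1}^{\omega_2}\bigl(1-z^k/b_\mu\bigr)},\qquad F(z)\not\equiv z^{p}, \] where $0\le\omega_1,\omega_2\le+\infty$, all $a_\nu,b_\mu$ are positive, and $\sum_\nu 1/a_\nu<\infty$, $\sum_\mu 1/b_\mu<\infty$. Write $e_j=\exp(i\pi j/k)$ and, for $j\in\mathbb Z$, \[ Q_j=\{z\ne 0: 0<\operatorname{Arg}(ze_{-j})<\pi/k\},\qquad \widetilde Q_j=\{z\ne 0: 0\le\operatorname{Arg}(ze_{-j})<\pi/k\}, \] where $-\pi<\operatorname{Arg}\le\pi$. For a complex number $u$, "$u>0$" and "$u<0$" mean that $u$ is real and positive, respectively negative. An $\alpha$-point of $F$ is a solution of $F(z)=\alpha$; its multiplicity is the least $n\ge1$ with $F^{(n)}(z)\ne0$, and it is simple if $n=1$ and double if $n=2$. Let $\alpha\ne 0$ be a complex number such that $F$ has at least one $\alpha$-point. Let $q\in\mathbb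 Z$ and $\varkappa\in\{0,1\}$ be such that $\alpha\in\widetilde Q_{2q-\varkappa}$, and let $m\in\mathbb Z$ satisfy $pm\equiv q\pmod k$. Then the following holds. 1. Suppose that $\alpha^k<0$ fails. Then there is an $\alpha$-point $z_*$ of $F$ that is simple and strictly closer to the origin than every other $\alpha$-point, and whose argument differs from that of each immediately succeeding $\alpha$-point (each $\alpha$-point whose absolute value is the smallest one greater than $|z_*|$ among absolute values of $\alpha$-points). If $\alpha\in Q_{2q-\varkappa}$, then $z_*\in Q_{2m-\varkappa}$. If $\alpha e_{-2q}>0$, then $z_*e_{-2m}>0$. 2. The condition $\alpha^k<0$ is equivalent to $\alpha e_{-2q+1}>0$. Suppose that it holds, and let $\widetilde m\in\mathbb Z$ satisfy $p\widetilde m\equiv q-1\pmod k$. Then $Q_{2\widetilde m}=Q_{-2m-2s}$ for every integer $s$ with $\operatorname{Im}(\alpha e_{ps})=0$, and one of the following two cases occurs: (i) there are two distinct simple $\alpha$-points $z_0\in Q_{2m-1}$ and $z_1\in Q_{2\widetilde m}$ with $|z_0|=|z_1|$, and every other $\alpha$-point has a strictly greater absolute value; (ii) $p=1$, and the two $\alpha$-points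 closest to the origin, counted with multiplicity, lie on the ray $\{z: ze_{-2m+1}>0\}$: either there is a double $\alpha$-point $z_0=z_1$ on this ray, or there are two simple $\alpha$-points $z_0,z_1$ on it with $|z_0|<|z_1|$; in both cases every other $\alpha$-point has absolute value strictly greater than $|z_1|$. -/

import Mathlib

open scoped ComplexOrder

noncomputable section

/-- `e_m = exp(i m π / k)`. -/
def unitExp (k : ℕ) (m : ℤ) : ℂ :=
  Complex.exp (((m : ℝ) / (k : ℝ) * Real.pi : ℝ) * Complex.I)

/-- The open sector `Q_s = {z ≠ 0 : 0 < Arg (z e_{-s}) < π / k}`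
(`Complex.arg` is the principal argument, with values in `(-π, π]`). -/
def openSector (k : ℕ) (s : ℤ) : Set ℂ :=
  {z | z ≠ 0 ∧ 0 < Complex.arg (z * unitExp k (-s)) ∧
    Complex.arg (z * unitExp k (-s)) < Real.pi / k}

/-- The half-open sector `{z ≠ 0 : 0 ≤ Arg (z e_{-s}) < π / k}`. -/
def halfOpenSector (k : ℕ) (s : ℤ) : Set ℂ :=
  {z | z ≠ 0 ∧ 0 ≤ Complex.arg (z * unitExp k (-s)) ∧
    Complex.arg (z * unitExp k (-s)) < Real.pi / k}

/-- `F(z) = z^p e^{A z^k} ∏ (1 + z^k / a_ν) / ∏ (1 - z^k / b_μ)`. The index types may be empty,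
finite or infinite. At a pole Lean's division returns the value `0`, so that for `α ≠ 0` a pole
is never a solution of `F z = α`. -/
def meroF {ι₁ ι₂ : Type*} (p k : ℕ) (A : ℝ) (a : ι₁ → ℝ) (b : ι₂ → ℝ) (z : ℂ) : ℂ :=
  z ^ p * Complex.exp ((A : ℂ) * z ^ k) * (∏' ν, (1 + z ^ k / (a ν : ℂ))) /
    (∏' μ, (1 - z ^ k / (b μ : ℂ)))

/-- `z` is an `α`-point of `f` of multiplicity `n ≥ 1`: `f(z) = α` and
`f'(z) = ⋯ = f^{(n-1)}(z) = 0 ≠ f^{(n)}(z)`. -/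
def IsAlphaPointOfMult (f : ℂ → ℂ) (α z : ℂ) (n : ℕ) : Prop :=
  f z = α ∧ 1 ≤ n ∧ (∀ i, 1 ≤ i → i < n → iteratedDeriv i f z = 0) ∧ iteratedDeriv n f z ≠ 0

/-- `z₁` is an `α`-point of `f` that succeeds `z₀` immediately in the order of absolute values:
`|z₁|` is the least absolute value above `|z₀|` that an `α`-point has. -/
def IsNextAlphaPoint (f : ℂ → ℂ) (α z₀ z₁ : ℂ) : Prop :=
  f z₁ = α ∧ ‖z₀‖ < ‖z₁‖ ∧ ∀ z, f z = α → ‖z₀‖ < ‖z‖ → ‖z₁‖ ≤ ‖z‖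

end

/-! Write `z = exp (η / k)` with `η` in the strip `0 ≤ Im η ≤ π`, so that `F(z) = H(η) = exp (P η)
R(exp η)`, `P = p / k`. Rotations by even multiples of `π / k` and complex conjugation carry every
`z ≠ 0` to such a point and act on the values of `F` by known rotations and conjugation. Off its
zeros and poles `H` has a logarithm on the closed strip whose imaginary part `T` is continuous and
nonnegative.

The driving inequality is `Im ((log H(η₂) - log H(η₁)) * conj (η₂ - η₁)) > 0` for distinct points
not on a common edge. The linear term `P η` contributes a real number. Every other summand has a
derivative with positive imaginary part inside the strip, so it turns chords anticlockwise
(`im_chord_pos`, `im_logH_chord_pos`). On a vertical chord the inequality says that `‖H‖` decreases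
upwards, so a level curve `‖H‖ = c` is a graph over `Re η`. For two points of one level curve it
says that `T` increases with `Re η`, that is, with `‖z‖` (`re_lt_of_T_lt`).

Ordering the α-points by modulus therefore amounts to ordering their values of `T`. After a
symmetry, `α = c exp (i β)` with `0 ≤ β ≤ π / k`. The α-points then have `T = β + 2 N π / k` or `T =
-β + 2 N π / k` with `N` an integer, and the least admissible value is `β` (`exists_strip_point`).
It is attained as soon as any α-point exists, because `T` takes all intermediate values along the
level curve (`exists_T_eq_of_lt`).

If `β < π / k`, the point with `T = β` is unique and gives one closest α-point. If `β = π / k`, an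
interior point and its mirror image give two of equal modulus. The point can lie on the upper edge
only when `p = 1`. There the modulus, up to the first zero, has a strictly decreasing logarithmic
derivative, hence takes the value `c` twice or once with multiplicity two (`exists_edge_solutions`).
Simplicity elsewhere holds because the logarithmic derivative `G` of `H` does not vanish at the
points concerned. -/

open scoped ComplexConjugate Topology
open Filter Set

noncomputable section

/-! ### Infinite products with real coefficients. -/

/-- The product `∏ (1 + c_i w)`. -/
def linProd {ι : Type*} (c : ι → ℝ) (w : ℂ) : ℂ := ∏' i, (1 + w * (c i : ℂ))

section LinProd

variable {ι : Type*} {c : ι → ℝ}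

lemma summable_norm_mul_ofReal (hc : Summable c) (w : ℂ) :
    Summable fun i => ‖w * (c i : ℂ)‖ := by
  simpa [norm_mul] using hc.abs.mul_left ‖w‖

lemma linProd_zero : linProd c 0 = 1 := by simp [linProd]

lemma linProd_eq_zero_iff (hc : Summable c) (w : ℂ) :
    linProd c w = 0 ↔ ∃ i, 1 + w * (c i : ℂ) = 0 := by
  constructor
  · intro h
    by_contra! h'
    exact tprod_one_add_ne_zero_of_summable h' (summable_norm_mul_ofReal hc w) h
  · intro h
    exact tprod_of_exists_eq_zero h

lemma multipliableLocallyUniformlyOn_linProd (hc : Summable c) (r : ℝ) :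
    MultipliableLocallyUniformlyOn (fun i (w : ℂ) => 1 + w * (c i : ℂ)) (Metric.ball 0 r) := by
  refine Summable.multipliableLocallyUniformlyOn_one_add (u := fun i => r * |c i|)
    Metric.isOpen_ball (hc.abs.mul_left r) (.of_forall fun i w hw => ?_) fun i => by fun_prop
  rw [norm_mul, Complex.norm_real, Real.norm_eq_abs]
  gcongr
  exact (mem_ball_zero_iff.1 hw).le

lemma differentiable_linProd (hc : Summable c) : Differentiable ℂ (linProd c) := by
  intro w
  have h := (multipliableLocallyUniformlyOn_linProd hc (‖w‖ + 1)).hasProdLocallyUniformlyOn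
  have h2 := TendstoLocallyUniformlyOn.differentiableOn h
    (.of_forall fun s => by fun_prop) Metric.isOpen_ball
  exact h2.differentiableAt (Metric.isOpen_ball.mem_nhds (by simp))

/-- For all but finitely many indices the denominator has modulus at least `1 / 2`. The exceptional
terms, including any with vanishing denominator, do not affect summability. -/
lemma summable_div_one_add (hc : Summable c) (w : ℂ) :
    Summable fun i => (c i : ℂ) / (1 + w * (c i : ℂ)) := by
  apply (hc.abs.mul_left 2).of_norm_bounded_eventually
  filter_upwards [(summable_norm_mul_ofReal hc w).tendsto_cofinite_zero.eventually_le_const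
    one_half_pos] with i hi
  have h1 : 1 / 2 ≤ ‖1 + w * (c i : ℂ)‖ := by
    have := norm_sub_le_norm_add (1 : ℂ) (w * c i)
    simp only [norm_one] at this
    linarith
  rw [norm_div, Complex.norm_real, Real.norm_eq_abs, div_le_iff₀ (by linarith)]
  nlinarith [abs_nonneg (c i)]

lemma hasDerivAt_linProd (hc : Summable c) {w : ℂ} (hw : linProd c w ≠ 0) :
    HasDerivAt (linProd c)
      (linProd c w * ∑' i, (c i : ℂ) / (1 + w * (c i : ℂ))) w := by
  have hne : ∀ i, 1 + w * (c i : ℂ) ≠ 0 := by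
    intro i hi
    exact hw ((linProd_eq_zero_iff hc w).2 ⟨i, hi⟩)
  have hld : ∀ i, logDeriv (fun w : ℂ => 1 + w * (c i : ℂ)) w
      = (c i : ℂ) / (1 + w * (c i : ℂ)) := by
    intro i
    have : HasDerivAt (fun w : ℂ => 1 + w * (c i : ℂ)) (c i : ℂ) w := by
      simpa using ((hasDerivAt_id w).mul_const (c i : ℂ)).const_add 1
    rw [logDeriv_apply, this.deriv]
  have h := logDeriv_tprod_eq_tsum (f := fun i (w : ℂ) => 1 + w * (c i : ℂ)) Metric.isOpen_ball
    (x := w) (s := Metric.ball 0 (‖w‖ + 1)) (by simp) hne (fun i => by fun_prop)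
    (by simpa only [hld] using summable_div_one_add hc w)
    (multipliableLocallyUniformlyOn_linProd hc _) hw
  simp only [hld] at h
  have h2 := (differentiable_linProd hc w).hasDerivAt
  have h3 : deriv (linProd c) w = linProd c w * ∑' i, (c i : ℂ) / (1 + w * (c i : ℂ)) := by
    rw [← h, logDeriv_apply]
    change _ = linProd c w * (deriv (linProd c) w / linProd c w)
    field_simp
  rwa [h3] at h2

lemma linProd_conj (w : ℂ) : linProd c (conj w) = conj (linProd c w) := by
  unfold linProd
  have h := Function.LeftInverse.map_tprod (f := fun i => 1 + w * (c i : ℂ)) (g := starRingEnd ℂ)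
    (L := SummationFilter.unconditional ι) Complex.continuous_conj Complex.continuous_conj Complex.conj_conj
  rw [h]
  simp

lemma linProd_ofReal_im (x : ℝ) : (linProd c (x : ℂ)).im = 0 := by
  rw [← Complex.conj_eq_iff_im, ← linProd_conj, Complex.conj_ofReal]

end LinProd

/-! ### The strip and the turning of chords. -/

/-- The closed strip `0 ≤ Im η ≤ π`, which `exp` maps onto the closed upper half-plane. -/
def cstrip : Set ℂ := {η | 0 ≤ η.im ∧ η.im ≤ Real.pi}

/-- The open strip `0 < Im η < π`. -/
def ostrip : Set ℂ := {η | 0 < η.im ∧ η.im < Real.pi}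

/-- Both points lie on the same boundary line of the strip. -/
def SameEdge (η₁ η₂ : ℂ) : Prop :=
  (η₁.im = 0 ∧ η₂.im = 0) ∨ (η₁.im = Real.pi ∧ η₂.im = Real.pi)

/-- The reflection of the strip in its middle line. -/
def stripRefl (η : ℂ) : ℂ := conj η + Real.pi * Complex.I

section Strip

lemma stripRefl_im (η : ℂ) : (stripRefl η).im = Real.pi - η.im := by
  simp [stripRefl]; ring

lemma stripRefl_re (η : ℂ) : (stripRefl η).re = η.re := by
  simp [stripRefl]

lemma stripRefl_mem {η : ℂ} (h : η ∈ cstrip) : stripRefl η ∈ cstrip := by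
  have := h.1; have := h.2
  constructor <;> rw [stripRefl_im] <;> linarith

lemma exp_stripRefl (η : ℂ) : Complex.exp (stripRefl η) = -conj (Complex.exp η) := by
  rw [stripRefl, Complex.exp_add, Complex.exp_pi_mul_I, Complex.exp_conj]; ring

lemma exp_im_nonneg {η : ℂ} (h : η ∈ cstrip) : 0 ≤ (Complex.exp η).im := by
  rw [Complex.exp_im]
  exact mul_nonneg (Real.exp_pos _).le (Real.sin_nonneg_of_nonneg_of_le_pi h.1 h.2)

lemma exp_im_pos {η : ℂ} (h : η ∈ ostrip) : 0 < (Complex.exp η).im := by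
  rw [Complex.exp_im]
  exact mul_pos (Real.exp_pos _) (Real.sin_pos_of_pos_of_lt_pi h.1 h.2)

lemma segment_mem_ostrip {η₁ η₂ : ℂ} (h1 : η₁ ∈ cstrip) (h2 : η₂ ∈ cstrip)
    (hs : ¬ SameEdge η₁ η₂) {t : ℝ} (ht : t ∈ Ioo (0 : ℝ) 1) :
    η₁ + t * (η₂ - η₁) ∈ ostrip := by
  obtain ⟨a1, a2⟩ := h1
  obtain ⟨b1, b2⟩ := h2
  obtain ⟨t1, t2⟩ := ht
  simp only [SameEdge, not_or, not_and] at hs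
  have e : (η₁ + t * (η₂ - η₁)).im = (1 - t) * η₁.im + t * η₂.im := by simp; ring
  constructor
  · rw [e]
    rcases a1.lt_or_eq with h | h
    · have := mul_pos (sub_pos.2 t2) h
      have := mul_nonneg t1.le b1
      linarith
    · have : 0 < η₂.im := lt_of_le_of_ne b1 fun h' => hs.1 h.symm h'.symm
      have := mul_pos t1 this
      rw [← h]; linarith
  · rw [e]
    rcases a2.lt_or_eq with h | h
    · have := mul_pos (sub_pos.2 t2) (sub_pos.2 h)
      have := mul_nonneg t1.le (sub_nonneg.2 b2)
      linarith
    · have : η₂.im < Real.pi := lt_of_le_of_ne b2 fun h' => hs.2 h h'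
      have := mul_pos t1 (sub_pos.2 this)
      rw [h]; linarith

/-- A function whose derivative has positive imaginary part in the open strip turns every chord
anticlockwise. -/
lemma im_chord_pos {g g' : ℂ → ℂ} {s : Set ℂ} {η₁ η₂ : ℂ} (h1 : η₁ ∈ cstrip) (h2 : η₂ ∈ cstrip)
    (hne : η₁ ≠ η₂) (hs : ¬ SameEdge η₁ η₂) (hg : ContinuousOn g s) (h1s : η₁ ∈ s) (h2s : η₂ ∈ s)
    (hos : ostrip ⊆ s) (hd : ∀ η ∈ ostrip, HasDerivAt g (g' η) η)
    (hpos : ∀ η ∈ ostrip, 0 < (g' η).im) :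
    0 < ((g η₂ - g η₁) * conj (η₂ - η₁)).im := by
  set Δ := η₂ - η₁ with hΔ
  let γ : ℝ → ℂ := fun t => η₁ + t * Δ
  have hγs : MapsTo γ (Icc 0 1) s := by
    intro t ht
    rcases ht.1.eq_or_lt with h | h
    · simpa [γ, ← h] using h1s
    rcases ht.2.eq_or_lt with h' | h'
    · simpa [γ, h', hΔ] using h2s
    exact hos (segment_mem_ostrip h1 h2 hs ⟨h, h'⟩)
  have hγc : Continuous γ := by fun_prop
  -- The derivative of `g (γ t) * conj Δ` is `g' (γ t)` times `|Δ|²`, so the imaginary part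
  -- increases with `t`. The open segment lies in the open strip, so continuity suffices at the end
  -- points.
  let f : ℝ → ℝ := fun t => (g (γ t) * conj Δ).im
  have hfc : ContinuousOn f (Icc 0 1) := by
    have := hg.comp hγc.continuousOn hγs
    exact Complex.continuous_im.comp_continuousOn (this.mul continuousOn_const)
  have hfd : ∀ t ∈ Ioo (0 : ℝ) 1, HasDerivAt f (((g' (γ t)).im) * Complex.normSq Δ) t := by
    intro t ht
    have hin := segment_mem_ostrip h1 h2 hs ht
    have hγd : HasDerivAt γ Δ t := by
      have := ((Complex.ofRealCLM.hasDerivAt (x := t)).mul_const Δ).const_add η₁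
      simpa [γ] using this
    have h3 := ((hd _ hin).comp t hγd).mul_const (conj Δ)
    have h4 := (Complex.imCLM.hasFDerivAt.comp_hasDerivAt t h3)
    have e : (Complex.imCLM (g' (γ t) * Δ * conj Δ)) = ((g' (γ t)).im) * Complex.normSq Δ := by
      rw [mul_assoc, Complex.mul_conj]
      simp
    have h5 : HasDerivAt f (Complex.imCLM (g' (γ t) * Δ * conj Δ)) t := h4
    rwa [e] at h5
  have hmono : StrictMonoOn f (Icc 0 1) := by
    refine strictMonoOn_of_deriv_pos (convex_Icc 0 1) hfc fun t ht => ?_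
    rw [interior_Icc] at ht
    rw [(hfd t ht).deriv]
    exact mul_pos (hpos _ (segment_mem_ostrip h1 h2 hs ht))
      (Complex.normSq_pos.2 (sub_ne_zero.2 hne.symm))
  have := hmono (left_mem_Icc.2 zero_le_one) (right_mem_Icc.2 zero_le_one) zero_lt_one
  have e0 : γ 0 = η₁ := by simp [γ]
  have e1 : γ 1 = η₂ := by simp [γ, hΔ]
  simp only [f, e0, e1] at this
  rw [sub_mul, Complex.sub_im]
  linarith

end Strip

/-! ### A continuous argument of the product on the closed strip. -/

/-- A logarithm of `linProd c (exp η)` on the closed strip. -/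
def logSum {ι : Type*} (c : ι → ℝ) (η : ℂ) : ℂ := ∑' i, Complex.log (1 + Complex.exp η * (c i : ℂ))

/-- The points of the closed strip at which no factor of `linProd c (exp η)` vanishes. -/
def stripReg {ι : Type*} (c : ι → ℝ) : Set ℂ :=
  {η | η ∈ cstrip ∧ ∀ i, 1 + Complex.exp η * (c i : ℂ) ≠ 0}

section LogTerm

variable {d : ℝ}

lemma im_one_add_exp_mul (η : ℂ) : (1 + Complex.exp η * (d : ℂ)).im = (Complex.exp η).im * d := by
  simp

lemma im_log_term_nonneg (hd : 0 < d) {η : ℂ} (h : η ∈ cstrip) :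
    0 ≤ (Complex.log (1 + Complex.exp η * (d : ℂ))).im := by
  rw [Complex.log_im, Complex.arg_nonneg_iff, im_one_add_exp_mul]
  exact mul_nonneg (exp_im_nonneg h) hd.le

lemma one_add_exp_mul_ne_zero_of_mem_ostrip (hd : 0 < d) {η : ℂ} (h : η ∈ ostrip) :
    1 + Complex.exp η * (d : ℂ) ≠ 0 := by
  intro h0
  have := im_one_add_exp_mul (d := d) η
  rw [h0] at this
  have := mul_pos (exp_im_pos h) hd
  simp only [Complex.zero_im] at *
  linarith

/-- The factor stays in the closed upper half-plane. Within that half-plane the principal logarithm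
is continuous away from 0, also at the negative axis, which is approached from above only. -/
lemma continuousOn_log_term (hd : 0 < d) :
    ContinuousOn (fun η : ℂ => Complex.log (1 + Complex.exp η * (d : ℂ)))
      {η | η ∈ cstrip ∧ 1 + Complex.exp η * (d : ℂ) ≠ 0} := by
  intro η hη
  have hin : ContinuousWithinAt (fun η : ℂ => 1 + Complex.exp η * (d : ℂ))
      {η | η ∈ cstrip ∧ 1 + Complex.exp η * (d : ℂ) ≠ 0} η := by fun_prop
  have him : 0 ≤ (1 + Complex.exp η * (d : ℂ)).im := by
    rw [im_one_add_exp_mul]; exact mul_nonneg (exp_im_nonneg hη.1) hd.le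
  by_cases hsl : 1 + Complex.exp η * (d : ℂ) ∈ Complex.slitPlane
  · exact hin.clog hsl
  · rw [Complex.mem_slitPlane_iff_not_le_zero, not_not, Complex.le_def] at hsl
    simp only [Complex.zero_re, Complex.zero_im] at hsl
    have hre : (1 + Complex.exp η * (d : ℂ)).re < 0 :=
      lt_of_le_of_ne hsl.1 fun h => hη.2 (Complex.ext h hsl.2)
    refine ContinuousWithinAt.comp (f := fun η : ℂ => 1 + Complex.exp η * (d : ℂ))
      (g := Complex.log) (t := {z : ℂ | 0 ≤ z.im})
      (Complex.continuousWithinAt_log_of_re_neg_of_im_zero hre hsl.2) hin ?_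
    intro ξ hξ
    change 0 ≤ (1 + Complex.exp ξ * (d : ℂ)).im
    rw [im_one_add_exp_mul]; exact mul_nonneg (exp_im_nonneg hξ.1) hd.le

lemma hasDerivAt_log_term (hd : 0 < d) {η : ℂ} (h : η ∈ ostrip) :
    HasDerivAt (fun η : ℂ => Complex.log (1 + Complex.exp η * (d : ℂ)))
      (Complex.exp η * (d : ℂ) / (1 + Complex.exp η * (d : ℂ))) η := by
  have h1 : HasDerivAt (fun η : ℂ => 1 + Complex.exp η * (d : ℂ)) (Complex.exp η * (d : ℂ)) η :=
    ((Complex.hasDerivAt_exp η).mul_const _).const_add 1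
  refine h1.clog (Complex.mem_slitPlane_iff.2 (Or.inr ?_))
  rw [im_one_add_exp_mul]
  exact (mul_pos (exp_im_pos h) hd).ne'

lemma im_div_one_add_mul (w : ℂ) :
    (w * (d : ℂ) / (1 + w * (d : ℂ))).im = w.im * d / Complex.normSq (1 + w * (d : ℂ)) := by
  rw [Complex.div_im]
  simp
  ring

lemma im_log_term_chord_pos (hd : 0 < d) {η₁ η₂ : ℂ} (h1 : η₁ ∈ cstrip) (h2 : η₂ ∈ cstrip)
    (hne : η₁ ≠ η₂) (hs : ¬ SameEdge η₁ η₂) (h1d : 1 + Complex.exp η₁ * (d : ℂ) ≠ 0)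
    (h2d : 1 + Complex.exp η₂ * (d : ℂ) ≠ 0) :
    0 < ((Complex.log (1 + Complex.exp η₂ * (d : ℂ)) - Complex.log (1 + Complex.exp η₁ * (d : ℂ)))
      * conj (η₂ - η₁)).im := by
  refine im_chord_pos (g := fun η : ℂ => Complex.log (1 + Complex.exp η * (d : ℂ))) h1 h2 hne hs
    (continuousOn_log_term hd) ⟨h1, h1d⟩ ⟨h2, h2d⟩ (fun η hη =>
      ⟨⟨hη.1.le, hη.2.le⟩, one_add_exp_mul_ne_zero_of_mem_ostrip hd hη⟩)
    (fun η hη => hasDerivAt_log_term hd hη) fun η hη => ?_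
  rw [im_div_one_add_mul]
  exact div_pos (mul_pos (exp_im_pos hη) hd)
    (Complex.normSq_pos.2 (one_add_exp_mul_ne_zero_of_mem_ostrip hd hη))

lemma exp_of_im_eq_zero {η : ℂ} (h : η.im = 0) : Complex.exp η = (Real.exp η.re : ℂ) := by
  have : η = (η.re : ℂ) := Complex.ext rfl (by simpa using h)
  rw [this]; simp

lemma exp_of_im_eq_pi {η : ℂ} (h : η.im = Real.pi) : Complex.exp η = (-Real.exp η.re : ℝ) := by
  apply Complex.ext
  · simp [Complex.exp_re, h]
  · rw [Complex.exp_im, h, Real.sin_pi, mul_zero, Complex.ofReal_im]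

lemma im_log_term_eq_zero (hd : 0 < d) {η : ℂ} (h : η.im = 0) :
    (Complex.log (1 + Complex.exp η * (d : ℂ))).im = 0 := by
  rw [Complex.log_im, exp_of_im_eq_zero h]
  rw [show (1 + (Real.exp η.re : ℂ) * d : ℂ) = ((1 + Real.exp η.re * d : ℝ) : ℂ) by push_cast; ring]
  exact Complex.arg_ofReal_of_nonneg (by positivity)

lemma im_log_term_of_im_eq_pi {η : ℂ} (h : η.im = Real.pi) :
    (Complex.log (1 + Complex.exp η * (d : ℂ))).im
      = if Real.exp η.re * d ≤ 1 then 0 else Real.pi := by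
  rw [Complex.log_im, exp_of_im_eq_pi h]
  rw [show (1 + ((-Real.exp η.re : ℝ) : ℂ) * d : ℂ) = ((1 - Real.exp η.re * d : ℝ) : ℂ) by
    push_cast; ring]
  -- At equality the factor vanishes, and `Complex.arg 0 = 0` puts this case with the first branch.
  split_ifs with h1
  · exact Complex.arg_ofReal_of_nonneg (by linarith)
  · exact Complex.arg_ofReal_of_neg (by linarith)

/-- Strictness is lost on a common edge. On the lower edge the argument is constantly 0, and on the
upper edge it is a step function of the real part that jumps up from 0 to `π`. -/
lemma im_log_term_chord_nonneg (hd : 0 < d) {η₁ η₂ : ℂ} (h1 : η₁ ∈ cstrip) (h2 : η₂ ∈ cstrip)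
    (h1d : 1 + Complex.exp η₁ * (d : ℂ) ≠ 0) (h2d : 1 + Complex.exp η₂ * (d : ℂ) ≠ 0) :
    0 ≤ ((Complex.log (1 + Complex.exp η₂ * (d : ℂ)) - Complex.log (1 + Complex.exp η₁ * (d : ℂ)))
      * conj (η₂ - η₁)).im := by
  by_cases hne : η₁ = η₂
  · simp [hne]
  by_cases hs : SameEdge η₁ η₂
  · rcases hs with ⟨e1, e2⟩ | ⟨e1, e2⟩
    · rw [Complex.mul_im, Complex.sub_im, im_log_term_eq_zero hd e1, im_log_term_eq_zero hd e2]
      simp [e1, e2]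
    · rw [Complex.mul_im, Complex.sub_im, im_log_term_of_im_eq_pi e1, im_log_term_of_im_eq_pi e2]
      simp only [Complex.conj_im, Complex.conj_re, Complex.sub_im, Complex.sub_re, e1, e2, sub_self,
        neg_zero, mul_zero, zero_add]
      rcases le_total η₁.re η₂.re with hle | hle
      · have := Real.exp_le_exp.2 hle
        have := mul_le_mul_of_nonneg_right this hd.le
        refine mul_nonneg ?_ (sub_nonneg.2 hle)
        split_ifs <;> linarith [Real.pi_pos]
      · have := Real.exp_le_exp.2 hle
        have := mul_le_mul_of_nonneg_right this hd.le
        refine mul_nonneg_of_nonpos_of_nonpos ?_ (sub_nonpos.2 hle)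
        split_ifs <;> linarith [Real.pi_pos]
  · exact (im_log_term_chord_pos hd h1 h2 hne hs h1d h2d).le

/-- A bound linear in `‖u‖` without a smallness assumption: away from 0 it follows from `|arg| ≤ π`.
It supplies the summable majorant for the continuity of the argument. -/
lemma abs_im_log_le (u : ℂ) : |(Complex.log (1 + u)).im| ≤ 2 * Real.pi * ‖u‖ := by
  rcases le_or_gt ‖u‖ (1 / 2) with h | h
  · have h1 := Complex.norm_log_one_add_half_le_self h
    have h2 := Complex.abs_im_le_norm (Complex.log (1 + u))
    nlinarith [norm_nonneg u, Real.pi_gt_three]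
  · have h2 := Complex.abs_arg_le_pi (1 + u)
    rw [Complex.log_im]
    nlinarith [Real.pi_pos]

end LogTerm

section LogSum

variable {ι : Type*} {c : ι → ℝ}

lemma summable_log_term (hc : Summable c) (η : ℂ) :
    Summable fun i => Complex.log (1 + Complex.exp η * (c i : ℂ)) :=
  Complex.summable_log_one_add_of_summable (summable_norm_mul_ofReal hc _).of_norm

lemma exp_logSum (hc : Summable c) {η : ℂ} (h : η ∈ stripReg c) :
    Complex.exp (logSum c η) = linProd c (Complex.exp η) :=
  Complex.cexp_tsum_eq_tprod h.2 (summable_log_term hc η)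

lemma hasSum_im_logSum (hc : Summable c) (η : ℂ) :
    HasSum (fun i => (Complex.log (1 + Complex.exp η * (c i : ℂ))).im) (logSum c η).im :=
  Complex.hasSum_im (summable_log_term hc η).hasSum

lemma im_logSum_nonneg (hc : Summable c) (hpos : ∀ i, 0 < c i) {η : ℂ} (h : η ∈ cstrip) :
    0 ≤ (logSum c η).im :=
  (hasSum_im_logSum hc η).nonneg fun i => im_log_term_nonneg (hpos i) h

lemma im_logSum_eq_zero (hc : Summable c) (hpos : ∀ i, 0 < c i) {η : ℂ} (h : η.im = 0) :
    (logSum c η).im = 0 := by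
  rw [← (hasSum_im_logSum hc η).tsum_eq]
  simp only [im_log_term_eq_zero (hpos _) h, tsum_zero]

lemma im_logSum_of_im_eq_pi (hc : Summable c) (hpos : ∀ i, 0 < c i) {η : ℂ} (h : η.im = Real.pi) :
    (logSum c η).im = 0 ↔ ∀ i, Real.exp η.re * c i ≤ 1 := by
  have hs := hasSum_im_logSum hc η
  have hη : η ∈ cstrip := ⟨by rw [h]; exact Real.pi_pos.le, h.le⟩
  have h0 := hasSum_zero_iff_of_nonneg (L := SummationFilter.unconditional ι) (f := fun i =>
    (Complex.log (1 + Complex.exp η * (c i : ℂ))).im) fun i => im_log_term_nonneg (hpos i) hη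
  have h1 : (logSum c η).im = 0 ↔ HasSum (fun i =>
      (Complex.log (1 + Complex.exp η * (c i : ℂ))).im) 0 :=
    ⟨fun h => h ▸ hs, fun h => hs.unique h⟩
  rw [h1, h0, funext_iff]
  refine forall_congr' fun i => ?_
  rw [Pi.zero_apply]
  rw [im_log_term_of_im_eq_pi h]
  simp [Real.pi_ne_zero]

lemma hasSum_logSum_chord (hc : Summable c) (η₁ η₂ : ℂ) :
    HasSum (fun i => ((Complex.log (1 + Complex.exp η₂ * (c i : ℂ)) -
      Complex.log (1 + Complex.exp η₁ * (c i : ℂ))) * conj (η₂ - η₁)).im)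
      ((logSum c η₂ - logSum c η₁) * conj (η₂ - η₁)).im :=
  Complex.hasSum_im
    (((summable_log_term hc η₂).hasSum.sub (summable_log_term hc η₁).hasSum).mul_right _)

lemma im_logSum_chord_nonneg (hc : Summable c) (hpos : ∀ i, 0 < c i) {η₁ η₂ : ℂ}
    (h1 : η₁ ∈ stripReg c) (h2 : η₂ ∈ stripReg c) :
    0 ≤ ((logSum c η₂ - logSum c η₁) * conj (η₂ - η₁)).im :=
  (hasSum_logSum_chord hc η₁ η₂).nonneg fun i =>
    im_log_term_chord_nonneg (hpos i) h1.1 h2.1 (h1.2 i) (h2.2 i)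

lemma im_logSum_chord_pos [Nonempty ι] (hc : Summable c) (hpos : ∀ i, 0 < c i) {η₁ η₂ : ℂ}
    (h1 : η₁ ∈ stripReg c) (h2 : η₂ ∈ stripReg c) (hne : η₁ ≠ η₂) (hs : ¬ SameEdge η₁ η₂) :
    0 < ((logSum c η₂ - logSum c η₁) * conj (η₂ - η₁)).im := by
  have h := hasSum_logSum_chord hc η₁ η₂
  rw [← h.tsum_eq]
  exact h.summable.tsum_pos (fun i =>
    im_log_term_chord_nonneg (hpos i) h1.1 h2.1 (h1.2 i) (h2.2 i)) (Classical.arbitrary ι)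
    (im_log_term_chord_pos (hpos _) h1.1 h2.1 hne hs (h1.2 _) (h2.2 _))

lemma continuousOn_im_logSum (hc : Summable c) (hpos : ∀ i, 0 < c i) :
    ContinuousOn (fun η => (logSum c η).im) (stripReg c) := by
  -- The majorant is uniform only on half-planes `Re η < X`, which is enough since continuity is
  -- local.
  have key : ∀ X : ℝ, ContinuousOn (fun η => (logSum c η).im) (stripReg c ∩ {η | η.re < X}) := by
    intro X
    have e : (fun η => (logSum c η).im)
        = fun η => ∑' i, (Complex.log (1 + Complex.exp η * (c i : ℂ))).im := by
      funext η
      exact (hasSum_im_logSum hc η).tsum_eq.symm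
    rw [e]
    refine continuousOn_tsum (u := fun i => 2 * Real.pi * (Real.exp X * c i)) (fun i => ?_)
      ((hc.mul_left _).mul_left _) fun i η hη => ?_
    · refine Complex.continuous_im.comp_continuousOn ((continuousOn_log_term (hpos i)).mono ?_)
      exact fun η hη => ⟨hη.1.1, hη.1.2 i⟩
    · refine (abs_im_log_le _).trans ?_
      rw [norm_mul, Complex.norm_exp, Complex.norm_real, Real.norm_of_nonneg (hpos i).le]
      have := hpos i
      have := Real.pi_pos
      gcongr
      exact hη.2.le
  intro η hη
  have h := key (η.re + 1) η ⟨hη, by simp⟩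
  refine h.mono_of_mem_nhdsWithin (inter_mem self_mem_nhdsWithin ?_)
  exact mem_nhdsWithin_of_mem_nhds
    ((isOpen_lt Complex.continuous_re continuous_const).mem_nhds (by simp))

end LogSum

/-! ### The function `H`, its argument `T`, and monotonicity. -/

/-- The data of `H(η) = exp (P η) R(exp η)` with
`R(w) = exp (A w) ∏ (1 + u_ν w) / ∏ (1 - v_μ w)` nonconstant. -/
structure StripData (ι₁ ι₂ : Type*) where
  /-- the exponent of the power -/
  P : ℝ
  /-- the exponential rate -/
  A : ℝ
  /-- the reciprocals of the moduli of the zeros -/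
  u : ι₁ → ℝ
  /-- the reciprocals of the moduli of the poles -/
  v : ι₂ → ℝ
  P_pos : 0 < P
  A_nonneg : 0 ≤ A
  u_pos : ∀ i, 0 < u i
  v_pos : ∀ i, 0 < v i
  u_sum : Summable u
  v_sum : Summable v
  nonconst : 0 < A ∨ Nonempty ι₁ ∨ Nonempty ι₂

namespace StripData

variable {ι₁ ι₂ : Type*} (D : StripData ι₁ ι₂)

/-- The numerator of `H`. -/
def num (η : ℂ) : ℂ :=
  Complex.exp (D.P * η) * Complex.exp (D.A * Complex.exp η) * linProd D.u (Complex.exp η)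

/-- The denominator of `H`. -/
def den (η : ℂ) : ℂ := linProd D.v (-Complex.exp η)

/-- The meromorphic function in the logarithmic variable. -/
def H (η : ℂ) : ℂ := D.num η / D.den η

/-- The points of the closed strip that are neither zeros nor poles. -/
def reg : Set ℂ := {η | η ∈ cstrip ∧ D.num η ≠ 0 ∧ D.den η ≠ 0}

/-- The logarithm of `H` on the closed strip that is continuous off the zeros and poles. -/
def logH (η : ℂ) : ℂ :=
  D.P * η + D.A * Complex.exp η + logSum D.u η - conj (logSum D.v (stripRefl η))

/-- The argument of `H`. -/
def T (η : ℂ) : ℝ := (D.logH η).im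

lemma num_ne_zero_iff (η : ℂ) : D.num η ≠ 0 ↔ ∀ i, 1 + Complex.exp η * (D.u i : ℂ) ≠ 0 := by
  have := linProd_eq_zero_iff D.u_sum (Complex.exp η)
  simp only [num, mul_ne_zero_iff]
  simp [Complex.exp_ne_zero, this]

lemma one_add_exp_stripRefl (η : ℂ) (d : ℝ) :
    1 + Complex.exp (stripRefl η) * (d : ℂ) = conj (1 + -Complex.exp η * (d : ℂ)) := by
  simp [exp_stripRefl]

lemma den_ne_zero_iff (η : ℂ) :
    D.den η ≠ 0 ↔ ∀ i, 1 + Complex.exp (stripRefl η) * (D.v i : ℂ) ≠ 0 := by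
  have := linProd_eq_zero_iff D.v_sum (-Complex.exp η)
  simp only [one_add_exp_stripRefl, den, Ne, this, map_eq_zero]
  push Not
  rfl

/-- The reflection of the strip sends `exp η` to `-conj (exp η)`, so a pole factor is the conjugate
of a zero factor at the reflected point. Division and conjugation both change the sign of the
argument, so poles also contribute nonnegatively to `T`. -/
lemma den_eq (η : ℂ) : D.den η = conj (linProd D.v (Complex.exp (stripRefl η))) := by
  rw [← linProd_conj, exp_stripRefl, den, map_neg, Complex.conj_conj]

variable {D}

lemma reg_u {η : ℂ} (h : η ∈ D.reg) : η ∈ stripReg D.u := ⟨h.1, (D.num_ne_zero_iff η).1 h.2.1⟩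

lemma reg_v {η : ℂ} (h : η ∈ D.reg) : stripRefl η ∈ stripReg D.v :=
  ⟨stripRefl_mem h.1, (D.den_ne_zero_iff η).1 h.2.2⟩

lemma exp_logH {η : ℂ} (h : η ∈ D.reg) : Complex.exp (D.logH η) = D.H η := by
  rw [logH, Complex.exp_sub, Complex.exp_add, Complex.exp_add, exp_logSum D.u_sum (reg_u h),
    Complex.exp_conj, exp_logSum D.v_sum (reg_v h), H, den_eq, num]

lemma norm_H {η : ℂ} (h : η ∈ D.reg) : ‖D.H η‖ = Real.exp (D.logH η).re := by
  rw [← exp_logH h, Complex.norm_exp]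

lemma H_eq_norm_mul {η : ℂ} (h : η ∈ D.reg) :
    D.H η = ‖D.H η‖ * Complex.exp (D.T η * Complex.I) := by
  rw [norm_H h, ← exp_logH h, Complex.ofReal_exp, ← Complex.exp_add, T, Complex.re_add_im]

lemma H_ne_zero {η : ℂ} (h : η ∈ D.reg) : D.H η ≠ 0 := div_ne_zero h.2.1 h.2.2

lemma mem_reg_of_H_ne_zero {η : ℂ} (hη : η ∈ cstrip) (h : D.H η ≠ 0) : η ∈ D.reg := by
  rw [H, div_ne_zero_iff] at h
  exact ⟨hη, h⟩

lemma T_eq (η : ℂ) : D.T η = D.P * η.im + D.A * (Complex.exp η).im + (logSum D.u η).im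
    + (logSum D.v (stripRefl η)).im := by
  simp [T, logH]

lemma P_mul_im_le_T {η : ℂ} (h : η ∈ cstrip) : D.P * η.im ≤ D.T η := by
  rw [T_eq]
  have h1 := mul_nonneg D.A_nonneg (exp_im_nonneg h)
  have h2 := im_logSum_nonneg D.u_sum D.u_pos h
  have h3 := im_logSum_nonneg D.v_sum D.v_pos (stripRefl_mem h)
  linarith

lemma T_nonneg {η : ℂ} (h : η ∈ cstrip) : 0 ≤ D.T η :=
  (mul_nonneg D.P_pos.le h.1).trans (P_mul_im_le_T h)

lemma im_eq_zero_of_T {η : ℂ} (h : η ∈ cstrip) (hT : D.T η = 0) : η.im = 0 := by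
  have h1 := P_mul_im_le_T (D := D) h
  rw [hT] at h1
  have := h.1
  nlinarith [D.P_pos]

lemma T_eq_of_im_eq_zero {η : ℂ} (h : η.im = 0) : D.T η = (logSum D.v (stripRefl η)).im := by
  rw [T_eq, im_logSum_eq_zero D.u_sum D.u_pos h, exp_of_im_eq_zero h, h, Complex.ofReal_im]
  ring

lemma T_eq_of_im_eq_pi {η : ℂ} (h : η.im = Real.pi) :
    D.T η = D.P * Real.pi + (logSum D.u η).im := by
  rw [T_eq, im_logSum_eq_zero D.v_sum D.v_pos (η := stripRefl η) (by rw [stripRefl_im, h, sub_self]),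
    exp_of_im_eq_pi h, h, Complex.ofReal_im]
  ring

/-- On the lower edge only poles contribute, each of them `π` once it has been passed. The `≤`
includes the first pole itself, where the term is `log 0 = 0`. -/
lemma T_eq_zero_iff {η : ℂ} (h : η.im = 0) : D.T η = 0 ↔ ∀ i, Real.exp η.re * D.v i ≤ 1 := by
  rw [T_eq_of_im_eq_zero h, im_logSum_of_im_eq_pi D.v_sum D.v_pos, stripRefl_re]
  rw [stripRefl_im, h, sub_zero]

lemma T_eq_P_mul_pi_iff {η : ℂ} (h : η.im = Real.pi) :
    D.T η = D.P * Real.pi ↔ ∀ i, Real.exp η.re * D.u i ≤ 1 := by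
  rw [T_eq_of_im_eq_pi h, ← im_logSum_of_im_eq_pi D.u_sum D.u_pos h]
  constructor <;> intro h <;> linarith

lemma continuousOn_T : ContinuousOn D.T D.reg := by
  have h1 : ContinuousOn (fun η => (logSum D.u η).im) D.reg :=
    (continuousOn_im_logSum D.u_sum D.u_pos).mono fun _ h => reg_u h
  have h2 : ContinuousOn (fun η => (logSum D.v (stripRefl η)).im) D.reg :=
    (continuousOn_im_logSum D.v_sum D.v_pos).comp
      (by unfold stripRefl; exact (Complex.continuous_conj.add continuous_const).continuousOn)
      fun _ h => reg_v h
  have h3 : ContinuousOn (fun η => D.P * η.im + D.A * (Complex.exp η).im) D.reg := by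
    refine Continuous.continuousOn ?_
    have := Complex.continuous_im
    have := Complex.continuous_exp
    fun_prop
  have : D.T = fun η => D.P * η.im + D.A * (Complex.exp η).im + (logSum D.u η).im
    + (logSum D.v (stripRefl η)).im := funext T_eq
  rw [this]
  exact (h3.add h1).add h2

lemma continuous_num : Continuous D.num := by
  have h := (differentiable_linProd D.u_sum).continuous.comp Complex.continuous_exp
  have := Complex.continuous_exp
  have h2 : Continuous fun η : ℂ =>
    Complex.exp (D.P * η) * Complex.exp (D.A * Complex.exp η) := by fun_prop
  exact h2.mul h

lemma continuous_den : Continuous D.den :=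
  (differentiable_linProd D.v_sum).continuous.comp Complex.continuous_exp.neg

/-- `H` is real on the lower edge, so a continuous argument is locally constant there. The analogue
on the upper edge has the offset `P π`. -/
lemma exists_T_eq_of_im_eq_zero {η : ℂ} (hη : η ∈ D.reg) (h : η.im = 0) :
    ∃ n : ℤ, D.T η = n * Real.pi := by
  have h1 : (D.H η).im = 0 := by
    have e1 := linProd_ofReal_im (c := D.u) (Real.exp η.re)
    have e2 := linProd_ofReal_im (c := D.v) (-Real.exp η.re)
    have hη' : η = (η.re : ℂ) := Complex.ext rfl (by simpa using h)
    rw [H, num, den, exp_of_im_eq_zero h]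
    push_cast at e2
    have e3 : linProd D.u (Real.exp η.re : ℂ) = ((linProd D.u (Real.exp η.re : ℂ)).re : ℂ) :=
      Complex.ext rfl (by simpa using e1)
    have e4 : linProd D.v (-(Real.exp η.re : ℂ)) = ((linProd D.v (-(Real.exp η.re : ℂ))).re : ℂ) :=
      Complex.ext rfl (by simpa using e2)
    rw [e3, e4, hη', Complex.ofReal_re]
    norm_cast
  rw [← exp_logH hη, Complex.exp_im] at h1
  have h2 := (mul_eq_zero.1 h1).resolve_left (Real.exp_pos _).ne'
  obtain ⟨n, hn⟩ := Real.sin_eq_zero_iff.1 h2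
  exact ⟨n, hn.symm⟩

/-- The values of `H` on the upper edge of the strip, up to a constant factor. -/
lemma H_of_im_eq_pi {η : ℂ} (h : η.im = Real.pi) : D.H η = Complex.exp (D.P * Real.pi * Complex.I) *
    (Real.exp (D.P * η.re) * Real.exp (-D.A * Real.exp η.re) *
      (linProd D.u (-Real.exp η.re : ℂ)).re / (linProd D.v (Real.exp η.re : ℂ)).re : ℝ) := by
  have e1 := linProd_ofReal_im (c := D.u) (-Real.exp η.re)
  have e2 := linProd_ofReal_im (c := D.v) (Real.exp η.re)
  rw [Complex.ofReal_neg] at e1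
  have e3 : linProd D.u (-(Real.exp η.re : ℂ)) = ((linProd D.u (-(Real.exp η.re : ℂ))).re : ℂ) :=
    Complex.ext rfl (by simpa using e1)
  have e4 : linProd D.v ((Real.exp η.re : ℂ)) = ((linProd D.v ((Real.exp η.re : ℂ))).re : ℂ) :=
    Complex.ext rfl (by simpa using e2)
  have hη : η = η.re + Real.pi * Complex.I := by
    rw [← h, Complex.re_add_im]
  rw [H, num, den, exp_of_im_eq_pi h, Complex.ofReal_neg, neg_neg]
  rw [Complex.ofReal_div, Complex.ofReal_mul, ← e3, ← e4]
  have e5 : Complex.exp (D.P * η) = Complex.exp (D.P * Real.pi * Complex.I) *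
      (Real.exp (D.P * η.re) : ℝ) := by
    conv_lhs => rw [hη]
    rw [Complex.ofReal_exp, ← Complex.exp_add]
    congr 1
    push_cast; ring
  rw [e5]
  push_cast
  ring_nf

lemma exists_T_eq_of_im_eq_pi {η : ℂ} (hη : η ∈ D.reg) (h : η.im = Real.pi) :
    ∃ n : ℤ, D.T η = D.P * Real.pi + n * Real.pi := by
  have h1 := H_of_im_eq_pi (D := D) h
  set r : ℝ := Real.exp (D.P * η.re) * Real.exp (-D.A * Real.exp η.re) *
      (linProd D.u (-Real.exp η.re : ℂ)).re / (linProd D.v (Real.exp η.re : ℂ)).re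
  have h2 : Complex.exp (D.logH η - D.P * Real.pi * Complex.I) = (r : ℂ) := by
    rw [Complex.exp_sub, exp_logH hη, h1]
    field_simp
  have h3 := congrArg Complex.im h2
  rw [Complex.exp_im, Complex.ofReal_im] at h3
  have h4 := (mul_eq_zero.1 h3).resolve_left (Real.exp_pos _).ne'
  obtain ⟨n, hn⟩ := Real.sin_eq_zero_iff.1 h4
  refine ⟨n, ?_⟩
  rw [hn]
  simp [T]

/-- The term `P η` contributes `P |η₂ - η₁|²`, which is real and drops out. The pole term becomes a
chord between reflected points because the reflection conjugates differences. -/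
lemma logH_chord (η₁ η₂ : ℂ) : ((D.logH η₂ - D.logH η₁) * conj (η₂ - η₁)).im
    = D.A * ((Complex.exp η₂ - Complex.exp η₁) * conj (η₂ - η₁)).im
      + ((logSum D.u η₂ - logSum D.u η₁) * conj (η₂ - η₁)).im
      + ((logSum D.v (stripRefl η₂) - logSum D.v (stripRefl η₁)) *
          conj (stripRefl η₂ - stripRefl η₁)).im := by
  simp only [logH, stripRefl, Complex.mul_im, Complex.sub_re, Complex.sub_im, Complex.add_re,
    Complex.add_im, Complex.conj_re, Complex.conj_im, Complex.mul_re, Complex.ofReal_re,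
    Complex.ofReal_im, Complex.I_re, Complex.I_im]
  ring

lemma stripRefl_ne {η₁ η₂ : ℂ} (h : η₁ ≠ η₂) : stripRefl η₁ ≠ stripRefl η₂ := by
  intro h'
  apply h
  unfold stripRefl at h'
  exact (starRingEnd ℂ).injective (add_right_cancel h')

lemma not_sameEdge_stripRefl {η₁ η₂ : ℂ} (h : ¬ SameEdge η₁ η₂) :
    ¬ SameEdge (stripRefl η₁) (stripRefl η₂) := by
  contrapose h
  simp only [SameEdge, stripRefl_im] at h ⊢
  rcases h with ⟨h1, h2⟩ | ⟨h1, h2⟩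
  · right; constructor <;> linarith
  · left; constructor <;> linarith

lemma im_exp_chord_pos {η₁ η₂ : ℂ} (h1 : η₁ ∈ cstrip) (h2 : η₂ ∈ cstrip)
    (hne : η₁ ≠ η₂) (hs : ¬ SameEdge η₁ η₂) :
    0 < ((Complex.exp η₂ - Complex.exp η₁) * conj (η₂ - η₁)).im :=
  im_chord_pos (s := univ) h1 h2 hne hs Complex.continuous_exp.continuousOn (mem_univ _)
    (mem_univ _) (subset_univ _) (fun η _ => Complex.hasDerivAt_exp η) fun _ h => exp_im_pos h

lemma im_exp_chord_nonneg {η₁ η₂ : ℂ} (h1 : η₁ ∈ cstrip) (h2 : η₂ ∈ cstrip) :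
    0 ≤ ((Complex.exp η₂ - Complex.exp η₁) * conj (η₂ - η₁)).im := by
  by_cases hne : η₁ = η₂
  · simp [hne]
  by_cases hs : SameEdge η₁ η₂
  · rw [Complex.mul_im, Complex.sub_im]
    rcases hs with ⟨e1, e2⟩ | ⟨e1, e2⟩
    · simp [Complex.exp_im, e1, e2]
    · simp [Complex.exp_im, e1, e2]
  · exact (im_exp_chord_pos h1 h2 hne hs).le

lemma im_logH_chord_nonneg {η₁ η₂ : ℂ} (h1 : η₁ ∈ D.reg) (h2 : η₂ ∈ D.reg) :
    0 ≤ ((D.logH η₂ - D.logH η₁) * conj (η₂ - η₁)).im := by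
  rw [logH_chord]
  have e1 := mul_nonneg D.A_nonneg (im_exp_chord_nonneg h1.1 h2.1)
  have e2 := im_logSum_chord_nonneg D.u_sum D.u_pos (reg_u h1) (reg_u h2)
  have e3 := im_logSum_chord_nonneg D.v_sum D.v_pos (reg_v h1) (reg_v h2)
  linarith

/-- All three contributions are nonnegative, and nonconstancy of `R` makes one of them strictly
positive. -/
lemma im_logH_chord_pos {η₁ η₂ : ℂ} (h1 : η₁ ∈ D.reg) (h2 : η₂ ∈ D.reg) (hne : η₁ ≠ η₂)
    (hs : ¬ SameEdge η₁ η₂) : 0 < ((D.logH η₂ - D.logH η₁) * conj (η₂ - η₁)).im := by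
  rw [logH_chord]
  have e1 := mul_nonneg D.A_nonneg (im_exp_chord_nonneg h1.1 h2.1)
  have e2 := im_logSum_chord_nonneg D.u_sum D.u_pos (reg_u h1) (reg_u h2)
  have e3 := im_logSum_chord_nonneg D.v_sum D.v_pos (reg_v h1) (reg_v h2)
  rcases D.nonconst with h | h | h
  · have := mul_pos h (im_exp_chord_pos h1.1 h2.1 hne hs)
    linarith
  · have := im_logSum_chord_pos D.u_sum D.u_pos (reg_u h1) (reg_u h2) hne hs
    linarith
  · have := im_logSum_chord_pos D.v_sum D.v_pos (reg_v h1) (reg_v h2) (stripRefl_ne hne)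
      (not_sameEdge_stripRefl hs)
    linarith

lemma re_logH_eq {η₁ η₂ : ℂ} (h1 : η₁ ∈ D.reg) (h2 : η₂ ∈ D.reg) (h : ‖D.H η₁‖ = ‖D.H η₂‖) :
    (D.logH η₁).re = (D.logH η₂).re := by
  rw [norm_H h1, norm_H h2] at h
  exact Real.exp_injective h

lemma chord_im_of_norm_eq {η₁ η₂ : ℂ} (h1 : η₁ ∈ D.reg) (h2 : η₂ ∈ D.reg)
    (h : ‖D.H η₁‖ = ‖D.H η₂‖) : ((D.logH η₂ - D.logH η₁) * conj (η₂ - η₁)).im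
      = (D.T η₂ - D.T η₁) * (η₂.re - η₁.re) := by
  rw [Complex.mul_im, Complex.sub_re, re_logH_eq h1 h2 h]
  simp [T]

/-- For equal moduli the chord of `logH` is vertical, and the chord inequality compares the signs of
the differences of `T` and of `Re η`. On a common edge it is only weak, but equal real parts would
then identify the two points. -/
lemma re_lt_of_T_lt {η₁ η₂ : ℂ} (h1 : η₁ ∈ D.reg) (h2 : η₂ ∈ D.reg)
    (h : ‖D.H η₁‖ = ‖D.H η₂‖) (hT : D.T η₁ < D.T η₂) : η₁.re < η₂.re := by
  have hne : η₁ ≠ η₂ := by rintro rfl; exact hT.false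
  have e := chord_im_of_norm_eq h1 h2 h
  by_cases hs : SameEdge η₁ η₂
  · have h3 := im_logH_chord_nonneg h1 h2
    rw [e] at h3
    have h4 : 0 ≤ η₂.re - η₁.re := nonneg_of_mul_nonneg_right h3 (sub_pos.2 hT)
    refine lt_of_le_of_ne (by linarith) fun h5 => hne (Complex.ext h5 ?_)
    rcases hs with ⟨h6, h7⟩ | ⟨h6, h7⟩ <;> rw [h6, h7]
  · have h3 := im_logH_chord_pos h1 h2 hne hs
    rw [e] at h3
    have := (mul_pos_iff_of_pos_left (sub_pos.2 hT)).1 h3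
    linarith

lemma eq_or_sameEdge_of_T_eq {η₁ η₂ : ℂ} (h1 : η₁ ∈ D.reg) (h2 : η₂ ∈ D.reg)
    (h : ‖D.H η₁‖ = ‖D.H η₂‖) (hT : D.T η₁ = D.T η₂) : η₁ = η₂ ∨ SameEdge η₁ η₂ := by
  by_contra! h'
  have h3 := im_logH_chord_pos h1 h2 h'.1 h'.2
  rw [chord_im_of_norm_eq h1 h2 h, hT] at h3
  simp at h3

/-- The chord inequality on a vertical segment. It makes each level curve of the modulus a graph
over the real part. -/
lemma norm_H_lt_of_im_lt {η₁ η₂ : ℂ} (h1 : η₁ ∈ D.reg) (h2 : η₂ ∈ D.reg)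
    (hre : η₁.re = η₂.re) (him : η₁.im < η₂.im) : ‖D.H η₂‖ < ‖D.H η₁‖ := by
  have hs : ¬ SameEdge η₁ η₂ := by
    rintro (⟨h3, h4⟩ | ⟨h3, h4⟩) <;> linarith
  have h3 := im_logH_chord_pos h1 h2 (by rintro rfl; exact him.false) hs
  rw [Complex.mul_im] at h3
  simp only [Complex.conj_re, Complex.conj_im, Complex.sub_re, Complex.sub_im, hre] at h3
  rw [norm_H h1, norm_H h2, Real.exp_lt_exp]
  nlinarith

end StripData

/-! ### Level curves of the modulus as graphs. -/

/-- The point `x + i y`. -/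
def xy (x y : ℝ) : ℂ := x + y * Complex.I

@[simp] lemma xy_re (x y : ℝ) : (xy x y).re = x := by simp [xy]
@[simp] lemma xy_im (x y : ℝ) : (xy x y).im = y := by simp [xy]

lemma xy_eta (η : ℂ) : xy η.re η.im = η := Complex.re_add_im η

lemma continuous_xy : Continuous fun p : ℝ × ℝ => xy p.1 p.2 := by unfold xy; fun_prop

lemma xy_mem_cstrip {x y : ℝ} (hy : y ∈ Icc 0 Real.pi) : xy x y ∈ cstrip := by
  simpa [cstrip] using hy

namespace StripData

variable {ι₁ ι₂ : Type*} (D : StripData ι₁ ι₂)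

/-- This function is positive where `c < ‖H‖` and negative where `‖H‖ < c`. -/
def level (c : ℝ) (η : ℂ) : ℝ := ‖D.num η‖ - c * ‖D.den η‖

/-- The curve `‖H‖ = c` in the closed strip crosses the vertical line over `x` at height `y`,
with `y` on the boundary if it does not meet that line. -/
def IsCrossing (c x y : ℝ) : Prop :=
  y ∈ Icc 0 Real.pi ∧ (∀ y' ∈ Icc 0 Real.pi, y' < y → 0 < D.level c (xy x y')) ∧
    ∀ y' ∈ Icc 0 Real.pi, y < y' → D.level c (xy x y') < 0

variable {D}

/-- Clearing the denominator keeps the comparison of `‖H‖` with `c` continuous through the poles. -/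
lemma continuous_level (c : ℝ) : Continuous (D.level c) :=
  (continuous_num.norm).sub (continuous_const.mul continuous_den.norm)

lemma im_eq_pi_of_zero {d : ℝ} (hd : 0 < d) {η : ℂ} (hη : η ∈ cstrip)
    (h : 1 + Complex.exp η * (d : ℂ) = 0) : η.im = Real.pi := by
  rcases hη.2.lt_or_eq with h1 | h1
  · rcases hη.1.lt_or_eq with h2 | h2
    · exact absurd h (one_add_exp_mul_ne_zero_of_mem_ostrip hd ⟨h2, h1⟩)
    · rw [exp_of_im_eq_zero h2.symm] at h
      have : (0 : ℝ) < 1 + Real.exp η.re * d := by positivity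
      exact absurd (by exact_mod_cast h) this.ne'
  · exact h1

lemma im_eq_pi_of_num_eq_zero {η : ℂ} (hη : η ∈ cstrip) (h : D.num η = 0) : η.im = Real.pi := by
  have := (D.num_ne_zero_iff η).not
  push Not at this
  obtain ⟨i, hi⟩ := this.1 h
  exact im_eq_pi_of_zero (D.u_pos i) hη hi

lemma im_eq_zero_of_den_eq_zero {η : ℂ} (hη : η ∈ cstrip) (h : D.den η = 0) : η.im = 0 := by
  have := (D.den_ne_zero_iff η).not
  push Not at this
  obtain ⟨i, hi⟩ := this.1 h
  have h2 := im_eq_pi_of_zero (D.v_pos i) (stripRefl_mem hη) hi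
  rw [stripRefl_im] at h2
  linarith

variable {c : ℝ}

lemma level_eq {η : ℂ} (h : η ∈ D.reg) : D.level c η = ‖D.den η‖ * (‖D.H η‖ - c) := by
  have := norm_pos_iff.2 h.2.2
  rw [level, H, norm_div]
  field_simp

lemma level_eq_zero_iff {η : ℂ} (h : η ∈ D.reg) : D.level c η = 0 ↔ ‖D.H η‖ = c := by
  rw [level_eq h, mul_eq_zero, norm_eq_zero, sub_eq_zero]
  exact or_iff_right h.2.2

lemma mem_reg_of_level_eq_zero (hc : 0 < c) {η : ℂ} (hη : η ∈ cstrip) (h : D.level c η = 0) :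
    η ∈ D.reg := by
  refine ⟨hη, fun h0 => ?_, fun h0 => ?_⟩
  · have h1 := im_eq_pi_of_num_eq_zero hη h0
    rw [level, h0, norm_zero, zero_sub, neg_eq_zero] at h
    have h2 := norm_eq_zero.1 ((mul_eq_zero.1 h).resolve_left hc.ne')
    have h3 := im_eq_zero_of_den_eq_zero hη h2
    linarith [Real.pi_pos]
  · have h1 := im_eq_zero_of_den_eq_zero hη h0
    rw [level, h0, norm_zero, mul_zero, sub_zero] at h
    have h3 := im_eq_pi_of_num_eq_zero hη (norm_eq_zero.1 h)
    linarith [Real.pi_pos]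

/-- Extends the decrease of the modulus to vertical segments that end at a zero or a pole. Zeros lie
on the upper edge and poles on the lower one, so neither obstructs the comparison. -/
lemma level_neg_of_im_lt (hc : 0 < c) {x y₁ y₂ : ℝ} (h1 : y₁ ∈ Icc 0 Real.pi)
    (h2 : y₂ ∈ Icc 0 Real.pi) (hlt : y₁ < y₂) (hle : D.level c (xy x y₁) ≤ 0) :
    D.level c (xy x y₂) < 0 := by
  have d2 : D.den (xy x y₂) ≠ 0 := fun h0 => by
    have := im_eq_zero_of_den_eq_zero (xy_mem_cstrip h2) h0
    rw [xy_im] at this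
    linarith [h1.1]
  have n1 : D.num (xy x y₁) ≠ 0 := fun h0 => by
    have := im_eq_pi_of_num_eq_zero (xy_mem_cstrip h1) h0
    rw [xy_im] at this
    linarith [h2.2]
  have d1 : D.den (xy x y₁) ≠ 0 := fun h0 => by
    rw [level, h0, norm_zero, mul_zero, sub_zero] at hle
    exact n1 (norm_le_zero_iff.1 hle)
  by_cases n2 : D.num (xy x y₂) = 0
  · rw [level, n2, norm_zero, zero_sub, neg_neg_iff_pos]
    exact mul_pos hc (norm_pos_iff.2 d2)
  have r1 : xy x y₁ ∈ D.reg := ⟨xy_mem_cstrip h1, n1, d1⟩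
  have r2 : xy x y₂ ∈ D.reg := ⟨xy_mem_cstrip h2, n2, d2⟩
  have := norm_H_lt_of_im_lt r1 r2 (by simp) (by simpa using hlt)
  rw [level_eq r1] at hle
  rw [level_eq r2]
  have h3 : ‖D.H (xy x y₁)‖ - c ≤ 0 := nonpos_of_mul_nonpos_right hle (norm_pos_iff.2 d1)
  exact mul_neg_of_pos_of_neg (norm_pos_iff.2 d2) (by linarith)

lemma exists_isCrossing (D : StripData ι₁ ι₂) (hc : 0 < c) (x : ℝ) :
    ∃ y, D.IsCrossing c x y := by
  -- The point 0 is put in by hand, so that the supremum is 0 when the whole vertical segment has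
  -- `‖H‖ < c`.
  let S : Set ℝ := {y | y ∈ Icc 0 Real.pi ∧ (y = 0 ∨ 0 ≤ D.level c (xy x y))}
  have h0 : (0 : ℝ) ∈ S := ⟨⟨le_rfl, Real.pi_pos.le⟩, Or.inl rfl⟩
  have hb : BddAbove S := ⟨Real.pi, fun y hy => hy.1.2⟩
  refine ⟨sSup S, ⟨le_csSup hb h0, csSup_le ⟨0, h0⟩ fun y hy => hy.1.2⟩, fun y hy hlt => ?_,
    fun y hy hlt => ?_⟩
  · obtain ⟨y', hy', hlt'⟩ := exists_lt_of_lt_csSup ⟨0, h0⟩ hlt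
    by_contra! hcon
    have := level_neg_of_im_lt hc hy hy'.1 hlt' hcon
    rcases hy'.2 with h | h
    · linarith [hy.1]
    · linarith
  · by_contra! hcon
    exact (le_csSup hb ⟨hy, Or.inr hcon⟩).not_gt hlt

lemma isCrossing_of_level_eq_zero (hc : 0 < c) {x y : ℝ} (hy : y ∈ Icc 0 Real.pi)
    (h : D.level c (xy x y) = 0) : D.IsCrossing c x y := by
  refine ⟨hy, fun y' hy' hlt => ?_, fun y' hy' hlt => level_neg_of_im_lt hc hy hy' hlt h.le⟩
  by_contra! hcon
  exact (level_neg_of_im_lt hc hy' hy hlt hcon).ne h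

lemma IsCrossing.unique {x y₁ y₂ : ℝ} (h1 : D.IsCrossing c x y₁) (h2 : D.IsCrossing c x y₂) :
    y₁ = y₂ := by
  have key : ∀ {y₁ y₂}, D.IsCrossing c x y₁ → D.IsCrossing c x y₂ → ¬ y₁ < y₂ := by
    intro y₁ y₂ h1 h2 hlt
    have hm : (y₁ + y₂) / 2 ∈ Icc 0 Real.pi :=
      ⟨by linarith [h1.1.1, h2.1.1], by linarith [h1.1.2, h2.1.2]⟩
    have a := h1.2.2 _ hm (by linarith)
    have b := h2.2.1 _ hm (by linarith)
    linarith
  exact le_antisymm (not_lt.1 (key h2 h1)) (not_lt.1 (key h1 h2))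

lemma isCrossing_zero (hc : 0 < c) {x : ℝ} (h : D.level c (xy x 0) < 0) : D.IsCrossing c x 0 :=
  ⟨⟨le_rfl, Real.pi_pos.le⟩, fun _ hy' hlt => absurd hlt (not_lt.2 hy'.1), fun _ hy' hlt =>
    level_neg_of_im_lt hc ⟨le_rfl, Real.pi_pos.le⟩ hy' hlt h.le⟩

lemma isCrossing_pi (hc : 0 < c) {x : ℝ} (h : 0 < D.level c (xy x Real.pi)) :
    D.IsCrossing c x Real.pi :=
  ⟨⟨Real.pi_pos.le, le_rfl⟩, fun y' hy' hlt => by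
    by_contra! hcon
    exact (level_neg_of_im_lt hc hy' ⟨Real.pi_pos.le, le_rfl⟩ hlt hcon).not_gt h,
    fun y' hy' hlt => absurd hlt (not_lt.2 hy'.2)⟩

lemma continuous_level_xy (c y : ℝ) : Continuous fun x => D.level c (xy x y) :=
  (continuous_level c).comp (continuous_xy.comp (by fun_prop : Continuous fun x : ℝ => (x, y)))

lemma continuous_level_xy' (c x : ℝ) : Continuous fun y => D.level c (xy x y) :=
  (continuous_level c).comp (continuous_xy.comp (by fun_prop : Continuous fun y : ℝ => (x, y)))

/-- On an edge where the level curve is not met, the crossing sits at that edge. -/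
lemma IsCrossing.level_cases {x y : ℝ} (h : D.IsCrossing c x y) :
    D.level c (xy x y) = 0 ∨ (y = 0 ∧ D.level c (xy x y) < 0) ∨
      (y = Real.pi ∧ 0 < D.level c (xy x y)) := by
  have hcont : Continuous fun y => D.level c (xy x y) := continuous_level_xy' c x
  rcases lt_trichotomy (D.level c (xy x y)) 0 with hl | hl | hl
  · right; left
    refine ⟨?_, hl⟩
    by_contra hne
    have hpos : 0 < y := lt_of_le_of_ne h.1.1 (Ne.symm hne)
    have hev := hcont.continuousAt.eventually_lt continuousAt_const hl
    obtain ⟨l, hl1, hl2⟩ := exists_Ioc_subset_of_mem_nhds hev ⟨0, hpos⟩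
    have hm : (max l 0 + y) / 2 ∈ Ioc l y := by
      constructor <;> rcases max_cases l 0 with ⟨h1, h2⟩ | ⟨h1, h2⟩ <;> rw [h1] <;> linarith
    have hp : max l 0 < y := max_lt hl1 hpos
    have h3 := h.2.1 ((max l 0 + y) / 2) ⟨by linarith [le_max_right l 0], by linarith [h.1.2]⟩
      (by linarith)
    have h4 : D.level c (xy x ((max l 0 + y) / 2)) < 0 := hl2 hm
    linarith
  · exact Or.inl hl
  · right; right
    refine ⟨?_, hl⟩
    by_contra hne
    have hpos : y < Real.pi := lt_of_le_of_ne h.1.2 hne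
    have hev := continuousAt_const.eventually_lt hcont.continuousAt hl
    obtain ⟨l, hl1, hl2⟩ := exists_Ico_subset_of_mem_nhds hev ⟨Real.pi, hpos⟩
    have hp : y < min l Real.pi := lt_min hl1 hpos
    have hm : (min l Real.pi + y) / 2 ∈ Ico y l := by
      constructor <;> linarith [min_le_left l Real.pi]
    have h3 := h.2.2 ((min l Real.pi + y) / 2) ⟨by linarith [h.1.1], by
      linarith [min_le_right l Real.pi]⟩ (by linarith)
    have h4 : 0 < D.level c (xy x ((min l Real.pi + y) / 2)) := hl2 hm
    linarith

/-- The graph avoids zeros and poles even where it runs along an edge: the level is nonnegative at a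
pole and nonpositive at a zero. Hence `T` is continuous along the entire graph. -/
lemma IsCrossing.mem_reg (hc : 0 < c) {x y : ℝ} (h : D.IsCrossing c x y) : xy x y ∈ D.reg := by
  have hs := xy_mem_cstrip (x := x) h.1
  rcases h.level_cases with hl | ⟨hy, hl⟩ | ⟨hy, hl⟩
  · exact mem_reg_of_level_eq_zero hc hs hl
  · refine ⟨hs, fun h0 => ?_, fun h0 => ?_⟩
    · have := im_eq_pi_of_num_eq_zero hs h0
      rw [xy_im] at this
      linarith [Real.pi_pos]
    · rw [level, h0, norm_zero, mul_zero, sub_zero] at hl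
      exact (norm_nonneg _).not_gt hl
  · refine ⟨hs, fun h0 => ?_, fun h0 => ?_⟩
    · rw [level, h0, norm_zero, zero_sub, neg_pos] at hl
      exact (mul_nonneg hc.le (norm_nonneg _)).not_gt hl
    · have := im_eq_zero_of_den_eq_zero hs h0
      rw [xy_im] at this
      linarith [Real.pi_pos]

/-- The sign of the level at a fixed height just below or above the crossing persists over nearby
abscissae and traps the crossing there. -/
lemma continuous_crossing {Y : ℝ → ℝ} (hY : ∀ x, D.IsCrossing c x (Y x)) : Continuous Y := by
  rw [continuous_iff_continuousAt]
  intro x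
  refine tendsto_order.2 ⟨fun l hl => ?_, fun l hl => ?_⟩
  · rcases lt_or_ge l 0 with h0 | h0
    · exact .of_forall fun x' => h0.trans_le (hY x').1.1
    · have hm : (l + Y x) / 2 ∈ Icc 0 Real.pi := ⟨by linarith, by linarith [(hY x).1.2]⟩
      have h1 := (hY x).2.1 _ hm (by linarith)
      have h2 := (continuousAt_const.eventually_lt
        (continuous_level_xy c ((l + Y x) / 2)).continuousAt h1)
      filter_upwards [h2] with x' hx'
      by_contra! hcon
      exact ((hY x').2.2 _ hm (by linarith)).not_gt hx'
  · rcases lt_or_ge Real.pi l with h0 | h0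
    · exact .of_forall fun x' => ((hY x').1.2).trans_lt h0
    · have hm : (l + Y x) / 2 ∈ Icc 0 Real.pi := ⟨by linarith [(hY x).1.1], by linarith⟩
      have h1 := (hY x).2.2 _ hm (by linarith)
      have h2 := ((continuous_level_xy c ((l + Y x) / 2)).continuousAt.eventually_lt
        continuousAt_const h1)
      filter_upwards [h2] with x' hx'
      by_contra! hcon
      exact ((hY x').2.1 _ hm (by linarith)).not_gt hx'

lemma exists_mul_v_le_one (D : StripData ι₁ ι₂) : ∃ X : ℝ, ∀ x ≤ X, ∀ i, Real.exp x * D.v i ≤ 1 := by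
  set S := ∑' i, D.v i
  have hS : 0 ≤ S := tsum_nonneg fun i => (D.v_pos i).le
  refine ⟨Real.log (1 / (S + 1)), fun x hx i => ?_⟩
  have h1 : Real.exp x ≤ 1 / (S + 1) := by
    rw [← Real.exp_log (show 0 < 1 / (S + 1) by positivity)]
    exact Real.exp_le_exp.2 hx
  have h2 : D.v i ≤ S := D.v_sum.le_tsum i fun j _ => (D.v_pos j).le
  have h3 := (D.v_pos i).le
  calc Real.exp x * D.v i ≤ 1 / (S + 1) * (S + 1) := by gcongr; linarith
    _ = 1 := by field_simp

lemma tendsto_level_atBot (D : StripData ι₁ ι₂) (y : ℝ) :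
    Tendsto (fun x : ℝ => D.level c (xy x y)) atBot (𝓝 (-c)) := by
  have he : Tendsto (fun x : ℝ => Complex.exp (xy x y)) atBot (𝓝 0) := by
    rw [tendsto_zero_iff_norm_tendsto_zero]
    simpa [Complex.norm_exp] using Real.tendsto_exp_atBot
  have h1 : Tendsto (fun x : ℝ => D.den (xy x y)) atBot (𝓝 1) := by
    have := ((differentiable_linProd D.v_sum).continuous.tendsto 0).comp
      (by simpa using he.neg)
    rwa [linProd_zero] at this
  have h2 : Tendsto (fun x : ℝ => linProd D.u (Complex.exp (xy x y))) atBot (𝓝 1) := by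
    have := ((differentiable_linProd D.u_sum).continuous.tendsto 0).comp he
    rwa [linProd_zero] at this
  have h3 : Tendsto (fun x : ℝ => Complex.exp (D.A * Complex.exp (xy x y))) atBot (𝓝 1) := by
    have := (Complex.continuous_exp.tendsto _).comp (he.const_mul (D.A : ℂ))
    rw [mul_zero, Complex.exp_zero] at this
    exact this
  have h4 : Tendsto (fun x : ℝ => Complex.exp (D.P * xy x y)) atBot (𝓝 0) := by
    rw [tendsto_zero_iff_norm_tendsto_zero]
    have : Tendsto (fun x : ℝ => D.P * x) atBot atBot := tendsto_id.const_mul_atBot D.P_pos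
    refine (Real.tendsto_exp_atBot.comp this).congr fun x => ?_
    simp [Complex.norm_exp]
  have h5 := ((h4.mul h3).mul h2).norm.sub (h1.norm.const_mul c)
  simpa [level, num] using h5

/-- Along the curve `‖H‖ = c` the argument takes all values between zero and any value that it
attains. -/
lemma exists_T_eq_of_lt (hc : 0 < c) {η₂ : ℂ} (h2 : η₂ ∈ D.reg) (hH : ‖D.H η₂‖ = c) {τ : ℝ}
    (h0 : 0 ≤ τ) (hτ : τ < D.T η₂) : ∃ η ∈ D.reg, ‖D.H η‖ = c ∧ D.T η = τ := by
  choose Y hY using exists_isCrossing D hc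
  have hYc := continuous_crossing hY
  have hγ : Continuous fun x => xy x (Y x) :=
    continuous_xy.comp (continuous_id.prodMk hYc)
  have hTc : Continuous fun x => D.T (xy x (Y x)) :=
    continuousOn_T.comp_continuous hγ fun x => (hY x).mem_reg hc
  -- Far to the left `‖H‖ < c` and no pole has been passed, so the graph runs on the lower edge with
  -- `T = 0`.
  obtain ⟨X, hX⟩ := exists_mul_v_le_one D
  have hev := (tendsto_level_atBot (c := c) D 0).eventually_lt_const (neg_lt_zero.2 hc)
  obtain ⟨x₁, hx1l, hx1X, hx12⟩ :=
    (hev.and ((eventually_le_atBot X).and (eventually_le_atBot η₂.re))).exists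
  have hT1 : D.T (xy x₁ (Y x₁)) = 0 := by
    rw [(hY x₁).unique (isCrossing_zero hc hx1l), T_eq_zero_iff (by simp)]
    simpa using hX x₁ hx1X
  have hT2 : D.T (xy η₂.re (Y η₂.re)) = D.T η₂ := by
    have := isCrossing_of_level_eq_zero (D := D) hc (x := η₂.re) (y := η₂.im) h2.1
      (by rw [xy_eta]; exact (level_eq_zero_iff h2).2 hH)
    rw [(hY η₂.re).unique this, xy_eta]
  -- The last abscissa with `T = τ` is taken. If the graph were off the level curve there, it would
  -- follow an edge, `T` would be locally constant, and a later abscissa would carry the same value.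
  let S : Set ℝ := {x | D.T (xy x (Y x)) = τ} ∩ Icc x₁ η₂.re
  have hScl : IsCompact S :=
    isCompact_Icc.inter_left (isClosed_eq hTc continuous_const)
  have hSne : S.Nonempty := by
    obtain ⟨x, hx, hxT⟩ := intermediate_value_Icc hx12 hTc.continuousOn
      (show τ ∈ Icc _ _ from ⟨hT1.trans_le h0, by rw [hT2]; exact hτ.le⟩)
    exact ⟨x, hxT, hx⟩
  obtain ⟨x, ⟨hxT, hxI⟩, hmax⟩ := hScl.exists_isGreatest hSne
  change D.T (xy x (Y x)) = τ at hxT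
  have hxlt : x < η₂.re := by
    refine lt_of_le_of_ne hxI.2 fun h => ?_
    rw [h, hT2] at hxT
    exact hτ.ne' hxT
  refine ⟨xy x (Y x), (hY x).mem_reg hc, ?_, hxT⟩
  rw [← level_eq_zero_iff ((hY x).mem_reg hc)]
  by_contra hne
  -- off the curve the argument is locally constant
  have hconst : ∀ᶠ x' in 𝓝 x, ∃ n : ℤ, D.T (xy x' (Y x')) = τ + n * Real.pi := by
    rcases (hY x).level_cases with hl | ⟨hy, hl⟩ | ⟨hy, hl⟩
    · exact absurd hl hne
    · rw [hy] at hl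
      have hev := (continuous_level_xy (D := D) c 0).continuousAt.eventually_lt
        continuousAt_const hl
      obtain ⟨n₀, hn₀⟩ := exists_T_eq_of_im_eq_zero ((hY x).mem_reg hc) (by simpa using hy)
      filter_upwards [hev] with x' hx'
      have e := (hY x').unique (isCrossing_zero hc hx')
      obtain ⟨n, hn⟩ := exists_T_eq_of_im_eq_zero ((hY x').mem_reg hc) (by simpa using e)
      refine ⟨n - n₀, ?_⟩
      rw [hn, ← hxT, hn₀]
      push_cast; ring
    · rw [hy] at hl
      have hev := continuousAt_const.eventually_lt
        (continuous_level_xy (D := D) c Real.pi).continuousAt hl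
      obtain ⟨n₀, hn₀⟩ := exists_T_eq_of_im_eq_pi ((hY x).mem_reg hc) (by simpa using hy)
      filter_upwards [hev] with x' hx'
      have e := (hY x').unique (isCrossing_pi hc hx')
      obtain ⟨n, hn⟩ := exists_T_eq_of_im_eq_pi ((hY x').mem_reg hc) (by simpa using e)
      refine ⟨n - n₀, ?_⟩
      rw [hn, ← hxT, hn₀]
      push_cast; ring
  have hnear : ∀ᶠ x' in 𝓝 x, |D.T (xy x' (Y x')) - τ| < Real.pi := by
    have : ContinuousAt (fun x' => |D.T (xy x' (Y x')) - τ|) x :=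
      (hTc.sub continuous_const).abs.continuousAt
    refine this.eventually_lt continuousAt_const ?_
    rw [hxT, sub_self, abs_zero]
    exact Real.pi_pos
  have hlt : ∀ᶠ x' in 𝓝 x, x' < η₂.re := eventually_lt_nhds hxlt
  have hall := (hconst.and (hnear.and hlt)).filter_mono (nhdsWithin_le_nhds (s := Ioi x))
  obtain ⟨x', ⟨⟨n, hn⟩, hn2, hn3⟩, hx'⟩ := (hall.and self_mem_nhdsWithin).exists
  have hx'' : x < x' := hx'
  have hn0 : n = 0 := by
    rw [hn, add_sub_cancel_left, abs_mul, abs_of_pos Real.pi_pos] at hn2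
    have : |(n : ℝ)| < 1 := by
      by_contra! h
      nlinarith [Real.pi_pos]
    rw [← Int.abs_lt_one_iff]
    exact_mod_cast this
  rw [hn0, Int.cast_zero, zero_mul, add_zero] at hn
  exact (hmax ⟨hn, hxI.1.trans hx''.le, hn3.le⟩).not_gt hx''

end StripData

/-! ### Monotonicity of logarithmic derivatives. -/

/-- The logarithmic derivative of `linProd c`. -/
def logDerivSum {ι : Type*} (c : ι → ℝ) (w : ℂ) : ℂ := ∑' i, (c i : ℂ) / (1 + w * (c i : ℂ))

section LogDerivSum

variable {ι : Type*} {c : ι → ℝ}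

/-- The extra factor `w.im` makes the terms nonnegative for positive `c` in both half-planes, so the
sum over the poles, taken at `-w`, needs no separate argument. -/
lemma hasSum_im_mul_logDerivSum (hc : Summable c) (w : ℂ) :
    HasSum (fun i => w.im * (w.im * c i / Complex.normSq (1 + w * (c i : ℂ))))
      (w.im * (w * logDerivSum c w).im) := by
  have h := (Complex.hasSum_im ((summable_div_one_add hc w).hasSum.mul_left w)).mul_left w.im
  refine h.congr_fun fun i => ?_
  rw [← im_div_one_add_mul, mul_div_assoc]

lemma im_mul_im_logDerivSum_nonneg (hc : Summable c) (hpos : ∀ i, 0 < c i) (w : ℂ) :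
    0 ≤ w.im * (w * logDerivSum c w).im := by
  refine (hasSum_im_mul_logDerivSum hc w).nonneg fun i => ?_
  have := (hpos i).le
  have := Complex.normSq_nonneg (1 + w * (c i : ℂ))
  rw [show w.im * (w.im * c i / Complex.normSq (1 + w * (c i : ℂ)))
    = w.im ^ 2 * c i / Complex.normSq (1 + w * (c i : ℂ)) by ring]
  positivity

lemma im_mul_im_logDerivSum_pos [Nonempty ι] (hc : Summable c) (hpos : ∀ i, 0 < c i) {w : ℂ}
    (hw : w.im ≠ 0) : 0 < w.im * (w * logDerivSum c w).im := by
  have h := hasSum_im_mul_logDerivSum hc w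
  have e : ∀ i, w.im * (w.im * c i / Complex.normSq (1 + w * (c i : ℂ)))
    = w.im ^ 2 * c i / Complex.normSq (1 + w * (c i : ℂ)) := fun i => by ring
  have hp : ∀ i, 0 < w.im * (w.im * c i / Complex.normSq (1 + w * (c i : ℂ))) := by
    intro i
    rw [e]
    have := hpos i
    have h1 : 1 + w * (c i : ℂ) ≠ 0 := by
      intro h0
      have := congrArg Complex.im h0
      simp [hw, (hpos i).ne'] at this
    have := Complex.normSq_pos.2 h1
    positivity
  rw [← h.tsum_eq]
  exact h.summable.tsum_pos (fun i => (hp i).le) (Classical.arbitrary ι) (hp _)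

/-- The real version of `logDerivSum`. -/
def realLogDerivSum (c : ι → ℝ) (x : ℝ) : ℝ := ∑' i, c i / (1 + x * c i)

lemma logDerivSum_ofReal (x : ℝ) : logDerivSum c (x : ℂ) = (realLogDerivSum c x : ℂ) := by
  rw [logDerivSum, realLogDerivSum, Complex.ofReal_tsum]
  push_cast
  rfl

lemma hasSum_realLogDerivSum (hc : Summable c) (x : ℝ) :
    HasSum (fun i => c i / (1 + x * c i)) (realLogDerivSum c x) := by
  have h := (summable_div_one_add hc (x : ℂ)).hasSum
  have h2 := Complex.hasSum_re h
  have : Summable fun i => c i / (1 + x * c i) := by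
    refine h2.summable.congr fun i => ?_
    norm_cast
  exact this.hasSum

/-- Termwise the difference is `(x - x₀) c / ((1 - x c) (1 - x₀ c))`, with both denominator factors
in `(0, 1]`. Chord bounds of this kind avoid differentiating the series. -/
lemma realLogDerivSum_neg_chord (hc : Summable c) (hpos : ∀ i, 0 < c i) {x₀ x : ℝ} (h0 : 0 ≤ x₀)
    (hx : x₀ ≤ x) (h1 : ∀ i, x * c i < 1) :
    (x - x₀) * (∑' i, c i) ≤ x * realLogDerivSum c (-x) - x₀ * realLogDerivSum c (-x₀) := by
  refine hasSum_le (fun i => ?_) (hc.hasSum.mul_left _)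
    (((hasSum_realLogDerivSum hc (-x)).mul_left x).sub
      ((hasSum_realLogDerivSum hc (-x₀)).mul_left x₀))
  have hci := hpos i
  have hi := h1 i
  have hi0 : x₀ * c i ≤ x * c i := by gcongr
  have p1 : 0 < 1 + -x * c i := by linarith
  have p2 : 0 < 1 + -x₀ * c i := by linarith
  have e : x * (c i / (1 + -x * c i)) - x₀ * (c i / (1 + -x₀ * c i))
      = (x - x₀) * c i / ((1 + -x * c i) * (1 + -x₀ * c i)) := by
    rw [← mul_div_assoc, ← mul_div_assoc, div_sub_div _ _ p1.ne' p2.ne']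
    congr 1; ring
  rw [e, le_div_iff₀ (by positivity)]
  refine mul_le_of_le_one_right (mul_nonneg (by linarith) hci.le) ?_
  have : 0 ≤ x₀ * c i := by positivity
  exact mul_le_one₀ (by linarith) p2.le (by linarith)

lemma realLogDerivSum_chord (hc : Summable c) (hpos : ∀ i, 0 < c i) {x₀ x X : ℝ} (h0 : 0 ≤ x₀)
    (hx : x₀ ≤ x) (hX : x ≤ X) :
    (x - x₀) * (∑' i, c i / (1 + X * c i) ^ 2)
      ≤ x * realLogDerivSum c x - x₀ * realLogDerivSum c x₀ := by
  have hX0 : 0 ≤ X := by linarith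
  have hsum : Summable fun i => c i / (1 + X * c i) ^ 2 := by
    refine hc.of_nonneg_of_le (fun i => ?_) fun i => ?_
    · have := hpos i
      positivity
    · have := hpos i
      refine div_le_self this.le (one_le_pow₀ ?_)
      have := mul_nonneg hX0 this.le
      linarith
  refine hasSum_le (fun i => ?_) (hsum.hasSum.mul_left _)
    (((hasSum_realLogDerivSum hc x).mul_left x).sub
      ((hasSum_realLogDerivSum hc x₀).mul_left x₀))
  have hci := hpos i
  have hx0 : 0 ≤ x := by linarith
  have p1 : 0 < 1 + x * c i := by positivity
  have p2 : 0 < 1 + x₀ * c i := by positivity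
  have e : x * (c i / (1 + x * c i)) - x₀ * (c i / (1 + x₀ * c i))
      = (x - x₀) * (c i / ((1 + x * c i) * (1 + x₀ * c i))) := by
    field_simp; ring
  rw [e, sq]
  have : 0 ≤ x - x₀ := by linarith
  have : x₀ ≤ X := by linarith
  gcongr

/-- On the positive axis the logarithm of the product is a sum of nonnegative terms, so the product
dominates each factor. This yields decay along the upper edge when there is a pole. -/
lemma one_add_le_norm_linProd (hc : Summable c) (hpos : ∀ i, 0 < c i) (s : ℝ) (i : ι) :
    1 + Real.exp s * c i ≤ ‖linProd c (Real.exp s : ℂ)‖ ∧ 1 ≤ ‖linProd c (Real.exp s : ℂ)‖ := by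
  have e0 : Complex.exp (s : ℂ) = (Real.exp s : ℂ) := by simp
  have hη : (s : ℂ) ∈ stripReg c := by
    refine ⟨⟨by simp, by simp [Real.pi_pos.le]⟩, fun j => ?_⟩
    rw [e0]
    have := hpos j
    have : (0 : ℝ) < 1 + Real.exp s * c j := by positivity
    exact_mod_cast this.ne'
  have h1 := exp_logSum hc hη
  rw [e0] at h1
  rw [← h1, Complex.norm_exp]
  have h2 := Complex.hasSum_re (summable_log_term hc (s : ℂ)).hasSum
  have e : ∀ j, (Complex.log (1 + Complex.exp (s : ℂ) * (c j : ℂ))).re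
      = Real.log (1 + Real.exp s * c j) := by
    intro j
    have := hpos j
    have hp : (0 : ℝ) < 1 + Real.exp s * c j := by positivity
    rw [Complex.log_re, e0]
    rw [show (1 + (Real.exp s : ℂ) * c j : ℂ) = ((1 + Real.exp s * c j : ℝ) : ℂ) by push_cast; ring,
      Complex.norm_real, Real.norm_of_nonneg hp.le]
  simp only [e] at h2
  have hn : ∀ j, 0 ≤ Real.log (1 + Real.exp s * c j) := fun j => by
    have := hpos j
    refine Real.log_nonneg ?_
    have : 0 ≤ Real.exp s * c j := by positivity
    linarith
  have hp : (0 : ℝ) < 1 + Real.exp s * c i := by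
    have := hpos i
    positivity
  constructor
  · rw [← Real.exp_log hp]
    exact Real.exp_le_exp.2 (le_hasSum h2 i fun j _ => hn j)
  · exact Real.one_le_exp (h2.nonneg hn)

end LogDerivSum

/-- A positive function `f` with `f' = f q`, `q` strictly decreasing, attains a value exceeding its
values at the end points either twice or at a single critical point. -/
lemma exists_two_solutions {f q : ℝ → ℝ} {l r c s₁ : ℝ} (hf : ContinuousOn f (Icc l r))
    (hd : ∀ s ∈ Ioo l r, HasDerivAt f (f s * q s) s) (hpos : ∀ s ∈ Ioo l r, f s ≠ 0)
    (hq : StrictAntiOn q (Ioo l r)) (hl : f l < c) (hr : f r < c) (hs₁ : s₁ ∈ Ioo l r)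
    (hfs : f s₁ = c) :
    ∃ a ∈ Ioo l r, ∃ b ∈ Ioo l r, f a = c ∧ f b = c ∧ (∀ s ∈ Ioo l r, f s = c → s = a ∨ s = b) ∧
      ((a = b ∧ q a = 0) ∨ (a < b ∧ q a ≠ 0 ∧ q b ≠ 0)) := by
  have hlr : l ≤ r := (hs₁.1.trans hs₁.2).le
  obtain ⟨ξ, hξ, hmax⟩ := isCompact_Icc.exists_isMaxOn (nonempty_Icc.2 hlr) hf
  have hcξ : c ≤ f ξ := hfs ▸ hmax ⟨hs₁.1.le, hs₁.2.le⟩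
  have hmem : ∀ s ∈ Icc l r, c ≤ f s → s ∈ Ioo l r := by
    intro s hs hcs
    refine ⟨lt_of_le_of_ne hs.1 ?_, lt_of_le_of_ne hs.2 ?_⟩
    · rintro rfl; linarith
    · rintro rfl; linarith
  -- A maximum with value at least `c` is interior because both end values are below `c`, hence it
  -- is a zero of `q`.
  have hcrit : ∀ s ∈ Icc l r, c ≤ f s → (∀ t ∈ Icc l r, f t ≤ f s) → q s = 0 := by
    intro s hs hcs hmx
    have hso := hmem s hs hcs
    have hloc : IsLocalMax f s := by
      filter_upwards [Icc_mem_nhds hso.1 hso.2] with t ht using hmx t ht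
    exact (mul_eq_zero.1 (hloc.hasDerivAt_eq_zero (hd s hso))).resolve_left (hpos s hso)
  have hξo := hmem ξ hξ hcξ
  have hqξ := hcrit ξ hξ hcξ fun t ht => hmax ht
  rcases hcξ.eq_or_lt with heq | hlt
  · refine ⟨ξ, hξo, ξ, hξo, heq.symm, heq.symm, fun s hs hsc => Or.inl ?_, Or.inl ⟨rfl, hqξ⟩⟩
    have hqs := hcrit s ⟨hs.1.le, hs.2.le⟩ hsc.ge fun t ht => by
      rw [hsc, heq]; exact hmax ht
    exact hq.injOn hs hξo (hqs.trans hqξ.symm)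
  -- Between two points of equal value Rolle gives a zero of `q`, which must be `ξ`. So each side of
  -- `ξ` carries only one solution.
  · have hrolle : ∀ s t, s ∈ Ioo l r → t ∈ Ioo l r → s < t → f s = f t →
        ∃ m ∈ Ioo s t, m = ξ := by
      intro s t hs ht hst hft
      obtain ⟨m, hm, hm0⟩ := exists_hasDerivAt_eq_zero (f := f) (f' := fun s => f s * q s) hst
        (hf.mono (Icc_subset_Icc hs.1.le ht.2.le)) hft
        fun x hx => hd x ⟨hs.1.trans hx.1, hx.2.trans ht.2⟩
      have hmo : m ∈ Ioo l r := ⟨hs.1.trans hm.1, hm.2.trans ht.2⟩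
      have hqm := (mul_eq_zero.1 hm0).resolve_left (hpos m hmo)
      exact ⟨m, hm, hq.injOn hmo hξo (hqm.trans hqξ.symm)⟩
    obtain ⟨a, ha, hac⟩ := intermediate_value_Ioo hξ.1 (hf.mono (Icc_subset_Icc_right hξ.2))
      (show c ∈ Ioo _ _ from ⟨hl, hlt⟩)
    obtain ⟨b, hb, hbc⟩ := intermediate_value_Ioo' hξ.2 (hf.mono (Icc_subset_Icc_left hξ.1))
      (show c ∈ Ioo _ _ from ⟨hr, hlt⟩)
    have hao : a ∈ Ioo l r := ⟨ha.1, ha.2.trans hξo.2⟩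
    have hbo : b ∈ Ioo l r := ⟨hξo.1.trans hb.1, hb.2⟩
    refine ⟨a, hao, b, hbo, hac, hbc, fun s hs hsc => ?_, Or.inr ⟨ha.2.trans hb.1, ?_, ?_⟩⟩
    · rcases lt_trichotomy s ξ with h | h | h
      · left
        by_contra hne
        rcases lt_or_gt_of_ne hne with h' | h'
        · obtain ⟨m, hm, rfl⟩ := hrolle s a hs hao h' (hsc.trans hac.symm)
          exact lt_asymm hm.2 ha.2
        · obtain ⟨m, hm, rfl⟩ := hrolle a s hao hs h' (hac.trans hsc.symm)
          exact lt_asymm hm.2 h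
      · rw [h] at hsc; linarith
      · right
        by_contra hne
        rcases lt_or_gt_of_ne hne with h' | h'
        · obtain ⟨m, hm, rfl⟩ := hrolle s b hs hbo h' (hsc.trans hbc.symm)
          exact lt_asymm hm.1 h
        · obtain ⟨m, hm, rfl⟩ := hrolle b s hbo hs h' (hbc.trans hsc.symm)
          exact lt_asymm hm.1 hb.1
    · have := hq hao hξo ha.2
      linarith
    · have := hq hξo hbo hb.1
      linarith

/-! ### Zeros of the logarithmic derivative of `H`. -/

namespace StripData

variable {ι₁ ι₂ : Type*} (D : StripData ι₁ ι₂)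

/-- The logarithmic derivative of `H`, as a function of `w = exp η`. -/
def G (w : ℂ) : ℂ := D.P + D.A * w + w * logDerivSum D.u w + w * logDerivSum D.v (-w)

/-- The values of `G` on the negative half-axis. -/
def g (x : ℝ) : ℝ := D.P - D.A * x - x * realLogDerivSum D.u (-x) - x * realLogDerivSum D.v x

variable {D}

/-- `Im w * Im G(w)` is a sum of nonnegative terms, one of them positive by nonconstancy. -/
lemma G_ne_zero_of_im_ne_zero {w : ℂ} (hw : w.im ≠ 0) : D.G w ≠ 0 := by
  intro h0
  have h1 := im_mul_im_logDerivSum_nonneg D.u_sum D.u_pos w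
  have h2 := im_mul_im_logDerivSum_nonneg D.v_sum D.v_pos (-w)
  have h3 : 0 < w.im ^ 2 := by positivity
  have e := congrArg Complex.im h0
  simp only [G, Complex.add_im, Complex.ofReal_im, Complex.zero_im] at e
  have e2 : (-w * logDerivSum D.v (-w)).im = - (w * logDerivSum D.v (-w)).im := by
    rw [neg_mul, Complex.neg_im]
  have e3 : (D.A * w : ℂ).im = D.A * w.im := by simp
  have h4 := mul_nonneg D.A_nonneg h3.le
  have e4 : D.A * w.im ^ 2 + w.im * (w * logDerivSum D.u w).im
      + (-w).im * (-w * logDerivSum D.v (-w)).im = 0 := by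
    rw [e2, Complex.neg_im]
    rw [e3] at e
    linear_combination w.im * e
  rcases D.nonconst with h | h | h
  · have := mul_pos h h3
    linarith
  · have := im_mul_im_logDerivSum_pos D.u_sum D.u_pos hw
    linarith
  · have := im_mul_im_logDerivSum_pos D.v_sum D.v_pos (w := -w) (by simpa using hw)
    linarith

lemma G_neg_ofReal (x : ℝ) : D.G (-(x : ℂ)) = (D.g x : ℂ) := by
  rw [G, g, neg_neg, logDerivSum_ofReal, ← Complex.ofReal_neg, logDerivSum_ofReal]
  push_cast
  ring

lemma G_ne_zero_of_pos {x : ℝ} (hx : 0 ≤ x) (h : ∀ i, x * D.v i ≤ 1) : D.G (x : ℂ) ≠ 0 := by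
  have e : D.G (x : ℂ)
      = ((D.P + D.A * x + x * realLogDerivSum D.u x + x * realLogDerivSum D.v (-x) : ℝ) : ℂ) := by
    rw [G, logDerivSum_ofReal, ← Complex.ofReal_neg, logDerivSum_ofReal]
    push_cast
    ring
  rw [e]
  have h1 : 0 ≤ realLogDerivSum D.u x := (hasSum_realLogDerivSum D.u_sum x).nonneg fun i => by
    have := D.u_pos i
    positivity
  have h2 : 0 ≤ realLogDerivSum D.v (-x) := (hasSum_realLogDerivSum D.v_sum (-x)).nonneg fun i => by
    have := D.v_pos i
    have := h i
    exact div_nonneg (by linarith) (by linarith)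
  have := D.P_pos
  have := D.A_nonneg
  have : 0 < D.P + D.A * x + x * realLogDerivSum D.u x + x * realLogDerivSum D.v (-x) := by
    positivity
  exact_mod_cast this.ne'

/-- Before the first zero, `g` decreases at a rate bounded away from 0, with `δ` read off from the
chord bounds of the two sums. The uniform rate later rules out critical points and not just equal
values. -/
lemma exists_g_chord (D : StripData ι₁ ι₂) {X : ℝ} (hX0 : 0 ≤ X) (hX : ∀ i, X * D.u i < 1) :
    ∃ δ > 0, ∀ x₀ x, 0 ≤ x₀ → x₀ ≤ x → x ≤ X → D.g x ≤ D.g x₀ - δ * (x - x₀) := by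
  have hn1 : ∀ i, 0 ≤ D.v i / (1 + X * D.v i) ^ 2 := fun i => by
    have := D.v_pos i
    positivity
  have hn2 : 0 ≤ ∑' i, D.v i / (1 + X * D.v i) ^ 2 := tsum_nonneg hn1
  have hn3 : 0 ≤ ∑' i, D.u i := tsum_nonneg fun i => (D.u_pos i).le
  refine ⟨D.A + (∑' i, D.u i) + ∑' i, D.v i / (1 + X * D.v i) ^ 2, ?_, fun x₀ x h0 hx hxX => ?_⟩
  · have := D.A_nonneg
    rcases D.nonconst with h | h | h
    · linarith
    · have := D.u_sum.tsum_pos (fun i => (D.u_pos i).le) (Classical.arbitrary ι₁) (D.u_pos _)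
      linarith
    · have hsum : Summable fun i => D.v i / (1 + X * D.v i) ^ 2 := by
        refine D.v_sum.of_nonneg_of_le hn1 fun i => ?_
        have := D.v_pos i
        refine div_le_self this.le (one_le_pow₀ ?_)
        have := mul_nonneg hX0 this.le
        linarith
      have := hsum.tsum_pos hn1 (Classical.arbitrary ι₂) (by
        have := D.v_pos (Classical.arbitrary ι₂)
        positivity)
      linarith
  · have h1 := realLogDerivSum_neg_chord D.u_sum D.u_pos h0 hx fun i =>
      (mul_le_mul_of_nonneg_right hxX (D.u_pos i).le).trans_lt (hX i)
    have h2 := realLogDerivSum_chord D.v_sum D.v_pos h0 hx hxX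
    unfold g
    linarith

/-- `g (exp s)` has no critical points. -/
lemma not_hasDerivAt_g_exp {s X : ℝ} (hsX : s < X) (hX : ∀ i, Real.exp X * D.u i < 1) :
    ¬ HasDerivAt (fun t => D.g (Real.exp t)) 0 s := by
  intro h
  obtain ⟨δ, hδ, hg⟩ := exists_g_chord D (Real.exp_pos X).le hX
  -- At a critical point this function would have the positive derivative `δ exp s`, although its
  -- slopes to the right of `s` are nonpositive.
  have h2 : HasDerivAt (fun t => D.g (Real.exp t) + δ * Real.exp t) (δ * Real.exp s) s := by
    have := h.add ((Real.hasDerivAt_exp s).const_mul δ)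
    rw [zero_add] at this
    exact this
  have h3 := (hasDerivAt_iff_tendsto_slope.1 h2).mono_left
    (nhdsWithin_mono s (fun t (ht : t ∈ Ioi s) => ne_of_gt ht))
  have h4 : ∀ᶠ t in 𝓝[>] s, slope (fun t => D.g (Real.exp t) + δ * Real.exp t) s t ≤ 0 := by
    filter_upwards [Ioo_mem_nhdsGT hsX] with t ht
    rw [slope_def_field]
    refine div_nonpos_of_nonpos_of_nonneg ?_ (sub_nonneg.2 ht.1.le)
    have := hg (Real.exp s) (Real.exp t) (Real.exp_pos s).le (Real.exp_le_exp.2 ht.1.le)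
      (Real.exp_le_exp.2 ht.2.le)
    linarith
  have h5 := le_of_tendsto h3 h4
  have := mul_pos hδ (Real.exp_pos s)
  linarith

lemma g_exp_lt {s t : ℝ} (hst : s < t) (ht : ∀ i, Real.exp t * D.u i < 1) :
    D.g (Real.exp t) < D.g (Real.exp s) := by
  obtain ⟨δ, hδ, hg⟩ := exists_g_chord D (Real.exp_pos t).le ht
  have h1 := hg _ _ (Real.exp_pos s).le (Real.exp_le_exp.2 hst.le) le_rfl
  have h2 := Real.exp_lt_exp.2 hst
  nlinarith

end StripData

/-! ### Derivatives of `F` and multiplicities. -/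

lemma isAlphaPointOfMult_one {f : ℂ → ℂ} {α z : ℂ} (h : f z = α) (hd : deriv f z ≠ 0) :
    IsAlphaPointOfMult f α z 1 :=
  ⟨h, le_rfl, fun i h1 h2 => absurd h1 (not_le.2 h2), by rwa [iteratedDeriv_one]⟩

lemma isAlphaPointOfMult_two {f : ℂ → ℂ} {α z : ℂ} (h : f z = α) (hd : deriv f z = 0)
    (hdd : deriv (deriv f) z ≠ 0) : IsAlphaPointOfMult f α z 2 := by
  refine ⟨h, one_le_two, fun i h1 h2 => ?_, by
    rwa [iteratedDeriv_succ, iteratedDeriv_one]⟩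
  obtain rfl : i = 1 := by omega
  rwa [iteratedDeriv_one]

namespace StripData

variable {ι₁ ι₂ : Type*} (D : StripData ι₁ ι₂)

/-- The meromorphic function `z ^ p R(z ^ k)`. -/
def F (p k : ℕ) (z : ℂ) : ℂ :=
  z ^ p * Complex.exp (D.A * z ^ k) * linProd D.u (z ^ k) / linProd D.v (-z ^ k)

variable {D} {p k : ℕ}

lemma F_exp (hk : k ≠ 0) (hP : D.P = p / k) (η : ℂ) : D.F p k (Complex.exp (η / k)) = D.H η := by
  have hk' : (k : ℂ) ≠ 0 := Nat.cast_ne_zero.2 hk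
  have e1 : Complex.exp (η / k) ^ k = Complex.exp η := by
    rw [← Complex.exp_nat_mul]; congr 1; field_simp
  have e2 : Complex.exp (η / k) ^ p = Complex.exp (D.P * η) := by
    rw [← Complex.exp_nat_mul, hP]; congr 1; push_cast; field_simp
  rw [F, e1, e2, H, num, den]

lemma hasDerivAt_F (hp : p ≠ 0) (hk : k ≠ 0) (hP : D.P = p / k) {z : ℂ} (hz : D.F p k z ≠ 0) :
    HasDerivAt (D.F p k) (D.F p k z * (k * D.G (z ^ k) / z)) z := by
  have hz' := hz
  simp only [F, div_ne_zero_iff, mul_ne_zero_iff] at hz'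
  obtain ⟨⟨⟨h1, h2⟩, h3⟩, h4⟩ := hz'
  have hz0 : z ≠ 0 := fun h0 => h1 (by rw [h0, zero_pow hp])
  have hk' : (k : ℂ) ≠ 0 := Nat.cast_ne_zero.2 hk
  have dk : HasDerivAt (fun z : ℂ => z ^ k) (k * z ^ k / z) z := by
    refine (hasDerivAt_pow k z).congr_deriv ?_
    obtain ⟨n, rfl⟩ := Nat.exists_eq_succ_of_ne_zero hk
    rw [Nat.succ_sub_one, pow_succ]; field_simp
  have dp : HasDerivAt (fun z : ℂ => z ^ p) (p * z ^ p / z) z := by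
    refine (hasDerivAt_pow p z).congr_deriv ?_
    obtain ⟨n, rfl⟩ := Nat.exists_eq_succ_of_ne_zero hp
    rw [Nat.succ_sub_one, pow_succ]; field_simp
  have de := (dk.const_mul (D.A : ℂ)).cexp
  have du : HasDerivAt (fun z : ℂ => linProd D.u (z ^ k)) _ z :=
    (hasDerivAt_linProd D.u_sum h3).comp z dk
  have dnk : HasDerivAt (fun z : ℂ => -z ^ k) (-(k * z ^ k / z)) z := dk.neg
  have dv := (hasDerivAt_linProd D.v_sum h4).comp z dnk
  have key := ((dp.mul de).mul du).div dv h4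
  refine key.congr_deriv ?_
  simp only [Pi.mul_apply, Function.comp_apply]
  rw [F, G, hP]
  simp only [logDerivSum]
  set S₁ := ∑' i, (D.u i : ℂ) / (1 + z ^ k * (D.u i : ℂ))
  set S₂ := ∑' i, (D.v i : ℂ) / (1 + -z ^ k * (D.v i : ℂ))
  set E₁ := linProd D.u (z ^ k)
  set E₂ := linProd D.v (-z ^ k)
  push_cast
  field_simp
  ring

lemma eventually_F_ne_zero (hp : p ≠ 0) (hk : k ≠ 0) (hP : D.P = p / k) {z : ℂ}
    (hz : D.F p k z ≠ 0) : ∀ᶠ z' in 𝓝 z, D.F p k z' ≠ 0 :=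
  (hasDerivAt_F hp hk hP hz).continuousAt.eventually_ne hz

lemma deriv_F_ne_zero (hp : p ≠ 0) (hk : k ≠ 0) (hP : D.P = p / k) {z : ℂ} (hz : D.F p k z ≠ 0)
    (hG : D.G (z ^ k) ≠ 0) : deriv (D.F p k) z ≠ 0 := by
  have hz0 : z ≠ 0 := fun h0 => hz (by simp [F, h0, zero_pow hp])
  rw [(hasDerivAt_F hp hk hP hz).deriv]
  exact mul_ne_zero hz (div_ne_zero (mul_ne_zero (Nat.cast_ne_zero.2 hk) hG) hz0)

lemma hasDerivAt_H (hp : p ≠ 0) (hk : k ≠ 0) (hP : D.P = p / k) {η : ℂ} (h : D.H η ≠ 0) :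
    HasDerivAt D.H (D.H η * D.G (Complex.exp η)) η := by
  have hk' : (k : ℂ) ≠ 0 := Nat.cast_ne_zero.2 hk
  have e1 : Complex.exp (η / k) ^ k = Complex.exp η := by
    rw [← Complex.exp_nat_mul]; congr 1; field_simp
  have h1 : HasDerivAt (fun η : ℂ => Complex.exp (η / k)) (Complex.exp (η / k) * (1 / k)) η :=
    ((hasDerivAt_id η).div_const (k : ℂ)).cexp
  have h2 := (hasDerivAt_F hp hk hP (z := Complex.exp (η / k))
    (by rwa [F_exp hk hP])).comp η h1
  have e2 : (D.F p k ∘ fun η : ℂ => Complex.exp (η / k)) = D.H := funext (F_exp hk hP)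
  rw [e2, F_exp hk hP, e1] at h2
  refine h2.congr_deriv ?_
  have := Complex.exp_ne_zero (η / k)
  field_simp

/-- The double point criterion on the rays `z ^ k < 0`. -/
lemma deriv_deriv_F_ne_zero (hp : p ≠ 0) (hk : k ≠ 0) (hP : D.P = p / k) {z : ℂ}
    (hz : D.F p k z ≠ 0) {s X : ℝ} (hzs : z ^ k = -(Real.exp s : ℂ)) (hsX : s < X)
    (hX : ∀ i, Real.exp X * D.u i < 1) (hd : deriv (D.F p k) z = 0) :
    deriv (deriv (D.F p k)) z ≠ 0 := by
  intro hdd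
  have hk' : (k : ℂ) ≠ 0 := Nat.cast_ne_zero.2 hk
  have hz0 : z ≠ 0 := fun h0 => hz (by simp [F, h0, zero_pow hp])
  have hev := eventually_F_ne_zero hp hk hP hz
  have han : AnalyticAt ℂ (D.F p k) z := by
    rw [Complex.analyticAt_iff_eventually_differentiableAt]
    filter_upwards [hev] with z' hz' using (hasDerivAt_F hp hk hP hz').differentiableAt
  have hF := han.differentiableAt.hasDerivAt
  have hF' := han.deriv.differentiableAt.hasDerivAt
  rw [hd] at hF
  rw [hdd] at hF'
  -- If `F'` and `F''` both vanished at `z`, then `y F'(y) / (k F(y)) = G(y ^ k)` would have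
  -- derivative 0 there. Along the ray `γ` through `z` it equals `g (exp t)`, which has no critical
  -- point.
  have hq : HasDerivAt (fun y => y * deriv (D.F p k) y / (k * D.F p k y)) 0 z := by
    have := ((hasDerivAt_id z).mul hF').div (hF.const_mul (k : ℂ)) (mul_ne_zero hk' hz)
    refine this.congr_deriv ?_
    simp [hd]
  let γ : ℝ → ℂ := fun t => z * Complex.exp (((t - s) / k : ℝ) : ℂ)
  have hγs : γ s = z := by simp [γ]
  have hγk : ∀ t, γ t ^ k = -(Real.exp t : ℂ) := by
    intro t
    simp only [γ]
    rw [mul_pow, hzs, ← Complex.exp_nat_mul, Complex.ofReal_exp, Complex.ofReal_exp, neg_mul,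
      ← Complex.exp_add]
    congr 2
    push_cast
    field_simp
    ring
  have hγd : DifferentiableAt ℝ γ s := by
    have h0 : DifferentiableAt ℝ (fun t : ℝ => (t - s) / (k : ℝ)) s := by fun_prop
    have h1 := h0.hasDerivAt.ofReal_comp
    exact (h1.cexp.const_mul z).differentiableAt
  have hcomp : HasDerivAt (fun t => γ t * deriv (D.F p k) (γ t) / (k * D.F p k (γ t))) 0 s := by
    have := HasDerivAt.comp s (hγs.symm ▸ hq) hγd.hasDerivAt
    rw [zero_mul] at this
    exact this
  have heq : (fun t => γ t * deriv (D.F p k) (γ t) / (k * D.F p k (γ t)))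
      =ᶠ[𝓝 s] fun t => ((D.g (Real.exp t) : ℝ) : ℂ) := by
    have h1 : ∀ᶠ t in 𝓝 s, D.F p k (γ t) ≠ 0 :=
      hγd.continuousAt.eventually (hγs.symm ▸ hev)
    filter_upwards [h1] with t ht
    rw [(hasDerivAt_F hp hk hP ht).deriv, hγk, G_neg_ofReal]
    have : γ t ≠ 0 := mul_ne_zero hz0 (Complex.exp_ne_zero _)
    field_simp
  have h2 := hcomp.congr_of_eventuallyEq heq.symm
  have h3 := Complex.reCLM.hasFDerivAt.comp_hasDerivAt s h2
  refine not_hasDerivAt_g_exp (D := D) hsX hX ?_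
  have h4 : HasDerivAt (fun t => D.g (Real.exp t)) (Complex.reCLM 0) s := h3
  simpa using h4

/-! ### The upper edge of the strip. -/

variable (D) in
/-- The values of `H` on the upper edge of the strip up to the factor `exp (i π P)`. -/
def edge (s : ℝ) : ℝ := Real.exp (D.P * s) * Real.exp (-D.A * Real.exp s) *
  (linProd D.u (-Real.exp s : ℂ)).re / (linProd D.v (Real.exp s : ℂ)).re

lemma H_edge (s : ℝ) :
    D.H (xy s Real.pi) = Complex.exp (D.P * Real.pi * Complex.I) * (D.edge s : ℂ) := by
  have := H_of_im_eq_pi (D := D) (η := xy s Real.pi) (by simp)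
  rwa [xy_re] at this

lemma abs_edge (s : ℝ) : |D.edge s| = ‖D.H (xy s Real.pi)‖ := by
  rw [H_edge, norm_mul, Complex.norm_real, Real.norm_eq_abs, ← Complex.ofReal_mul,
    Complex.norm_exp_ofReal_mul_I, one_mul]

lemma den_edge_ne_zero (s : ℝ) : D.den (xy s Real.pi) ≠ 0 := fun h => by
  have := im_eq_zero_of_den_eq_zero (xy_mem_cstrip ⟨Real.pi_pos.le, le_rfl⟩) h
  rw [xy_im] at this
  exact Real.pi_ne_zero this

lemma edge_eq_re (s : ℝ) :
    D.edge s = (Complex.exp (-(D.P * Real.pi * Complex.I)) * D.H (xy s Real.pi)).re := by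
  rw [H_edge, ← mul_assoc, ← Complex.exp_add, neg_add_cancel, Complex.exp_zero, one_mul,
    Complex.ofReal_re]

lemma continuous_edge : Continuous D.edge := by
  have h1 : Continuous fun s : ℝ => xy s Real.pi :=
    continuous_xy.comp (by fun_prop : Continuous fun s : ℝ => (s, Real.pi))
  have h2 : Continuous fun s : ℝ => D.H (xy s Real.pi) :=
    (continuous_num.comp h1).div (continuous_den.comp h1) den_edge_ne_zero
  rw [funext edge_eq_re]
  exact Complex.continuous_re.comp (continuous_const.mul h2)

lemma exp_xy_pi (s : ℝ) : Complex.exp (xy s Real.pi) = -(Real.exp s : ℂ) := by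
  rw [exp_of_im_eq_pi (xy_im _ _), xy_re, Complex.ofReal_neg]

lemma hasDerivAt_edge (hp : p ≠ 0) (hk : k ≠ 0) (hP : D.P = p / k) {s : ℝ} (hs : D.edge s ≠ 0) :
    HasDerivAt D.edge (D.edge s * D.g (Real.exp s)) s := by
  have hH : D.H (xy s Real.pi) ≠ 0 := by
    rw [← norm_ne_zero_iff, ← abs_edge]
    exact abs_ne_zero.2 hs
  have h1 := hasDerivAt_H hp hk hP hH
  have h2 : HasDerivAt (fun t : ℝ => xy t Real.pi) 1 s := by
    unfold xy
    exact (Complex.ofRealCLM.hasDerivAt (x := s)).add_const _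
  have h3 := (h1.comp s h2).const_mul (Complex.exp (-(D.P * Real.pi * Complex.I)))
  have h4 := Complex.reCLM.hasFDerivAt.comp_hasDerivAt s h3
  rw [funext edge_eq_re]
  refine h4.congr_deriv ?_
  rw [mul_one, exp_xy_pi, G_neg_ofReal, ← mul_assoc]
  rw [Complex.reCLM_apply, Complex.re_mul_ofReal]

lemma xy_pi_mem_reg {s : ℝ} (h : ∀ i, Real.exp s * D.u i < 1) : xy s Real.pi ∈ D.reg := by
  refine ⟨xy_mem_cstrip ⟨Real.pi_pos.le, le_rfl⟩, (D.num_ne_zero_iff _).2 fun i => ?_,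
    den_edge_ne_zero s⟩
  rw [exp_xy_pi]
  have : (0 : ℝ) < 1 + -Real.exp s * D.u i := by linarith [h i]
  exact_mod_cast this.ne'

lemma T_xy_pi {s : ℝ} (h : ∀ i, Real.exp s * D.u i < 1) : D.T (xy s Real.pi) = D.P * Real.pi :=
  (T_eq_P_mul_pi_iff (xy_im _ _)).2 fun i => by rw [xy_re]; exact (h i).le

lemma edge_eq_norm {s : ℝ} (h : ∀ i, Real.exp s * D.u i < 1) :
    D.edge s = ‖D.H (xy s Real.pi)‖ := by
  have h1 := H_eq_norm_mul (xy_pi_mem_reg h)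
  rw [T_xy_pi h] at h1
  rw [edge_eq_re]
  conv_lhs => rw [h1]
  rw [mul_comm, mul_assoc, Complex.ofReal_mul, ← Complex.exp_add, add_neg_cancel,
    Complex.exp_zero, mul_one, Complex.ofReal_re]

lemma norm_H_edge_eq (s : ℝ) : ‖D.H (xy s Real.pi)‖ =
    Real.exp (D.P * s) * Real.exp (-D.A * Real.exp s) * ‖linProd D.u (-Real.exp s : ℂ)‖ /
      ‖linProd D.v (Real.exp s : ℂ)‖ := by
  rw [H, num, den, exp_xy_pi, neg_neg, norm_div, norm_mul, norm_mul, Complex.norm_exp,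
    Complex.norm_exp]
  congr 4
  · simp
  · rw [← Complex.ofReal_neg, ← Complex.ofReal_mul, Complex.ofReal_re, mul_neg, neg_mul]

/-- Without zeros, either `A > 0` and `exp (-A exp s)` beats `exp (P s)`, or there is a pole and the
denominator grows at least like a multiple of `exp s`, which suffices since `P < 1`. -/
lemma tendsto_norm_H_edge [IsEmpty ι₁] (hP : D.P < 1) :
    Tendsto (fun s => ‖D.H (xy s Real.pi)‖) atTop (𝓝 0) := by
  have hu : ∀ w, linProd D.u w = 1 := fun w => by simp [linProd]
  simp only [norm_H_edge_eq, hu, norm_one, mul_one]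
  have hv1 : ∀ s : ℝ, 1 ≤ ‖linProd D.v (Real.exp s : ℂ)‖ := fun s => by
    rcases isEmpty_or_nonempty ι₂ with h | ⟨⟨i⟩⟩
    · simp [linProd]
    · exact (one_add_le_norm_linProd D.v_sum D.v_pos s i).2
  by_cases hA : 0 < D.A
  · have h0 : Tendsto (fun s : ℝ => D.P * s - D.A * Real.exp s) atTop atBot := by
      have h1 : Tendsto (fun s : ℝ => D.P * (s * Real.exp (-s)) - D.A) atTop (𝓝 (D.P * 0 - D.A)) := by
        have := Real.tendsto_pow_mul_exp_neg_atTop_nhds_zero 1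
        simp only [pow_one] at this
        exact (this.const_mul D.P).sub_const _
      rw [mul_zero, zero_sub] at h1
      refine (Real.tendsto_exp_atTop.atTop_mul_neg (neg_lt_zero.2 hA) h1).congr fun s => ?_
      rw [Real.exp_neg]
      have := Real.exp_pos s
      field_simp
    refine squeeze_zero (fun s => by positivity) (fun s => ?_) (Real.tendsto_exp_atBot.comp h0)
    rw [Function.comp_apply, sub_eq_add_neg, Real.exp_add, neg_mul]
    exact div_le_self (by positivity) (hv1 s)
  · have h2 : Nonempty ι₂ := by
      rcases D.nonconst with h | h | h
      · exact absurd h hA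
      · exact (IsEmpty.false (Classical.arbitrary ι₁)).elim
      · exact h
    have i := Classical.arbitrary ι₂
    have hvi := D.v_pos i
    have h1 : Tendsto (fun s : ℝ => Real.exp ((D.P - 1) * s) * (D.v i)⁻¹) atTop
        (𝓝 (0 * (D.v i)⁻¹)) := by
      refine Tendsto.mul_const _ (Real.tendsto_exp_atBot.comp ?_)
      exact tendsto_id.const_mul_atTop_of_neg (by linarith)
    rw [zero_mul] at h1
    refine squeeze_zero (fun s => by positivity) (fun s => ?_) h1
    have hle := (one_add_le_norm_linProd D.v_sum D.v_pos s i).1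
    have hA1 : Real.exp (-D.A * Real.exp s) ≤ 1 := by
      rw [Real.exp_le_one_iff]
      have := mul_nonneg D.A_nonneg (Real.exp_pos s).le
      linarith
    have hes := Real.exp_pos s
    calc _ ≤ Real.exp (D.P * s) * 1 / (Real.exp s * D.v i) := by
          gcongr
          linarith
      _ = _ := by
          rw [sub_mul, one_mul, Real.exp_sub]
          field_simp

/-- The upper end of the first interval of the upper edge. -/
lemma exists_edge_end (D : StripData ι₁ ι₂) (hP : D.P < 1) {c : ℝ} (hc : 0 < c) :
    ∃ r, (∀ s < r, ∀ i, Real.exp s * D.u i < 1) ∧ D.edge r < c ∧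
      ∀ η ∈ D.reg, η.im = Real.pi → D.T η = D.P * Real.pi → ‖D.H η‖ = c → η.re < r := by
  rcases isEmpty_or_nonempty ι₁ with he | hne
  · obtain ⟨r, hr⟩ := eventually_atTop.1 ((tendsto_norm_H_edge hP).eventually_lt_const hc)
    refine ⟨r, fun s _ i => (IsEmpty.false i).elim, ?_, fun η _ him _ hH => ?_⟩
    · have := hr r le_rfl
      rw [← abs_edge] at this
      exact (le_abs_self _).trans_lt this
    · by_contra! hcon
      have := hr η.re hcon
      rw [← him, xy_eta, hH] at this
      exact this.false
  -- The right end is the first zero on the edge. A largest `u` exists because the `u i` tend to 0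
  -- along the cofinite filter.
  · obtain ⟨i₀, hi₀⟩ : ∃ i₀, ∀ i, D.u i ≤ D.u i₀ := by
      have i₁ := Classical.arbitrary ι₁
      have hfin : {i | D.u i₁ ≤ D.u i}.Finite := by
        have := (D.u_sum.tendsto_cofinite_zero.eventually_lt_const (D.u_pos i₁))
        simpa [Filter.eventually_cofinite] using this
      obtain ⟨i₀, hi₀, hmax⟩ := hfin.exists_maximalFor D.u _ ⟨i₁, le_refl (D.u i₁)⟩
      refine ⟨i₀, fun i => ?_⟩
      rcases le_total (D.u i₁) (D.u i) with h | h
      · rcases le_total (D.u i) (D.u i₀) with h' | h'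
        · exact h'
        · exact hmax h h'
      · exact h.trans hi₀
    have hu := D.u_pos i₀
    have hexp : Real.exp (-Real.log (D.u i₀)) * D.u i₀ = 1 := by
      rw [Real.exp_neg, Real.exp_log hu, inv_mul_cancel₀ hu.ne']
    have hlt : ∀ s, s < -Real.log (D.u i₀) ↔ Real.exp s * D.u i₀ < 1 := by
      intro s
      rw [← hexp, mul_lt_mul_iff_left₀ hu, Real.exp_lt_exp]
    refine ⟨-Real.log (D.u i₀), fun s hs i => ?_, ?_, fun η hη him hT _ => ?_⟩
    · exact (mul_le_mul_of_nonneg_left (hi₀ i) (Real.exp_pos s).le).trans_lt ((hlt s).1 hs)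
    · have h0 : linProd D.u (-(Real.exp (-Real.log (D.u i₀)) : ℂ)) = 0 := by
        refine (linProd_eq_zero_iff D.u_sum _).2 ⟨i₀, ?_⟩
        rw [neg_mul, ← Complex.ofReal_mul, hexp]
        simp
      rw [edge, h0]
      simpa using hc
    · rw [hlt]
      refine lt_of_le_of_ne ((T_eq_P_mul_pi_iff him).1 hT i₀) fun h1 => ?_
      refine (D.num_ne_zero_iff η).1 hη.2.1 i₀ ?_
      rw [exp_of_im_eq_pi him, ← Complex.ofReal_mul, neg_mul, h1]
      simp

/-- Before the first zero `edge` equals the modulus, its logarithmic derivative `g (exp s)` is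
strictly decreasing, and it is below `c` at both ends of the chosen interval. The bound `X` leaves
room between the solutions and the first zero for the double point criterion. -/
lemma exists_edge_solutions (hp : p ≠ 0) (hk : k ≠ 0) (hPk : D.P = p / k) (hP : D.P < 1) {c : ℝ}
    (hc : 0 < c) {η₀ : ℂ} (h₀ : η₀ ∈ D.reg) (him : η₀.im = Real.pi) (hT : D.T η₀ = D.P * Real.pi)
    (hH : ‖D.H η₀‖ = c) :
    ∃ a b X : ℝ, a < X ∧ b < X ∧ (∀ i, Real.exp X * D.u i < 1) ∧
      ‖D.H (xy a Real.pi)‖ = c ∧ ‖D.H (xy b Real.pi)‖ = c ∧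
      (∀ η ∈ D.reg, η.im = Real.pi → D.T η = D.P * Real.pi → ‖D.H η‖ = c → η.re = a ∨ η.re = b) ∧
      ((a = b ∧ D.g (Real.exp a) = 0) ∨
        (a < b ∧ D.g (Real.exp a) ≠ 0 ∧ D.g (Real.exp b) ≠ 0)) := by
  obtain ⟨r, hr1, hr2, hr3⟩ := exists_edge_end D hP hc
  obtain ⟨l, hl⟩ := eventually_atBot.1
    ((tendsto_level_atBot (c := c) D Real.pi).eventually_lt_const (neg_lt_zero.2 hc))
  have hlH : ∀ s ≤ l, ‖D.H (xy s Real.pi)‖ < c := by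
    intro s hs
    have h1 := hl s hs
    rw [level, sub_neg] at h1
    rw [H, norm_div, div_lt_iff₀ (norm_pos_iff.2 (den_edge_ne_zero s))]
    exact h1
  have hloc : ∀ η ∈ D.reg, η.im = Real.pi → D.T η = D.P * Real.pi → ‖D.H η‖ = c →
      η.re ∈ Ioo l r := by
    intro η hη him hT hH
    refine ⟨?_, hr3 η hη him hT hH⟩
    by_contra! hcon
    have := hlH _ hcon
    rw [← him, xy_eta, hH] at this
    exact this.false
  have hpos : ∀ s ∈ Ioo l r, D.edge s ≠ 0 := fun s hs => by
    rw [edge_eq_norm (hr1 s hs.2)]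
    exact norm_ne_zero_iff.2 (H_ne_zero (xy_pi_mem_reg (hr1 s hs.2)))
  have h0mem := hloc η₀ h₀ him hT hH
  obtain ⟨a, ha, b, hb, hac, hbc, hall, hab⟩ := exists_two_solutions (f := D.edge)
    (q := fun s => D.g (Real.exp s)) (l := l) (r := r) (c := c) (s₁ := η₀.re)
    continuous_edge.continuousOn (fun s hs => hasDerivAt_edge hp hk hPk (hpos s hs)) hpos
    (fun s _ t ht hst => g_exp_lt hst (hr1 t ht.2))
    (by
      have := hlH l le_rfl
      rw [← abs_edge] at this
      exact (le_abs_self _).trans_lt this) hr2 h0mem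
    (by rw [edge_eq_norm (hr1 _ h0mem.2), ← him, xy_eta, hH])
  refine ⟨a, b, (max a b + r) / 2, ?_, ?_, ?_, ?_, ?_, ?_, hab⟩
  · have := max_lt ha.2 hb.2
    linarith [le_max_left a b]
  · have := max_lt ha.2 hb.2
    linarith [le_max_right a b]
  · have := max_lt ha.2 hb.2
    exact hr1 _ (by linarith)
  · rw [← edge_eq_norm (hr1 a ha.2), hac]
  · rw [← edge_eq_norm (hr1 b hb.2), hbc]
  · intro η hη him hT hH
    have hm := hloc η hη him hT hH
    refine hall _ hm ?_
    rw [edge_eq_norm (hr1 _ hm.2), ← him, xy_eta, hH]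

end StripData

/-! ### Rotations and the fundamental sector. -/

section UnitExp

variable {k : ℕ}

lemma unitExp_add (k : ℕ) (m n : ℤ) : unitExp k (m + n) = unitExp k m * unitExp k n := by
  rw [unitExp, unitExp, unitExp, ← Complex.exp_add]
  congr 1
  push_cast
  ring

lemma unitExp_zero (k : ℕ) : unitExp k 0 = 1 := by simp [unitExp]

lemma unitExp_ne_zero (k : ℕ) (m : ℤ) : unitExp k m ≠ 0 := Complex.exp_ne_zero _

lemma norm_unitExp (k : ℕ) (m : ℤ) : ‖unitExp k m‖ = 1 := Complex.norm_exp_ofReal_mul_I _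

lemma conj_unitExp (k : ℕ) (m : ℤ) : conj (unitExp k m) = unitExp k (-m) := by
  rw [unitExp, unitExp, ← Complex.exp_conj]
  congr 1
  simp only [map_mul, Complex.conj_ofReal, Complex.conj_I]
  push_cast
  ring

lemma unitExp_pow (k : ℕ) (m : ℤ) (n : ℕ) : unitExp k m ^ n = unitExp k (n * m) := by
  rw [unitExp, unitExp, ← Complex.exp_nat_mul]
  congr 1
  push_cast
  ring

lemma unitExp_two_mul_of_dvd (hk : k ≠ 0) {j : ℤ} (h : (k : ℤ) ∣ j) : unitExp k (2 * j) = 1 := by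
  obtain ⟨n, rfl⟩ := h
  rw [unitExp, Complex.exp_eq_one_iff]
  refine ⟨n, ?_⟩
  have : (k : ℂ) ≠ 0 := Nat.cast_ne_zero.2 hk
  push_cast
  field_simp

lemma unitExp_congr (hk : k ≠ 0) {i j : ℤ} (h : (k : ℤ) ∣ i - j) :
    unitExp k (2 * i) = unitExp k (2 * j) := by
  have := unitExp_two_mul_of_dvd hk h
  rw [show 2 * i = 2 * (i - j) + 2 * j by ring, unitExp_add, this, one_mul]

lemma unitExp_even_pow (hk : k ≠ 0) (j : ℤ) : unitExp k (2 * j) ^ k = 1 := by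
  rw [unitExp_pow, show (k : ℤ) * (2 * j) = 2 * (k * j) by ring]
  exact unitExp_two_mul_of_dvd hk (dvd_mul_right _ _)

lemma unitExp_two_mul (k : ℕ) (j : ℤ) :
    unitExp k (2 * j) = Complex.exp ((2 * Real.pi * j / k : ℝ) * Complex.I) := by
  rw [unitExp]
  congr 2
  push_cast
  ring

/-- A rotation by an even multiple of `π / k`, possibly composed with a reflection, brings every
point into the closed sector `0 ≤ arg z ≤ π / k`. -/
lemma exists_sector_rep (hk : k ≠ 0) {z : ℂ} (hz : z ≠ 0) : ∃ j : ℤ, ∃ η ∈ cstrip,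
    ‖z‖ = Real.exp (η.re / k) ∧ (z = unitExp k (2 * j) * Complex.exp (η / k) ∨
      z = unitExp k (2 * j) * conj (Complex.exp (η / k))) := by
  have hk0 : (0 : ℝ) < k := Nat.cast_pos.2 (Nat.pos_of_ne_zero hk)
  have hkc : (k : ℂ) ≠ 0 := Nat.cast_ne_zero.2 hk
  have hpi := Real.pi_pos
  have hn : 0 < ‖z‖ := norm_pos_iff.2 hz
  set θ := Complex.arg z with hθ
  set x := k * Real.log ‖z‖ with hx
  have hzx : z = Complex.exp ((x / k : ℝ) : ℂ) * Complex.exp (θ * Complex.I) := by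
    have := Complex.norm_mul_exp_arg_mul_I z
    rw [← hθ] at this
    rw [← Complex.ofReal_exp, show x / k = Real.log ‖z‖ by rw [hx]; field_simp, Real.exp_log hn, this]
  have hnx : ‖z‖ = Real.exp (x / k) := by
    rw [show x / k = Real.log ‖z‖ by rw [hx]; field_simp, Real.exp_log hn]
  set j : ℤ := ⌊k * θ / (2 * Real.pi)⌋ with hj
  have h1 := Int.floor_le (k * θ / (2 * Real.pi))
  have h2 := Int.lt_floor_add_one (k * θ / (2 * Real.pi))
  rw [← hj, le_div_iff₀ (by positivity)] at h1
  rw [← hj, div_lt_iff₀ (by positivity)] at h2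
  -- The angle `k θ - 2 π j` lies in `[0, 2 π)`. Its first half is used directly; the second half is
  -- reflected, measured backwards from `2 π (j + 1)`.
  rcases le_or_gt (k * θ - 2 * Real.pi * j) Real.pi with h | h
  · refine ⟨j, xy x (k * θ - 2 * Real.pi * j), xy_mem_cstrip ⟨by linarith, h⟩, by rwa [xy_re],
      Or.inl ?_⟩
    rw [unitExp_two_mul, hzx, xy, ← Complex.exp_add, ← Complex.exp_add]
    congr 1
    push_cast
    field_simp
    ring
  · refine ⟨j + 1, xy x (2 * Real.pi * (j + 1) - k * θ), xy_mem_cstrip ⟨by linarith, by linarith⟩,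
      by rwa [xy_re], Or.inr ?_⟩
    rw [unitExp_two_mul, hzx, xy, ← Complex.exp_add, ← Complex.exp_conj, ← Complex.exp_add]
    congr 1
    simp only [map_div₀, map_add, map_mul, Complex.conj_ofReal, Complex.conj_I, Complex.conj_natCast]
    push_cast
    field_simp
    ring

lemma norm_exp_div (k : ℕ) (η : ℂ) : ‖Complex.exp (η / k)‖ = Real.exp (η.re / k) := by
  rw [Complex.norm_exp, Complex.div_natCast_re]

lemma exp_xy_pi_div (k : ℕ) (s : ℝ) :
    Complex.exp (xy s Real.pi / k) = (Real.exp (s / k) : ℂ) * unitExp k 1 := by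
  rw [unitExp, Complex.ofReal_exp, ← Complex.exp_add, xy]
  congr 1
  push_cast
  ring

lemma conj_exp_div_mul_unitExp_one (k : ℕ) (η : ℂ) :
    conj (Complex.exp (η / k)) * unitExp k 1 = Complex.exp (stripRefl η / k) := by
  rw [unitExp, ← Complex.exp_conj, ← Complex.exp_add, stripRefl]
  congr 1
  simp only [map_div₀, Complex.conj_natCast]
  push_cast
  ring

lemma exp_div_pow (hk : k ≠ 0) (η : ℂ) : Complex.exp (η / k) ^ k = Complex.exp η := by
  have hkc : (k : ℂ) ≠ 0 := Nat.cast_ne_zero.2 hk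
  rw [← Complex.exp_nat_mul]; congr 1; field_simp

end UnitExp

/-! ### All points with a given value, read in the strip. -/

namespace StripData

variable {ι₁ ι₂ : Type*} {D : StripData ι₁ ι₂} {p k : ℕ}

lemma F_rotate (hk : k ≠ 0) (j : ℤ) (z : ℂ) :
    D.F p k (unitExp k (2 * j) * z) = unitExp k (2 * (j * p)) * D.F p k z := by
  rw [F, F, mul_pow, mul_pow, unitExp_even_pow hk, one_mul, unitExp_pow,
    show (p : ℤ) * (2 * j) = 2 * (j * p) by ring]
  ring

lemma F_conj (z : ℂ) : D.F p k (conj z) = conj (D.F p k z) := by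
  rw [F, F, ← map_pow (starRingEnd ℂ) z k, ← map_neg, linProd_conj, linProd_conj]
  simp only [map_div₀, map_mul, ← Complex.exp_conj, Complex.conj_ofReal, map_pow]

lemma G_conj (w : ℂ) : D.G (conj w) = conj (D.G w) := by
  simp only [G, logDerivSum, map_add, map_mul, Complex.conj_ofReal, Complex.conj_tsum, map_div₀,
    map_one, map_neg]

variable {c β : ℝ}

lemma F_rotate_exp (hk : k ≠ 0) (hP : D.P = p / k) {η : ℂ} (hη : η ∈ D.reg) (hc : ‖D.H η‖ = c)
    (j : ℤ) : D.F p k (unitExp k (2 * j) * Complex.exp (η / k))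
      = c * Complex.exp ((D.T η + 2 * Real.pi * (j * p : ℤ) / k : ℝ) * Complex.I) := by
  rw [F_rotate hk, F_exp hk hP, H_eq_norm_mul hη, hc, unitExp_two_mul, mul_left_comm,
    ← Complex.exp_add]
  congr 2
  push_cast
  ring

lemma F_rotate_conj_exp (hk : k ≠ 0) (hP : D.P = p / k) {η : ℂ} (hη : η ∈ D.reg)
    (hc : ‖D.H η‖ = c) (j : ℤ) :
    D.F p k (unitExp k (2 * j) * conj (Complex.exp (η / k)))
      = c * Complex.exp ((-D.T η + 2 * Real.pi * (j * p : ℤ) / k : ℝ) * Complex.I) := by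
  rw [F_rotate hk, F_conj, F_exp hk hP, H_eq_norm_mul hη, hc, unitExp_two_mul, map_mul,
    ← Complex.exp_conj, Complex.conj_ofReal, mul_left_comm, ← Complex.exp_add]
  congr 2
  simp only [map_mul, Complex.conj_ofReal, Complex.conj_I]
  push_cast
  ring

lemma exp_mul_I_eq_iff {x y : ℝ} : Complex.exp (x * Complex.I) = Complex.exp (y * Complex.I) ↔
    ∃ n : ℤ, x = y + 2 * Real.pi * n := by
  rw [Complex.exp_eq_exp_iff_exists_int]
  refine exists_congr fun n => ?_
  rw [show (y * Complex.I + n * (2 * Real.pi * Complex.I) : ℂ)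
    = ((y + 2 * Real.pi * n : ℝ) : ℂ) * Complex.I by push_cast; ring]
  rw [mul_left_inj' Complex.I_ne_zero, Complex.ofReal_inj]

lemma ne_zero_of_F_ne_zero (hp : p ≠ 0) {z : ℂ} (hz : D.F p k z ≠ 0) : z ≠ 0 :=
  fun h0 => hz (by simp [F, h0, zero_pow hp])

/-- The position of the points with a prescribed value `c exp (i β)`, `0 ≤ β ≤ π / k`. -/
lemma exists_strip_point (hp : p ≠ 0) (hk : k ≠ 0) (hpk : Nat.gcd p k = 1) (hP : D.P = p / k)
    (hc : 0 < c) (hβ0 : 0 ≤ β) (hβ : β ≤ Real.pi / k) {z : ℂ}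
    (hz : D.F p k z = c * Complex.exp (β * Complex.I)) :
    ∃ η ∈ D.reg, ‖D.H η‖ = c ∧ ‖z‖ = Real.exp (η.re / k) ∧ β ≤ D.T η ∧
      (D.T η = β → z = Complex.exp (η / k) ∨ (β = 0 ∧ z = conj (Complex.exp (η / k))) ∨
        (β = Real.pi / k ∧ ∃ j : ℤ, (k : ℤ) ∣ j * p - 1 ∧
          z = unitExp k (2 * j) * conj (Complex.exp (η / k)))) := by
  have hk0 : (0 : ℝ) < k := Nat.cast_pos.2 (Nat.pos_of_ne_zero hk)
  have hpi := Real.pi_pos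
  have hcc : (c : ℂ) ≠ 0 := Complex.ofReal_ne_zero.2 hc.ne'
  have hFz : D.F p k z ≠ 0 := by
    rw [hz]; exact mul_ne_zero hcc (Complex.exp_ne_zero _)
  have hnz : ‖D.F p k z‖ = c := by
    rw [hz, norm_mul, Complex.norm_exp_ofReal_mul_I, mul_one, Complex.norm_real,
      Real.norm_of_nonneg hc.le]
  obtain ⟨j, η, hη, hn, hrep⟩ := exists_sector_rep hk (ne_zero_of_F_ne_zero hp hFz)
  have hnH : ‖D.H η‖ = c := by
    rcases hrep with rfl | rfl
    · rwa [F_rotate hk, F_exp hk hP, norm_mul, norm_unitExp, one_mul] at hnz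
    · rwa [F_rotate hk, F_conj, F_exp hk hP, norm_mul, norm_unitExp, one_mul,
        Complex.norm_conj] at hnz
  have hreg : η ∈ D.reg := mem_reg_of_H_ne_zero hη (norm_ne_zero_iff.1 (by rw [hnH]; exact hc.ne'))
  have hT0 := T_nonneg (D := D) hη
  have hdvd : ∀ {j : ℤ}, (k : ℤ) ∣ j * p → (k : ℤ) ∣ j := fun h =>
    (Int.isCoprime_iff_gcd_eq_one.2 (by
      rw [Int.gcd_natCast_natCast, Nat.gcd_comm]; exact hpk)).dvd_of_dvd_mul_right h
  -- integrality of the shift of the argument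
  have hq : ∀ N : ℤ, 2 * Real.pi * N / k = 2 * (Real.pi / k) * N := fun N => by ring
  have hδ : 0 < Real.pi / k := by positivity
  refine ⟨η, hreg, hnH, hn, ?_⟩
  rcases hrep with hrep | hrep
  · rw [hrep, F_rotate_exp hk hP hreg hnH, mul_right_inj' hcc, exp_mul_I_eq_iff] at hz
    obtain ⟨n, hn⟩ := hz
    have hT : D.T η = β + 2 * (Real.pi / k) * ((k * n - j * p : ℤ) : ℝ) := by
      rw [← hq]
      have : D.T η = β + 2 * Real.pi * n - 2 * Real.pi * (j * p : ℤ) / k := by linarith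
      rw [this]; push_cast; field_simp; ring
    -- `N < 0` would give `T ≤ β - 2 π / k < 0`. Equality `T = β` means `N = 0`, so `k` divides `j
    -- p`, and by coprimality the rotation is trivial.
    set N : ℤ := k * n - j * p with hN
    have hN0 : 0 ≤ N := by
      by_contra! hneg
      have : (N : ℝ) ≤ -1 := by exact_mod_cast Int.le_sub_one_of_lt hneg
      nlinarith
    have hN0' : (0 : ℝ) ≤ N := by exact_mod_cast hN0
    refine ⟨by rw [hT]; have := mul_nonneg hδ.le hN0'; linarith, fun hTβ => Or.inl ?_⟩
    have hN1 : (N : ℝ) = 0 := by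
      have : (Real.pi / k) * N = 0 := by linarith
      exact (mul_eq_zero.1 this).resolve_left hδ.ne'
    have hN2 : N = 0 := by exact_mod_cast hN1
    have hj : (k : ℤ) ∣ j := hdvd ⟨n, by linarith⟩
    rw [hrep, unitExp_two_mul_of_dvd hk hj, one_mul]
  · rw [hrep, F_rotate_conj_exp hk hP hreg hnH, mul_right_inj' hcc, exp_mul_I_eq_iff] at hz
    obtain ⟨n, hn⟩ := hz
    have hT : D.T η = -β + 2 * (Real.pi / k) * ((j * p - k * n : ℤ) : ℝ) := by
      rw [← hq]
      have : D.T η = -β - 2 * Real.pi * n + 2 * Real.pi * (j * p : ℤ) / k := by linarith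
      rw [this]; push_cast; field_simp; ring
    -- Here `N = 0` forces `β = T = 0`, and `N ≥ 1` gives `T ≥ 2 π / k - β ≥ β`, with `T = β` only
    -- for `N = 1` and `β = π / k`.
    set N : ℤ := j * p - k * n with hN
    have hN0 : 0 ≤ N := by
      by_contra! hneg
      have : (N : ℝ) ≤ -1 := by exact_mod_cast Int.le_sub_one_of_lt hneg
      nlinarith
    rcases hN0.eq_or_lt with h0 | h0
    · have hβ00 : β = 0 := by
        rw [← h0] at hT
        simp only [Int.cast_zero, mul_zero, add_zero] at hT
        linarith
      refine ⟨by rw [hβ00]; exact hT0, fun _ => Or.inr (Or.inl ⟨hβ00, ?_⟩)⟩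
      have hj : (k : ℤ) ∣ j := hdvd ⟨n, by linarith⟩
      rw [hrep, unitExp_two_mul_of_dvd hk hj, one_mul]
    · have h1 : (1 : ℝ) ≤ N := by exact_mod_cast h0
      have h2 := mul_le_mul_of_nonneg_left h1 hδ.le
      refine ⟨by linarith, fun hTβ => Or.inr (Or.inr ⟨by linarith, j, ?_, hrep⟩)⟩
      have hN1 : (N : ℝ) = 1 := by
        have h3 : (Real.pi / k) * (N - 1) = 0 := by
          rw [mul_sub, mul_one]
          linarith
        have := (mul_eq_zero.1 h3).resolve_left hδ.ne'
        linarith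
      have hN2 : N = 1 := by exact_mod_cast hN1
      exact ⟨n, by linarith⟩

/-- On the positive ray before the first pole the modulus is injective. -/
lemma not_re_lt_of_T_eq_zero (hp : p ≠ 0) (hk : k ≠ 0) (hP : D.P = p / k) {η₁ η₂ : ℂ}
    (h2 : η₂ ∈ D.reg) (i1 : η₁.im = 0) (i2 : η₂.im = 0) (hT : D.T η₂ = 0)
    (hn : ‖D.H η₁‖ = ‖D.H η₂‖) : ¬ η₁.re < η₂.re := by
  intro hlt
  have hle : ∀ x ≤ η₂.re, ∀ i, Real.exp x * D.v i ≤ 1 := fun x hx i =>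
    (mul_le_mul_of_nonneg_right (Real.exp_le_exp.2 hx) (D.v_pos i).le).trans
      ((T_eq_zero_iff i2).1 hT i)
  have hTx : ∀ x ≤ η₂.re, D.T (xy x 0) = 0 := fun x hx =>
    (T_eq_zero_iff (xy_im _ _)).2 (by rw [xy_re]; exact hle x hx)
  have e2 : xy η₂.re 0 = η₂ := by rw [← i2, xy_eta]
  have e1 : xy η₁.re 0 = η₁ := by rw [← i1, xy_eta]
  have hreg : ∀ x ≤ η₂.re, xy x 0 ∈ D.reg := by
    intro x hx
    rcases hx.eq_or_lt with h | h
    · rwa [h, e2]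
    have hs : xy x 0 ∈ cstrip := xy_mem_cstrip ⟨le_rfl, Real.pi_pos.le⟩
    refine ⟨hs, fun h0 => ?_, (D.den_ne_zero_iff _).2 fun i h0 => ?_⟩
    · have := im_eq_pi_of_num_eq_zero hs h0
      rw [xy_im] at this
      exact Real.pi_ne_zero this.symm
    · rw [one_add_exp_stripRefl, map_eq_zero, exp_of_im_eq_zero (xy_im _ _), xy_re] at h0
      have h3 : 1 + -Real.exp x * D.v i = 0 := by exact_mod_cast h0
      have h4 := hle η₂.re le_rfl i
      have h5 := mul_lt_mul_of_pos_right (Real.exp_lt_exp.2 h) (D.v_pos i)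
      linarith
  have hval : ∀ x ≤ η₂.re, D.H (xy x 0) = (‖D.H (xy x 0)‖ : ℂ) := by
    intro x hx
    have := H_eq_norm_mul (hreg x hx)
    rwa [hTx x hx, Complex.ofReal_zero, zero_mul, Complex.exp_zero, mul_one] at this
  have hd : ∀ x ≤ η₂.re, HasDerivAt (fun t => (D.H (xy t 0)).re)
      (D.H (xy x 0) * D.G (Complex.exp (xy x 0))).re x := by
    intro x hx
    have d1 := hasDerivAt_H hp hk hP (H_ne_zero (hreg x hx))
    have d2 : HasDerivAt (fun t : ℝ => xy t 0) 1 x := by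
      unfold xy
      exact (Complex.ofRealCLM.hasDerivAt (x := x)).add_const _
    have d3 := Complex.reCLM.hasFDerivAt.comp_hasDerivAt x (d1.comp x d2)
    rw [mul_one] at d3
    exact d3
  -- Where `T = 0` the value of `H` equals its modulus, so equal moduli give a critical point by
  -- Rolle. There `G` would vanish, although it is real and nonzero before the first pole.
  obtain ⟨m, hm, hm0⟩ := exists_hasDerivAt_eq_zero hlt
    (f := fun t => (D.H (xy t 0)).re)
    (fun x hx => (hd x hx.2).continuousAt.continuousWithinAt)
    (by rw [hval _ hlt.le, hval _ le_rfl, e1, e2, hn])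
    (fun x hx => hd x hx.2.le)
  have hG := G_ne_zero_of_pos (D := D) (Real.exp_pos m).le (hle m hm.2.le)
  have hexp : Complex.exp (xy m 0) = (Real.exp m : ℂ) := by
    rw [exp_of_im_eq_zero (xy_im _ _), xy_re]
  have hGim : (D.G (Real.exp m : ℂ)).im = 0 := by
    rw [← Complex.conj_eq_iff_im, ← G_conj, Complex.conj_ofReal]
  rw [hexp, hval m hm.2.le, Complex.re_ofReal_mul, mul_eq_zero, norm_eq_zero] at hm0
  rcases hm0 with h | h
  · exact H_ne_zero (hreg m hm.2.le) h
  · exact hG (Complex.ext h hGim)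

end StripData

/-! ### The closest points in normalized position. -/

namespace StripData

variable {ι₁ ι₂ : Type*} {D : StripData ι₁ ι₂} {p k : ℕ} {c β : ℝ}

lemma exists_mul_sub_one_dvd (hpk : Nat.gcd p k = 1) : ∃ j : ℤ, (k : ℤ) ∣ j * p - 1 := by
  obtain ⟨a, b, hab⟩ := (Nat.isCoprime_iff_coprime.2 hpk : IsCoprime (p : ℤ) (k : ℤ))
  exact ⟨a, -b, by linarith⟩

lemma F_exp_of_T (hk : k ≠ 0) (hP : D.P = p / k) {η : ℂ} (hη : η ∈ D.reg) (hc : ‖D.H η‖ = c)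
    (hT : D.T η = β) : D.F p k (Complex.exp (η / k)) = c * Complex.exp (β * Complex.I) := by
  rw [F_exp hk hP, H_eq_norm_mul hη, hc, hT]

/-- Since `j p ≡ 1` modulo `k`, the rotation adds `2 π / k` to the reflected argument `-T`. Points
with `T = 2 π / k - β` thus yield further α-points. -/
lemma F_rotate_conj_exp_of_T (hk : k ≠ 0) (hP : D.P = p / k) {η : ℂ} (hη : η ∈ D.reg)
    (hc : ‖D.H η‖ = c) (hT : D.T η = 2 * Real.pi / k - β) {j : ℤ} (hj : (k : ℤ) ∣ j * p - 1) :
    D.F p k (unitExp k (2 * j) * conj (Complex.exp (η / k))) = c * Complex.exp (β * Complex.I) := by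
  rw [F_rotate_conj_exp hk hP hη hc]
  congr 1
  rw [exp_mul_I_eq_iff]
  obtain ⟨n, hn⟩ := hj
  refine ⟨n, ?_⟩
  have hk0 : (k : ℝ) ≠ 0 := Nat.cast_ne_zero.2 hk
  rw [show j * p = k * n + 1 by linarith, hT]
  push_cast
  field_simp
  ring

/-- If `0 ≤ β < π / k`, then the point with value `c exp (i β)` that is closest to the origin
belongs to the closed sector `0 ≤ arg z < π / k`. -/
lemma exists_closest_of_lt (hp : p ≠ 0) (hk : 2 ≤ k) (hpk : Nat.gcd p k = 1) (hP : D.P = p / k)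
    (hc : 0 < c) (hβ0 : 0 ≤ β) (hβ : β < Real.pi / k) {α : ℂ}
    (hα : α = c * Complex.exp (β * Complex.I)) (hex : ∃ z, D.F p k z = α) :
    ∃ η₀ ∈ D.reg, D.F p k (Complex.exp (η₀ / k)) = α ∧ D.G (Complex.exp η₀) ≠ 0 ∧
      (∀ z, D.F p k z = α → z ≠ Complex.exp (η₀ / k) → ‖Complex.exp (η₀ / k)‖ < ‖z‖) ∧
      (∀ z, IsNextAlphaPoint (D.F p k) α (Complex.exp (η₀ / k)) z → ∀ t : ℝ, 0 < t →
        z ≠ t * Complex.exp (η₀ / k)) ∧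
      (0 < β → η₀ ∈ ostrip) ∧ (β = 0 → η₀.im = 0) := by
  have hk' : k ≠ 0 := by omega
  have hk0 : (0 : ℝ) < k := Nat.cast_pos.2 (by omega)
  have hk2 : (2 : ℝ) ≤ k := by exact_mod_cast hk
  have hpi := Real.pi_pos
  have hδ : 2 * (Real.pi / k) ≤ Real.pi := by
    rw [← mul_div_assoc, div_le_iff₀ hk0]; nlinarith
  have hδ0 : 0 < Real.pi / k := by positivity
  have hPk : Real.pi / k ≤ D.P * Real.pi := by
    have h1 : (1 : ℝ) ≤ p := by exact_mod_cast Nat.one_le_iff_ne_zero.2 hp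
    rw [hP, div_mul_eq_mul_div]
    gcongr
    exact le_mul_of_one_le_left hpi.le h1
  obtain ⟨η₀, h₀, hn₀, hT₀⟩ : ∃ η ∈ D.reg, ‖D.H η‖ = c ∧ D.T η = β := by
    obtain ⟨z, hz⟩ := hex
    rw [hα] at hz
    obtain ⟨η, hη, hnη, -, hle, -⟩ := exists_strip_point hp hk' hpk hP hc hβ0 hβ.le hz
    rcases hle.eq_or_lt with h | h
    · exact ⟨η, hη, hnη, h.symm⟩
    · exact exists_T_eq_of_lt hc hη hnη hβ0 h
  -- On the upper edge `T ≥ P π ≥ π / k > β`.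
  have hupper : η₀.im ≠ Real.pi := fun him => by
    have := P_mul_im_le_T (D := D) h₀.1
    rw [him, hT₀] at this
    linarith
  -- On the lower edge `T` is a multiple of `π`, whereas `0 < β < π`.
  have hint : 0 < β → η₀ ∈ ostrip := by
    intro hβpos
    refine ⟨lt_of_le_of_ne h₀.1.1 fun him => ?_, lt_of_le_of_ne h₀.1.2 hupper⟩
    obtain ⟨n, hn⟩ := exists_T_eq_of_im_eq_zero h₀ him.symm
    rw [hT₀] at hn
    have h1 : (n : ℝ) < 1 := by nlinarith
    have h2 : 0 < (n : ℝ) := by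
      by_contra! h
      nlinarith
    have h3 : n < 1 := by exact_mod_cast h1
    have h4 : 0 < n := by exact_mod_cast h2
    omega
  have hreal : β = 0 → η₀.im = 0 := fun h => im_eq_zero_of_T h₀.1 (hT₀.trans h)
  have huniq : ∀ η ∈ D.reg, ‖D.H η‖ = c → D.T η = β → η = η₀ := by
    intro η hη hn hT
    rcases eq_or_sameEdge_of_T_eq hη h₀ (hn.trans hn₀.symm) (hT.trans hT₀.symm) with h |
      ⟨e1, e2⟩ | ⟨e1, e2⟩
    · exact h
    · have hβ00 : β = 0 := by
        by_contra hne
        exact (hint (lt_of_le_of_ne hβ0 (Ne.symm hne))).1.ne' e2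
      rw [hβ00] at hT hT₀
      refine Complex.ext (le_antisymm ?_ ?_) (e1.trans e2.symm)
      · exact not_lt.1 (not_re_lt_of_T_eq_zero hp hk' hP hη e2 e1 hT (hn₀.trans hn.symm))
      · exact not_lt.1 (not_re_lt_of_T_eq_zero hp hk' hP h₀ e1 e2 hT₀ (hn.trans hn₀.symm))
    · exact absurd e2 hupper
  have hnorm_lt : ∀ {η₁ η₂ : ℂ}, η₁.re < η₂.re → Real.exp (η₁.re / k) < Real.exp (η₂.re / k) :=
    fun h => Real.exp_lt_exp.2 (by gcongr)
  refine ⟨η₀, h₀, by rw [hα]; exact F_exp_of_T hk' hP h₀ hn₀ hT₀, ?_, ?_, ?_, hint, hreal⟩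
  · rcases hβ0.eq_or_lt with h | h
    · rw [exp_of_im_eq_zero (hreal h.symm)]
      exact G_ne_zero_of_pos (Real.exp_pos _).le
        ((T_eq_zero_iff (hreal h.symm)).1 (hT₀.trans h.symm))
    · exact G_ne_zero_of_im_ne_zero (exp_im_pos (hint h)).ne'
  · intro z hz hne
    rw [hα] at hz
    obtain ⟨η, hη, hnη, hnz, hle, heq⟩ := exists_strip_point hp hk' hpk hP hc hβ0 hβ.le hz
    rw [norm_exp_div, hnz]
    refine hnorm_lt (re_lt_of_T_lt h₀ hη (hn₀.trans hnη.symm) ?_)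
    rw [hT₀]
    refine lt_of_le_of_ne hle fun hT => hne ?_
    have hηη := huniq η hη hnη hT.symm
    rcases heq hT.symm with h | ⟨hβ00, h⟩ | ⟨h, -⟩
    · rw [h, hηη]
    · rw [h, hηη, ← Complex.exp_conj, map_div₀, Complex.conj_natCast,
        Complex.conj_eq_iff_im.2 (hreal hβ00)]
    · exact absurd h hβ.ne
  -- A next α-point on the same ray has `T = β + 2 π n` with `n ≥ 1`. The level curve takes the
  -- argument `2 π / k - β` strictly in between, which gives an α-point of strictly intermediate
  -- modulus.
  · rintro z ⟨hz, hlt, hmin⟩ t ht rfl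
    have hrep : (t : ℂ) * Complex.exp (η₀ / k)
        = Complex.exp ((η₀ + (k * Real.log t : ℝ)) / k) := by
      have hkc : (k : ℂ) ≠ 0 := Nat.cast_ne_zero.2 hk'
      rw [add_div, Complex.exp_add, mul_comm]
      congr 1
      conv_lhs => rw [← Real.exp_log ht]
      rw [Complex.ofReal_exp]
      congr 1
      push_cast
      field_simp
    set η := η₀ + (k * Real.log t : ℝ) with hηdef
    have him : η.im = η₀.im := by simp [hηdef]
    have hηs : η ∈ cstrip := by
      have := h₀.1
      simpa [cstrip, him] using this
    rw [hrep] at hz hlt hmin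
    rw [norm_exp_div, norm_exp_div, Real.exp_lt_exp, div_lt_div_iff_of_pos_right hk0] at hlt
    rw [F_exp hk' hP, hα] at hz
    have hcc : (c : ℂ) ≠ 0 := Complex.ofReal_ne_zero.2 hc.ne'
    have hη : η ∈ D.reg := mem_reg_of_H_ne_zero hηs (by
      rw [hz]; exact mul_ne_zero hcc (Complex.exp_ne_zero _))
    have hnη : ‖D.H η‖ = c := by
      rw [hz, norm_mul, Complex.norm_exp_ofReal_mul_I, mul_one, Complex.norm_real,
        Real.norm_of_nonneg hc.le]
    have hTlt : β < D.T η := by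
      rcases lt_trichotomy (D.T η) β with h | h | h
      · have := re_lt_of_T_lt hη h₀ (hnη.trans hn₀.symm) (h.trans_eq hT₀.symm)
        linarith
      · have := huniq η hη hnη h
        rw [this] at hlt
        exact absurd hlt (lt_irrefl _)
      · exact h
    rw [H_eq_norm_mul hη, hnη, mul_right_inj' hcc, exp_mul_I_eq_iff] at hz
    obtain ⟨n, hn⟩ := hz
    have hn1 : (1 : ℝ) ≤ n := by
      have : 0 < (n : ℝ) := by
        by_contra! h
        nlinarith
      have : 0 < n := by exact_mod_cast this
      exact_mod_cast this
    have hT2 : 2 * (Real.pi / k) - β < D.T η := by nlinarith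
    obtain ⟨η', hη', hnη', hTη'⟩ := exists_T_eq_of_lt hc hη hnη
      (τ := 2 * Real.pi / k - β) (by rw [mul_div_assoc]; linarith) (by rw [mul_div_assoc]; exact hT2)
    obtain ⟨j, hj⟩ := exists_mul_sub_one_dvd hpk
    have h1 := re_lt_of_T_lt h₀ hη' (hn₀.trans hnη'.symm) (by
      rw [hT₀, hTη', mul_div_assoc]; linarith)
    have h2 := re_lt_of_T_lt hη' hη (hnη'.trans hnη.symm) (by
      rw [hTη', mul_div_assoc]; exact hT2)
    have h3 := hmin (unitExp k (2 * j) * conj (Complex.exp (η' / k)))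
      (by rw [hα]; exact F_rotate_conj_exp_of_T hk' hP hη' hnη' hTη' hj)
      (by
        rw [norm_mul, norm_unitExp, one_mul, Complex.norm_conj, norm_exp_div, norm_exp_div]
        exact hnorm_lt h1)
    rw [norm_mul, norm_unitExp, one_mul, Complex.norm_conj, norm_exp_div, norm_exp_div] at h3
    exact h3.not_gt (hnorm_lt h2)

/-- The points closest to the origin whose value is `c exp (i π / k)`. -/
lemma exists_closest_of_eq (hp : p ≠ 0) (hk : 2 ≤ k) (hpk : Nat.gcd p k = 1) (hP : D.P = p / k)
    (hc : 0 < c) {α : ℂ} (hα : α = c * Complex.exp ((Real.pi / k : ℝ) * Complex.I))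
    (hex : ∃ z, D.F p k z = α) {j : ℤ} (hj : (k : ℤ) ∣ j * p - 1) :
    (∃ η₀ ∈ ostrip, D.F p k (Complex.exp (η₀ / k)) = α ∧
      D.F p k (unitExp k (2 * j) * conj (Complex.exp (η₀ / k))) = α ∧
      ∀ z, D.F p k z = α → z ≠ Complex.exp (η₀ / k) →
        z ≠ unitExp k (2 * j) * conj (Complex.exp (η₀ / k)) → ‖Complex.exp (η₀ / k)‖ < ‖z‖) ∨
    (p = 1 ∧ ∃ a b X : ℝ, a < X ∧ b < X ∧ (∀ i, Real.exp X * D.u i < 1) ∧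
      D.F p k (Complex.exp (xy a Real.pi / k)) = α ∧
      D.F p k (Complex.exp (xy b Real.pi / k)) = α ∧
      ((a = b ∧ D.g (Real.exp a) = 0) ∨
        (a < b ∧ D.g (Real.exp a) ≠ 0 ∧ D.g (Real.exp b) ≠ 0)) ∧
      ∀ z, D.F p k z = α → z ≠ Complex.exp (xy a Real.pi / k) →
        z ≠ Complex.exp (xy b Real.pi / k) → ‖Complex.exp (xy b Real.pi / k)‖ < ‖z‖) := by
  have hk' : k ≠ 0 := by omega
  have hk0 : (0 : ℝ) < k := Nat.cast_pos.2 (by omega)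
  have hk2 : (2 : ℝ) ≤ k := by exact_mod_cast hk
  have hpi := Real.pi_pos
  have hδ : 2 * (Real.pi / k) ≤ Real.pi := by
    rw [← mul_div_assoc, div_le_iff₀ hk0]; nlinarith
  have hδ0 : 0 < Real.pi / k := by positivity
  have hclass := fun (z : ℂ) (hz : D.F p k z = α) =>
    exists_strip_point hp hk' hpk hP hc hδ0.le le_rfl (hz.trans hα)
  obtain ⟨η₀, h₀, hn₀, hT₀⟩ : ∃ η ∈ D.reg, ‖D.H η‖ = c ∧ D.T η = Real.pi / k := by
    obtain ⟨z, hz⟩ := hex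
    obtain ⟨η, hη, hnη, -, hle, -⟩ := hclass z hz
    rcases hle.eq_or_lt with h | h
    · exact ⟨η, hη, hnη, h.symm⟩
    · exact exists_T_eq_of_lt hc hη hnη hδ0.le h
  have hlower : η₀.im ≠ 0 := fun him => by
    obtain ⟨n, hn⟩ := exists_T_eq_of_im_eq_zero h₀ him
    rw [hT₀] at hn
    have h1 : (n : ℝ) < 1 := by nlinarith
    have h2 : 0 < (n : ℝ) := by
      by_contra! h
      nlinarith
    have h3 : n < 1 := by exact_mod_cast h1
    have h4 : 0 < n := by exact_mod_cast h2
    omega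
  have hnorm_lt : ∀ {η₁ η₂ : ℂ}, η₁.re < η₂.re → Real.exp (η₁.re / k) < Real.exp (η₂.re / k) :=
    fun h => Real.exp_lt_exp.2 (by gcongr)
  have hrot : ∀ {j' : ℤ}, (k : ℤ) ∣ j' * p - 1 → unitExp k (2 * j') = unitExp k (2 * j) := by
    intro j' hj'
    refine unitExp_congr hk' ?_
    have h1 : (k : ℤ) ∣ (j' - j) * p := by
      have := dvd_sub hj' hj
      rwa [show j' * p - 1 - (j * p - 1) = (j' - j) * p by ring] at this
    exact (Int.isCoprime_iff_gcd_eq_one.2 (by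
      rw [Int.gcd_natCast_natCast, Nat.gcd_comm]; exact hpk)).dvd_of_dvd_mul_right h1
  by_cases hedge : η₀.im = Real.pi
  · right
    -- On the upper edge `p π / k = P π ≤ T = π / k`, which leaves only `p = 1`.
    have hle := P_mul_im_le_T (D := D) h₀.1
    rw [hedge, hT₀, hP, div_mul_eq_mul_div, div_le_div_iff_of_pos_right hk0] at hle
    have hp1 : p = 1 := by
      have h1 : (p : ℝ) ≤ 1 := by nlinarith
      have h2 : p ≤ 1 := by exact_mod_cast h1
      omega
    have hPpi : D.P * Real.pi = Real.pi / k := by rw [hP, hp1]; push_cast; ring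
    have hP1 : D.P < 1 := by
      rw [hP, hp1, Nat.cast_one, div_lt_one hk0]; linarith
    obtain ⟨a, b, X, haX, hbX, hX, hna, hnb, hall, hab⟩ :=
      exists_edge_solutions hp hk' hP hP1 hc h₀ hedge (hT₀.trans hPpi.symm) hn₀
    have hu : ∀ s < X, ∀ i, Real.exp s * D.u i < 1 := fun s hs i =>
      (mul_le_mul_of_nonneg_right (Real.exp_le_exp.2 hs.le) (D.u_pos i).le).trans_lt (hX i)
    have hra := xy_pi_mem_reg (hu a haX)
    have hrb := xy_pi_mem_reg (hu b hbX)
    have hTa := (T_xy_pi (hu a haX)).trans hPpi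
    have hTb := (T_xy_pi (hu b hbX)).trans hPpi
    refine ⟨hp1, a, b, X, haX, hbX, hX, ?_, ?_, hab, fun z hz hza hzb => ?_⟩
    · rw [hα]; exact F_exp_of_T hk' hP hra hna hTa
    · rw [hα]; exact F_exp_of_T hk' hP hrb hnb hTb
    · obtain ⟨η, hη, hnη, hnz, hle, heq⟩ := hclass z hz
      rw [norm_exp_div, hnz]
      refine hnorm_lt (re_lt_of_T_lt hrb hη (hnb.trans hnη.symm) ?_)
      rw [hTb]
      refine lt_of_le_of_ne hle fun hT => ?_
      have him : η.im = Real.pi := by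
        rcases eq_or_sameEdge_of_T_eq hη hra (hnη.trans hna.symm) (hT.symm.trans hTa.symm) with h |
          ⟨-, e2⟩ | ⟨e1, -⟩
        · rw [h, xy_im]
        · rw [xy_im] at e2; exact absurd e2 hpi.ne'
        · exact e1
      -- For `p = 1` the reflected representation gives nothing new: the conjugate of a point on the
      -- ray of `e_1`, turned by `e_2`, is the point itself.
      have hzη : z = Complex.exp (η / k) := by
        rcases heq hT.symm with h | ⟨h, -⟩ | ⟨-, j', hj', h⟩
        · exact h
        · exact absurd h hδ0.ne'
        · have e1 : unitExp k (2 * j') = unitExp k (2 * 1) :=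
            unitExp_congr hk' (by rwa [hp1, Nat.cast_one, mul_one] at hj')
          rw [h, e1, mul_comm, show (2 * 1 : ℤ) = 1 + 1 by norm_num, unitExp_add, ← mul_assoc,
            conj_exp_div_mul_unitExp_one, mul_comm]
          have e2 : xy η.re Real.pi = η := by rw [← him, xy_eta]
          rw [← e2, exp_xy_pi_div, mul_comm]
          congr 1
          rw [exp_of_im_eq_zero]
          · rw [Complex.div_natCast_re, stripRefl_re, xy_re]
          · rw [Complex.div_natCast_im, stripRefl_im, xy_im, sub_self, zero_div]
      have e2 : xy η.re Real.pi = η := by rw [← him, xy_eta]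
      rcases hall η hη him (hT.symm.trans hPpi.symm) hnη with h | h
      · exact hza (by rw [hzη, ← h, e2])
      · exact hzb (by rw [hzη, ← h, e2])
  · left
    have ho : η₀ ∈ ostrip :=
      ⟨lt_of_le_of_ne h₀.1.1 (Ne.symm hlower), lt_of_le_of_ne h₀.1.2 hedge⟩
    refine ⟨η₀, ho, by rw [hα]; exact F_exp_of_T hk' hP h₀ hn₀ hT₀, ?_, fun z hz hz0 hz1 => ?_⟩
    · rw [hα]
      exact F_rotate_conj_exp_of_T hk' hP h₀ hn₀ (by rw [hT₀]; ring) hj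
    · obtain ⟨η, hη, hnη, hnz, hle, heq⟩ := hclass z hz
      rw [norm_exp_div, hnz]
      refine hnorm_lt (re_lt_of_T_lt h₀ hη (hn₀.trans hnη.symm) ?_)
      rw [hT₀]
      refine lt_of_le_of_ne hle fun hT => ?_
      have hηη : η = η₀ := by
        rcases eq_or_sameEdge_of_T_eq hη h₀ (hnη.trans hn₀.symm) (hT.symm.trans hT₀.symm) with h |
          ⟨-, e2⟩ | ⟨-, e2⟩
        · exact h
        · exact absurd e2 hlower
        · exact absurd e2 hedge
      rcases heq hT.symm with h | ⟨h, -⟩ | ⟨-, j', hj', h⟩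
      · exact hz0 (by rw [h, hηη])
      · exact absurd h hδ0.ne'
      · exact hz1 (by rw [h, hrot hj', hηη])

end StripData

/-! ### Transport by rotations and reflections. -/

/-- `Ψ` is a symmetry of the plane that takes the `α'`-points of `f` to its `α`-points. -/
structure IsAlphaSymmetry (f : ℂ → ℂ) (k : ℕ) (α α' : ℂ) (Ψ : ℂ → ℂ) : Prop where
  norm_eq : ∀ z, ‖Ψ z‖ = ‖z‖
  injective : Function.Injective Ψ
  surjective : Function.Surjective Ψ
  apply_eq_iff : ∀ z, f (Ψ z) = α ↔ f z = α'
  real_smul : ∀ (t : ℝ) z, Ψ (t * z) = t * Ψ z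
  pow_eq : ∀ z, Ψ z ^ k = z ^ k ∨ Ψ z ^ k = conj (z ^ k)

namespace StripData

variable {ι₁ ι₂ : Type*} {D : StripData ι₁ ι₂} {p k : ℕ} {c β : ℝ}

/-- As `m p ≡ q` modulo `k`, turning `z` by `e_{2m}` turns `F(z)` by `e_{2q}`. -/
lemma isAlphaSymmetry_rotate (hk : k ≠ 0) {q m : ℤ} (hm : (k : ℤ) ∣ m * p - q) {α α' : ℂ}
    (h : α = unitExp k (2 * q) * α') :
    IsAlphaSymmetry (D.F p k) k α α' fun z => unitExp k (2 * m) * z where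
  norm_eq z := by rw [norm_mul, norm_unitExp, one_mul]
  injective z z' hz := mul_left_cancel₀ (unitExp_ne_zero _ _) hz
  surjective z := ⟨z / unitExp k (2 * m), mul_div_cancel₀ _ (unitExp_ne_zero _ _)⟩
  apply_eq_iff z := by
    rw [F_rotate hk, unitExp_congr hk hm, h]
    exact mul_right_inj' (unitExp_ne_zero _ _)
  real_smul t z := by ring
  pow_eq z := Or.inl (by rw [mul_pow, unitExp_even_pow hk, one_mul])

lemma isAlphaSymmetry_rotate_conj (hk : k ≠ 0) {q m : ℤ} (hm : (k : ℤ) ∣ m * p - q) {α α' : ℂ}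
    (h : α = unitExp k (2 * q) * conj α') :
    IsAlphaSymmetry (D.F p k) k α α' fun z => unitExp k (2 * m) * conj z where
  norm_eq z := by rw [norm_mul, norm_unitExp, one_mul, Complex.norm_conj]
  injective z z' hz := (starRingEnd ℂ).injective (mul_left_cancel₀ (unitExp_ne_zero _ _) hz)
  surjective z := ⟨conj (z / unitExp k (2 * m)), by
    simp only [Complex.conj_conj]
    exact mul_div_cancel₀ _ (unitExp_ne_zero _ _)⟩
  apply_eq_iff z := by
    rw [F_rotate hk, F_conj, unitExp_congr hk hm, h, mul_right_inj' (unitExp_ne_zero _ _)]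
    exact (starRingEnd ℂ).injective.eq_iff
  real_smul t z := by rw [map_mul, Complex.conj_ofReal]; ring
  pow_eq z := Or.inr (by rw [mul_pow, unitExp_even_pow hk, one_mul, map_pow])

lemma isAlphaPoint_one_of_symmetry (hp : p ≠ 0) (hk : k ≠ 0) (hP : D.P = p / k) {α α' : ℂ}
    (hα : α ≠ 0) {Ψ : ℂ → ℂ} (hΨ : IsAlphaSymmetry (D.F p k) k α α' Ψ) {z : ℂ}
    (hz : D.F p k z = α') (hG : D.G (z ^ k) ≠ 0) : IsAlphaPointOfMult (D.F p k) α (Ψ z) 1 := by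
  have h := (hΨ.apply_eq_iff z).2 hz
  refine isAlphaPointOfMult_one h (deriv_F_ne_zero hp hk hP (by rwa [h]) ?_)
  rcases hΨ.pow_eq z with h1 | h1
  · rwa [h1]
  · rwa [h1, G_conj, map_ne_zero]

lemma isAlphaPoint_two_of_symmetry (hp : p ≠ 0) (hk : k ≠ 0) (hP : D.P = p / k) {α α' : ℂ}
    (hα : α ≠ 0) {Ψ : ℂ → ℂ} (hΨ : IsAlphaSymmetry (D.F p k) k α α' Ψ) {s X : ℝ}
    (hz : D.F p k (Complex.exp (xy s Real.pi / k)) = α') (hg : D.g (Real.exp s) = 0)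
    (hsX : s < X) (hX : ∀ i, Real.exp X * D.u i < 1) :
    IsAlphaPointOfMult (D.F p k) α (Ψ (Complex.exp (xy s Real.pi / k))) 2 := by
  have h := (hΨ.apply_eq_iff _).2 hz
  have hne : D.F p k (Ψ (Complex.exp (xy s Real.pi / k))) ≠ 0 := by rwa [h]
  have hpow : Ψ (Complex.exp (xy s Real.pi / k)) ^ k = -(Real.exp s : ℂ) := by
    have e := exp_div_pow hk (xy s Real.pi)
    rw [exp_xy_pi] at e
    rcases hΨ.pow_eq (Complex.exp (xy s Real.pi / k)) with h1 | h1
    · rw [h1, e]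
    · rw [h1, e, map_neg, Complex.conj_ofReal]
  have hd : deriv (D.F p k) (Ψ (Complex.exp (xy s Real.pi / k))) = 0 := by
    rw [(hasDerivAt_F hp hk hP hne).deriv, hpow, G_neg_ofReal, hg]
    simp
  exact isAlphaPointOfMult_two h hd (deriv_deriv_F_ne_zero hp hk hP hne hpow hsX hX hd)

lemma closest_of_symmetry_of_lt (hp : p ≠ 0) (hk : 2 ≤ k) (hpk : Nat.gcd p k = 1)
    (hP : D.P = p / k) (hc : 0 < c) (hβ0 : 0 ≤ β) (hβ : β < Real.pi / k) {α α' : ℂ}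
    (hα' : α' = c * Complex.exp (β * Complex.I)) (hα : α ≠ 0) {Ψ : ℂ → ℂ}
    (hΨ : IsAlphaSymmetry (D.F p k) k α α' Ψ) (hex : ∃ z, D.F p k z = α) :
    ∃ η₀, IsAlphaPointOfMult (D.F p k) α (Ψ (Complex.exp (η₀ / k))) 1 ∧
      (∀ z, D.F p k z = α → z ≠ Ψ (Complex.exp (η₀ / k)) →
        ‖Ψ (Complex.exp (η₀ / k))‖ < ‖z‖) ∧
      (∀ z, IsNextAlphaPoint (D.F p k) α (Ψ (Complex.exp (η₀ / k))) z →
        Complex.arg z ≠ Complex.arg (Ψ (Complex.exp (η₀ / k)))) ∧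
      (0 < β → η₀ ∈ ostrip) ∧ (β = 0 → η₀.im = 0) := by
  have hk' : k ≠ 0 := by omega
  have hex' : ∃ z, D.F p k z = α' := by
    obtain ⟨z, hz⟩ := hex
    obtain ⟨z', rfl⟩ := hΨ.surjective z
    exact ⟨z', (hΨ.apply_eq_iff z').1 hz⟩
  obtain ⟨η₀, -, hF, hG, hmin, hnext, h1, h2⟩ :=
    exists_closest_of_lt hp hk hpk hP hc hβ0 hβ hα' hex'
  refine ⟨η₀, isAlphaPoint_one_of_symmetry hp hk' hP hα hΨ hF (by rwa [exp_div_pow hk']), ?_, ?_,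
    h1, h2⟩
  · intro z hz hne
    obtain ⟨z', rfl⟩ := hΨ.surjective z
    rw [hΨ.norm_eq, hΨ.norm_eq]
    exact hmin z' ((hΨ.apply_eq_iff z').1 hz) fun h => hne (by rw [h])
  · rintro z ⟨hz, hlt, hleast⟩ harg
    obtain ⟨z', rfl⟩ := hΨ.surjective z
    have hn0 : 0 < ‖Ψ (Complex.exp (η₀ / k))‖ := by
      rw [hΨ.norm_eq]
      exact norm_pos_iff.2 (Complex.exp_ne_zero _)
    -- Equal arguments make the next point a positive real multiple of the closest one, the factor
    -- being the ratio of the moduli; `Ψ` respects real factors.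
    refine hnext z' ⟨(hΨ.apply_eq_iff z').1 hz, ?_, fun y hy hylt => ?_⟩
      (‖Ψ z'‖ / ‖Ψ (Complex.exp (η₀ / k))‖) (div_pos (hn0.trans hlt) hn0) ?_
    · rwa [hΨ.norm_eq, hΨ.norm_eq] at hlt
    · have := hleast (Ψ y) ((hΨ.apply_eq_iff y).2 hy) (by rwa [hΨ.norm_eq, hΨ.norm_eq])
      rwa [hΨ.norm_eq, hΨ.norm_eq] at this
    · refine hΨ.injective ?_
      rw [hΨ.real_smul]
      conv_lhs => rw [← Complex.norm_mul_exp_arg_mul_I (Ψ z'), harg]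
      conv_rhs => rw [← Complex.norm_mul_exp_arg_mul_I (Ψ (Complex.exp (η₀ / k)))]
      have : (‖Ψ (Complex.exp (η₀ / k))‖ : ℂ) ≠ 0 := Complex.ofReal_ne_zero.2 hn0.ne'
      simp only [Complex.norm_mul, Complex.norm_real, norm_norm, Complex.norm_exp_ofReal_mul_I,
        mul_one]
      push_cast
      field_simp

lemma closest_of_symmetry_of_eq (hp : p ≠ 0) (hk : 2 ≤ k) (hpk : Nat.gcd p k = 1)
    (hP : D.P = p / k) (hc : 0 < c) {α α' : ℂ}
    (hα' : α' = c * Complex.exp ((Real.pi / k : ℝ) * Complex.I)) (hα : α ≠ 0) {Ψ : ℂ → ℂ}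
    (hΨ : IsAlphaSymmetry (D.F p k) k α α' Ψ) (hex : ∃ z, D.F p k z = α)
    {j : ℤ} (hj : (k : ℤ) ∣ j * p - 1) :
    (∃ η₀ ∈ ostrip, IsAlphaPointOfMult (D.F p k) α (Ψ (Complex.exp (η₀ / k))) 1 ∧
      IsAlphaPointOfMult (D.F p k) α (Ψ (unitExp k (2 * j) * conj (Complex.exp (η₀ / k)))) 1 ∧
      ∀ z, D.F p k z = α → z ≠ Ψ (Complex.exp (η₀ / k)) →
        z ≠ Ψ (unitExp k (2 * j) * conj (Complex.exp (η₀ / k))) →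
        ‖Ψ (Complex.exp (η₀ / k))‖ < ‖z‖) ∨
    (p = 1 ∧ ∃ a b : ℝ,
      ((a = b ∧ IsAlphaPointOfMult (D.F p k) α (Ψ (Complex.exp (xy a Real.pi / k))) 2) ∨
        (a < b ∧ IsAlphaPointOfMult (D.F p k) α (Ψ (Complex.exp (xy a Real.pi / k))) 1 ∧
          IsAlphaPointOfMult (D.F p k) α (Ψ (Complex.exp (xy b Real.pi / k))) 1)) ∧
      ∀ z, D.F p k z = α → z ≠ Ψ (Complex.exp (xy a Real.pi / k)) →
        z ≠ Ψ (Complex.exp (xy b Real.pi / k)) →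
        ‖Ψ (Complex.exp (xy b Real.pi / k))‖ < ‖z‖) := by
  have hk' : k ≠ 0 := by omega
  have hex' : ∃ z, D.F p k z = α' := by
    obtain ⟨z, hz⟩ := hex
    obtain ⟨z', rfl⟩ := hΨ.surjective z
    exact ⟨z', (hΨ.apply_eq_iff z').1 hz⟩
  rcases exists_closest_of_eq hp hk hpk hP hc hα' hex' hj with
    ⟨η₀, ho, hF0, hF1, hmin⟩ | ⟨hp1, a, b, X, haX, hbX, hX, hFa, hFb, hab, hmin⟩
  · left
    have hG := G_ne_zero_of_im_ne_zero (D := D) (exp_im_pos ho).ne'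
    refine ⟨η₀, ho, isAlphaPoint_one_of_symmetry hp hk' hP hα hΨ hF0 (by rwa [exp_div_pow hk']),
      isAlphaPoint_one_of_symmetry hp hk' hP hα hΨ hF1 ?_, fun z hz h0 h1 => ?_⟩
    · rw [mul_pow, unitExp_even_pow hk', one_mul, ← map_pow, exp_div_pow hk', G_conj]
      rwa [map_ne_zero]
    · obtain ⟨z', rfl⟩ := hΨ.surjective z
      rw [hΨ.norm_eq, hΨ.norm_eq]
      exact hmin z' ((hΨ.apply_eq_iff z').1 hz) (fun h => h0 (by rw [h])) fun h => h1 (by rw [h])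
  · right
    have hG : ∀ s, D.g (Real.exp s) ≠ 0 → D.G (Complex.exp (xy s Real.pi / k) ^ k) ≠ 0 := by
      intro s hs
      rw [exp_div_pow hk', exp_xy_pi, G_neg_ofReal]
      exact Complex.ofReal_ne_zero.2 hs
    refine ⟨hp1, a, b, ?_, fun z hz h0 h1 => ?_⟩
    · rcases hab with ⟨h, hg⟩ | ⟨h, hga, hgb⟩
      · exact Or.inl ⟨h, isAlphaPoint_two_of_symmetry hp hk' hP hα hΨ hFa hg haX hX⟩
      · exact Or.inr ⟨h, isAlphaPoint_one_of_symmetry hp hk' hP hα hΨ hFa (hG a hga),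
          isAlphaPoint_one_of_symmetry hp hk' hP hα hΨ hFb (hG b hgb)⟩
    · obtain ⟨z', rfl⟩ := hΨ.surjective z
      rw [hΨ.norm_eq, hΨ.norm_eq]
      exact hmin z' ((hΨ.apply_eq_iff z').1 hz) (fun h => h0 (by rw [h])) fun h => h1 (by rw [h])

end StripData

/-! ### Sectors, arguments and signs. -/

section Sectors

variable {k : ℕ}

lemma arg_exp_div (hk : 0 < k) {η : ℂ} (hη : η ∈ ostrip) :
    Complex.arg (Complex.exp (η / k)) = η.im / k := by
  have hk1 : (1 : ℝ) ≤ k := by exact_mod_cast hk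
  have h1 : 0 < (η / k).im := by
    rw [Complex.div_natCast_im]
    exact div_pos hη.1 (by linarith)
  have h2 : (η / k).im ≤ Real.pi := by
    rw [Complex.div_natCast_im]
    exact (div_le_self hη.1.le hk1).trans hη.2.le
  rw [← Complex.log_im, Complex.log_exp (by linarith [Real.pi_pos]) h2, Complex.div_natCast_im]

lemma mem_openSector (hk : 0 < k) (s : ℤ) {η : ℂ} (hη : η ∈ ostrip) :
    unitExp k s * Complex.exp (η / k) ∈ openSector k s := by
  have hk1 : (0 : ℝ) < k := Nat.cast_pos.2 hk
  have e : unitExp k s * Complex.exp (η / k) * unitExp k (-s) = Complex.exp (η / k) := by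
    rw [mul_right_comm, ← unitExp_add, add_neg_cancel, unitExp_zero, one_mul]
  refine ⟨mul_ne_zero (unitExp_ne_zero _ _) (Complex.exp_ne_zero _), ?_, ?_⟩
  · rw [e, arg_exp_div hk hη]
    exact div_pos hη.1 hk1
  · rw [e, arg_exp_div hk hη]
    gcongr
    exact hη.2

/-- Conjugation carries `Q_0` to `Q_{-1}`, hence the shift of the index by one. -/
lemma conj_mem_openSector (hk : 0 < k) (s : ℤ) {η : ℂ} (hη : η ∈ ostrip) :
    unitExp k s * conj (Complex.exp (η / k)) ∈ openSector k (s - 1) := by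
  have e : unitExp k s * conj (Complex.exp (η / k))
      = unitExp k (s - 1) * Complex.exp (stripRefl η / k) := by
    rw [← conj_exp_div_mul_unitExp_one, mul_comm (conj _), ← mul_assoc, ← unitExp_add,
      sub_add_cancel]
  rw [e]
  refine mem_openSector hk _ ⟨?_, ?_⟩ <;> rw [stripRefl_im]
  · linarith [hη.2]
  · linarith [hη.1]

lemma exists_rep_of_mem_halfOpenSector {s : ℤ} {α : ℂ} (h : α ∈ halfOpenSector k s) :
    ∃ c φ : ℝ, 0 < c ∧ 0 ≤ φ ∧ φ < Real.pi / k ∧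
      α = unitExp k s * (c * Complex.exp (φ * Complex.I)) ∧
      (α ∈ openSector k s → 0 < φ) := by
  refine ⟨‖α * unitExp k (-s)‖, Complex.arg (α * unitExp k (-s)),
    norm_pos_iff.2 (mul_ne_zero h.1 (unitExp_ne_zero _ _)), h.2.1, h.2.2, ?_, fun h' => h'.2.1⟩
  rw [Complex.norm_mul_exp_arg_mul_I, mul_comm α, ← mul_assoc, ← unitExp_add, add_neg_cancel,
    unitExp_zero, one_mul]

lemma ofReal_mul_exp_im (c φ : ℝ) : ((c : ℂ) * Complex.exp (φ * Complex.I)).im = c * Real.sin φ := by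
  rw [Complex.im_ofReal_mul, Complex.exp_ofReal_mul_I_im]

lemma pos_ofReal_mul_exp_iff {c φ : ℝ} (hc : 0 < c) (h1 : -Real.pi < φ) (h2 : φ < Real.pi) :
    0 < (c : ℂ) * Complex.exp (φ * Complex.I) ↔ φ = 0 := by
  constructor
  · intro h
    have him := (Complex.lt_def.1 h).2
    rw [ofReal_mul_exp_im, Complex.zero_im] at him
    have hs := (mul_eq_zero.1 him.symm).resolve_left hc.ne'
    exact (Real.sin_eq_zero_iff_of_lt_of_lt h1 h2).1 hs
  · rintro rfl
    simpa using hc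

lemma unitExp_mul_ofReal_mul_exp (k : ℕ) (s : ℤ) (c φ : ℝ) :
    unitExp k s * (c * Complex.exp (φ * Complex.I))
      = c * Complex.exp ((φ + s / k * Real.pi : ℝ) * Complex.I) := by
  rw [unitExp, mul_left_comm, ← Complex.exp_add]
  congr 2
  push_cast
  ring

lemma openSector_congr (hk : k ≠ 0) {i j : ℤ} (h : (k : ℤ) ∣ i - j) :
    openSector k (2 * i) = openSector k (2 * j) := by
  have h' : (k : ℤ) ∣ -i - -j := by
    rw [show -i - -j = -(i - j) by ring]
    exact (dvd_neg).2 h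
  have := unitExp_congr hk h'
  rw [mul_neg, mul_neg] at this
  unfold openSector
  rw [this]

end Sectors

lemma meroF_eq {ι₁ ι₂ : Type*} (p k : ℕ) (A : ℝ) (a : ι₁ → ℝ) (b : ι₂ → ℝ) (z : ℂ) :
    meroF p k A a b z = z ^ p * Complex.exp (A * z ^ k) * linProd (fun ν => (a ν)⁻¹) (z ^ k) /
      linProd (fun μ => (b μ)⁻¹) (-z ^ k) := by
  simp only [meroF, linProd, Complex.ofReal_inv, div_eq_mul_inv, neg_mul, sub_eq_add_neg]

lemma mul_exp_pow (c φ : ℝ) (k : ℕ) : ((c : ℂ) * Complex.exp (φ * Complex.I)) ^ k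
    = ((c ^ k : ℝ) : ℂ) * Complex.exp ((k * φ : ℝ) * Complex.I) := by
  rw [mul_pow, ← Complex.exp_nat_mul]
  push_cast
  ring_nf

lemma not_mul_exp_neg {c φ : ℝ} (hc : 0 < c) (h0 : 0 ≤ φ) (h1 : φ < Real.pi) :
    ¬ (c : ℂ) * Complex.exp (φ * Complex.I) < 0 := by
  intro h
  have him := (Complex.lt_def.1 h).2
  rw [ofReal_mul_exp_im, Complex.zero_im] at him
  have hs := (mul_eq_zero.1 him).resolve_left hc.ne'
  have hφ := (Real.sin_eq_zero_iff_of_lt_of_lt (by linarith) h1).1 hs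
  exact lt_asymm h ((pos_ofReal_mul_exp_iff hc (by linarith) h1).2 hφ)

lemma unitExp_odd_pow {k : ℕ} (hk : k ≠ 0) (q : ℤ) : unitExp k (2 * q - 1) ^ k = -1 := by
  rw [sub_eq_add_neg, unitExp_add, mul_pow, unitExp_even_pow hk, one_mul, unitExp,
    ← Complex.exp_nat_mul]
  rw [show (k : ℂ) * ((((-1 : ℤ) : ℝ) / (k : ℝ) * Real.pi : ℝ) * Complex.I)
    = -(Real.pi * Complex.I) by
      have : (k : ℂ) ≠ 0 := Nat.cast_ne_zero.2 hk
      push_cast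
      field_simp]
  rw [Complex.exp_neg, Complex.exp_pi_mul_I]
  norm_num

lemma conj_edge_mul_unitExp (k : ℕ) (m : ℤ) (s : ℝ) :
    unitExp k (2 * m) * conj (Complex.exp (xy s Real.pi / k)) * unitExp k (-2 * m + 1)
      = (Real.exp (s / k) : ℂ) := by
  rw [exp_xy_pi_div, map_mul, Complex.conj_ofReal, conj_unitExp]
  rw [show unitExp k (2 * m) * ((Real.exp (s / k) : ℂ) * unitExp k (-1)) * unitExp k (-2 * m + 1)
    = (Real.exp (s / k) : ℂ) * (unitExp k (2 * m) * unitExp k (-1) * unitExp k (-2 * m + 1)) by ring]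
  rw [← unitExp_add, ← unitExp_add, show 2 * m + -1 + (-2 * m + 1) = 0 by ring, unitExp_zero,
    mul_one]

end

/-! ### Reduction of the theorem to normalized position. -/

theorem mainTheorem6 {ι₁ ι₂ : Type*} (p k : ℕ) (hp : 0 < p) (hk : 2 ≤ k) (hpk : Nat.gcd p k = 1)
    (A : ℝ) (hA : 0 ≤ A)
    (a : ι₁ → ℝ) (ha : ∀ ν, 0 < a ν) (ha_sum : Summable fun ν => (a ν)⁻¹)
    (b : ι₂ → ℝ) (hb : ∀ μ, 0 < b μ) (hb_sum : Summable fun μ => (b μ)⁻¹)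
    (F : ℂ → ℂ) (hF : F = meroF p k A a b) (hF_ne : ∃ z, F z ≠ z ^ p)
    (α : ℂ) (hα : α ≠ 0) (h_ne : ∃ z, F z = α)
    (q ϰ m : ℤ) (hϰ : ϰ = 0 ∨ ϰ = 1) (hq : α ∈ halfOpenSector k (2 * q - ϰ))
    (hm : (p : ℤ) * m ≡ q [ZMOD k]) :
    (¬ α ^ k < 0 →
      ∃ z₀, IsAlphaPointOfMult F α z₀ 1 ∧
        (∀ z, F z = α → z ≠ z₀ → ‖z₀‖ < ‖z‖) ∧
        (∀ z, IsNextAlphaPoint F α z₀ z → Complex.arg z ≠ Complex.arg z₀) ∧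
        (α ∈ openSector k (2 * q - ϰ) → z₀ ∈ openSector k (2 * m - ϰ)) ∧
        (0 < α * unitExp k (-2 * q) → 0 < z₀ * unitExp k (-2 * m))) ∧
    (α ^ k < 0 ↔ 0 < α * unitExp k (-2 * q + 1)) ∧
    (α ^ k < 0 → ∀ m' : ℤ, (p : ℤ) * m' ≡ q - 1 [ZMOD k] →
      (∀ s : ℤ, (α * unitExp k (p * s)).im = 0 →
        openSector k (2 * m') = openSector k (-2 * m - 2 * s)) ∧
      ((∃ z₀ z₁, z₀ ≠ z₁ ∧ ‖z₀‖ = ‖z₁‖ ∧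
          IsAlphaPointOfMult F α z₀ 1 ∧ IsAlphaPointOfMult F α z₁ 1 ∧
          (∀ z, F z = α → z ≠ z₀ → z ≠ z₁ → ‖z₀‖ < ‖z‖) ∧
          z₀ ∈ openSector k (2 * m - 1) ∧ z₁ ∈ openSector k (2 * m')) ∨
        (p = 1 ∧ ∃ z₀ z₁, 0 < z₀ * unitExp k (-2 * m + 1) ∧ 0 < z₁ * unitExp k (-2 * m + 1) ∧
          ((z₀ = z₁ ∧ IsAlphaPointOfMult F α z₀ 2) ∨
            (‖z₀‖ < ‖z₁‖ ∧ IsAlphaPointOfMult F α z₀ 1 ∧ IsAlphaPointOfMult F α z₁ 1)) ∧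
          (∀ z, F z = α → z ≠ z₀ → z ≠ z₁ → ‖z₁‖ < ‖z‖)))) := by
  have hk' : k ≠ 0 := by omega
  have hkpos : 0 < k := by omega
  have hp' : p ≠ 0 := hp.ne'
  have hk0 : (0 : ℝ) < k := Nat.cast_pos.2 hkpos
  have hk2 : (2 : ℝ) ≤ k := by exact_mod_cast hk
  have hpi := Real.pi_pos
  have hπk : 0 < Real.pi / k := by positivity
  have hδ : 2 * (Real.pi / k) ≤ Real.pi := by
    rw [← mul_div_assoc, div_le_iff₀ hk0]; nlinarith
  have hkπ : ∀ {φ : ℝ}, φ < Real.pi / k → k * φ < Real.pi := fun h => by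
    rw [mul_comm]; exact (lt_div_iff₀ hk0).1 h
  have hnc : 0 < A ∨ Nonempty ι₁ ∨ Nonempty ι₂ := by
    by_contra! h
    obtain ⟨h1, h2, h3⟩ := h
    obtain ⟨z, hz⟩ := hF_ne
    refine hz ?_
    rw [hF, meroF, le_antisymm h1 hA]
    simp
  let D : StripData ι₁ ι₂ :=
    { P := p / k, A := A, u := fun ν => (a ν)⁻¹, v := fun μ => (b μ)⁻¹
      P_pos := div_pos (Nat.cast_pos.2 hp) hk0
      A_nonneg := hA
      u_pos := fun i => inv_pos.2 (ha i)
      v_pos := fun i => inv_pos.2 (hb i)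
      u_sum := ha_sum
      v_sum := hb_sum
      nonconst := hnc }
  have hP : D.P = p / k := rfl
  have hFD : F = D.F p k := hF.trans (funext (meroF_eq p k A a b))
  clear_value D
  subst hFD
  have hm' : (k : ℤ) ∣ m * p - q := by
    have := hm.symm.dvd
    rwa [mul_comm] at this
  obtain ⟨c, φ, hc, hφ0, hφ, hαφ, hopen⟩ := exists_rep_of_mem_halfOpenSector hq
  have hck : 0 < c ^ k := pow_pos hc k
  have hkφ0 : 0 ≤ k * φ := by positivity
  -- For `ϰ = 0` a rotation normalizes `α` with `β = φ`. For `ϰ = 1` a rotation with reflection does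
  -- so with `β = π / k - φ`, and the exceptional case `β = π / k` is `φ = 0`, which is `α ^ k < 0`.
  rcases hϰ with rfl | rfl
  · rw [sub_zero] at hαφ hopen
    have hneg : ¬ α ^ k < 0 := by
      rw [hαφ, mul_pow, unitExp_even_pow hk', one_mul, mul_exp_pow]
      exact not_mul_exp_neg hck hkφ0 (hkπ hφ)
    have hpos : ¬ 0 < α * unitExp k (-2 * q + 1) := by
      rw [hαφ, mul_comm, ← mul_assoc, ← unitExp_add, show -2 * q + 1 + 2 * q = 1 by ring,
        unitExp_mul_ofReal_mul_exp]
      have e : φ + ((1 : ℤ) : ℝ) / k * Real.pi = φ + Real.pi / k := by push_cast; ring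
      rw [e, pos_ofReal_mul_exp_iff hc (by linarith) (by linarith)]
      linarith
    refine ⟨fun _ => ?_, iff_of_false hneg hpos, fun h => absurd h hneg⟩
    obtain ⟨η₀, h1, h2, h3, h4, h5⟩ := StripData.closest_of_symmetry_of_lt hp' hk hpk hP hc hφ0 hφ
      rfl hα (StripData.isAlphaSymmetry_rotate hk' hm' hαφ) h_ne
    refine ⟨_, h1, h2, h3, fun ho => ?_, fun h => ?_⟩
    · rw [sub_zero] at ho ⊢
      exact mem_openSector hkpos _ (h4 (hopen ho))
    · rw [hαφ, mul_comm, ← mul_assoc, ← unitExp_add, show -2 * q + 2 * q = 0 by ring,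
        unitExp_zero, one_mul, pos_ofReal_mul_exp_iff hc (by linarith) (by linarith)] at h
      have him : (η₀ / k).im = 0 := by rw [Complex.div_natCast_im, h5 h, zero_div]
      rw [mul_right_comm, ← unitExp_add, show 2 * m + -2 * m = 0 by ring, unitExp_zero, one_mul,
        exp_of_im_eq_zero him]
      exact_mod_cast Real.exp_pos _
  · have hneg : α ^ k < 0 ↔ φ = 0 := by
      rw [hαφ, mul_pow, unitExp_odd_pow hk', mul_exp_pow, neg_one_mul, neg_lt_zero,
        pos_ofReal_mul_exp_iff hck (by linarith) (hkπ hφ), mul_eq_zero]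
      exact or_iff_right hk0.ne'
    have hpos : 0 < α * unitExp k (-2 * q + 1) ↔ φ = 0 := by
      rw [hαφ, mul_comm, ← mul_assoc, ← unitExp_add, show -2 * q + 1 + (2 * q - 1) = 0 by ring,
        unitExp_zero, one_mul, pos_ofReal_mul_exp_iff hc (by linarith) (by linarith)]
    have hα' : α = unitExp k (2 * q) *
        conj (c * Complex.exp ((Real.pi / k - φ : ℝ) * Complex.I)) := by
      rw [hαφ, sub_eq_add_neg (2 * q), unitExp_add, mul_assoc, unitExp_mul_ofReal_mul_exp, map_mul,
        Complex.conj_ofReal, ← Complex.exp_conj]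
      congr 3
      simp only [map_mul, Complex.conj_ofReal, Complex.conj_I]
      push_cast
      ring
    have hΨ := StripData.isAlphaSymmetry_rotate_conj (D := D) hk' hm' hα'
    refine ⟨fun hn => ?_, hneg.trans hpos.symm, fun hn m₁ hm₁ => ?_⟩
    · have hφpos : 0 < φ := lt_of_le_of_ne hφ0 fun h => hn (hneg.2 h.symm)
      obtain ⟨η₀, h1, h2, h3, h4, h5⟩ := StripData.closest_of_symmetry_of_lt hp' hk hpk hP hc
        (by linarith) (by linarith) rfl hα hΨ h_ne
      refine ⟨_, h1, h2, h3, fun _ => conj_mem_openSector hkpos _ (h4 (by linarith)), fun h => ?_⟩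
      -- The argument of `α e_{-2q}` is `φ - π / k < 0`, so this number is not positive.
      exfalso
      rw [hαφ, mul_comm, ← mul_assoc, ← unitExp_add, show -2 * q + (2 * q - 1) = -1 by ring,
        unitExp_mul_ofReal_mul_exp] at h
      have e : φ + ((-1 : ℤ) : ℝ) / k * Real.pi = φ - Real.pi / k := by push_cast; ring
      rw [e, pos_ofReal_mul_exp_iff hc (by linarith) (by linarith)] at h
      linarith
    · have hφz : φ = 0 := hneg.1 hn
      have hm₁' : (k : ℤ) ∣ p * m₁ - (q - 1) := hm₁.symm.dvd
      constructor
      · intro s hs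
        rw [show -2 * m - 2 * s = 2 * (-m - s) by ring]
        refine openSector_congr hk' ?_
        -- A real `α e_{ps}` means `p s ≡ 1 - 2 q` modulo `k`. Adding the congruences for `m` and
        -- `m₁` gives `p (m₁ + m + s) ≡ 0`.
        have h1 : (k : ℤ) ∣ 2 * q - 1 + p * s := by
          rw [hαφ, mul_comm, ← mul_assoc, ← unitExp_add, unitExp_mul_ofReal_mul_exp,
            ofReal_mul_exp_im, hφz, zero_add] at hs
          obtain ⟨n, hn⟩ := Real.sin_eq_zero_iff.1 ((mul_eq_zero.1 hs).resolve_left hc.ne')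
          have h2 : (n : ℝ) = ((p * s + (2 * q - 1) : ℤ) : ℝ) / k :=
            mul_right_cancel₀ hpi.ne' hn
          rw [eq_div_iff hk0.ne'] at h2
          have h3 : n * k = p * s + (2 * q - 1) := by exact_mod_cast h2
          exact ⟨n, by linarith⟩
        have h2 : (k : ℤ) ∣ (m₁ - (-m - s)) * p := by
          have := dvd_add (dvd_add hm₁' hm') h1
          rwa [show p * m₁ - (q - 1) + (m * p - q) + (2 * q - 1 + p * s)
            = (m₁ - (-m - s)) * p by ring] at this
        exact (Int.isCoprime_iff_gcd_eq_one.2 (by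
          rw [Int.gcd_natCast_natCast, Nat.gcd_comm]; exact hpk)).dvd_of_dvd_mul_right h2
      -- With `j = m - m₁` the second point becomes `e_{2m - 2j} = e_{2m₁}` times the unreflected
      -- one, which places it in the required sector.
      · have hj : (k : ℤ) ∣ (m - m₁) * p - 1 := by
          have := dvd_sub hm' hm₁'
          rwa [show m * p - q - (p * m₁ - (q - 1)) = (m - m₁) * p - 1 by ring] at this
        rw [hφz, sub_zero] at hΨ
        rcases StripData.closest_of_symmetry_of_eq hp' hk hpk hP hc rfl hα hΨ h_ne hj with
          ⟨η₀, ho, h0, h1, hmin⟩ | ⟨hp1, s, t, hst, hmin⟩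
        · left
          refine ⟨_, _, fun heq => ?_, ?_, h0, h1, hmin, conj_mem_openSector hkpos _ ho, ?_⟩
          -- Equal points would have equal `k`-th powers, making `exp η₀` real.
          · have h2 := congrArg (· ^ k) (hΨ.injective heq)
            simp only [mul_pow] at h2
            rw [unitExp_even_pow hk', one_mul, ← map_pow, exp_div_pow hk'] at h2
            exact (exp_im_pos ho).ne' (Complex.conj_eq_iff_im.1 h2.symm)
          · rw [hΨ.norm_eq, hΨ.norm_eq, norm_mul, norm_unitExp, one_mul, Complex.norm_conj]
          · rw [map_mul, Complex.conj_conj, conj_unitExp, ← mul_assoc, ← unitExp_add,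
              show 2 * m + -(2 * (m - m₁)) = 2 * m₁ by ring]
            exact mem_openSector hkpos _ ho
        · right
          have hray : ∀ s : ℝ, 0 < unitExp k (2 * m) * conj (Complex.exp (xy s Real.pi / k)) *
              unitExp k (-2 * m + 1) := fun s => by
            rw [conj_edge_mul_unitExp]
            exact_mod_cast Real.exp_pos _
          refine ⟨hp1, _, _, hray s, hray t, ?_, hmin⟩
          rcases hst with ⟨rfl, h⟩ | ⟨hlt, h0, h1⟩
          · exact Or.inl ⟨rfl, h⟩
          · refine Or.inr ⟨?_, h0, h1⟩
            rw [hΨ.norm_eq, hΨ.norm_eq, norm_exp_div, norm_exp_div, xy_re, xy_re, Real.exp_lt_exp]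
            gcongr
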